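/- Conventions. $B_t\subset\mathbf R^3$ is the closed ball of radius $t$ centred at $0$. Surfaces are compact and smoothly embedded, possibly disconnected; a minimal surface is one with zero mean curvature. The genus $\mathrm{gen}(\Sigma)$ of a compact orientable surface $\Sigma$ with boundary is the genus of the closed surface obtained by adding a disk to each boundary circle, where the genus of a closed surface is the maximal number of pairwise disjoint simple closed curves whose removal disconnects none of its components (so genus is additive over components). If $0\in\Sigma$, then $\Sigma_{0,t}$ denotes the connected component of $B_t\cap\Sigma$ containing $0$. Intersections with balls are considered at radii $t$ for which $\partial B_t$ meets the surface transversally, so that $\Sigma_{0,t}$ is a compact surface with boundary. Proposition. Let $g\ge 0$ be an integer, let $S_i\to\infty$, and let $\Sigma_i$ ($i\ge 0$) be compact embedded minimal surfaces with $0\in\Sigma_i\subset B_{S_i}\subset\mathbf R^3$, $\partial\Sigma_i\subset\partial B_{S_i}$ and $\mathrm{gen}(\Sigma_i)\le g$. Then there are a subsequence $\Sigma_j$ (with radii $S_j$), a radius $R_0>0$ and radii $R_j\to\infty$ with $R_0\le R_j\le S_j$, such that $\partial B_{R_0}$ and $\partial B_{R_j}$ meet $\Sigma_j$ transversally for every $j$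 and, writing $\Sigma_{j,0,t}$ for the component of $B_t\cap\Sigma_j$ containing $0$, $$\mathrm{gen}(\Sigma_{j,0,R_0})=\mathrm{gen}(\Sigma_{j,0,R_j})\le g\qquad\text{for all } j,$$ and at least one of the following holds: (a) for all $j$ and all $t\in[R_0,R_j]$ for which $\partial B_t$ meets $\Sigma_j$ transversally, $\partial\Sigma_{j,0,t}$ is (nonempty and) connected; (b) for all $j$, $\partial\Sigma_{j,0,R_0}$ is disconnected. -/

import Mathlib

open Set Filter Topology Metric
open scoped ContDiff

/-- Euclidean three-space. -/
abbrev E3 : Type := EuclideanSpace ℝ (Fin 3)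

/-- `f` is a smooth defining function of `M` on the open set `U`: `∇ f` does not vanish on `U`, and
`M ∩ U` is the zero set of `f` in `U`. -/
structure IsDefiningFunction (M U : Set E3) (f : E3 → ℝ) : Prop where
  isOpen : IsOpen U
  smooth : ContDiffOn ℝ ∞ f U
  regular : ∀ x ∈ U, gradient f x ≠ 0
  eq_zeros : M ∩ U = {x | x ∈ U ∧ f x = 0}

/-- `p` is an interior point of the embedded surface (with boundary) `M`. -/
def IsInteriorPoint (M : Set E3) (p : E3) : Prop :=
  p ∈ M ∧ ∃ (U : Set E3) (f : E3 → ℝ), p ∈ U ∧ IsDefiningFunction M U f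

/-- `p` is a boundary point of the embedded surface with boundary `M`: near `p`, the set `M` is
`{f = 0, h ≤ 0}` with `∇ f`, `∇ h` linearly independent, and `f p = h p = 0`. -/
def IsBoundaryPoint (M : Set E3) (p : E3) : Prop :=
  ∃ (U : Set E3) (f h : E3 → ℝ), IsOpen U ∧ p ∈ U ∧
    ContDiffOn ℝ ∞ f U ∧ ContDiffOn ℝ ∞ h U ∧
    (∀ x ∈ U, LinearIndependent ℝ ![gradient f x, gradient h x]) ∧
    M ∩ U = {x | x ∈ U ∧ f x = 0 ∧ h x ≤ 0} ∧ f p = 0 ∧ h p = 0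

/-- The boundary `∂M` of an embedded surface with boundary. -/
def surfaceBoundary (M : Set E3) : Set E3 := {p | IsBoundaryPoint M p}

/-- The mean curvature `div (∇ f / |∇ f|)` at `x` of the level set of `f` through `x` (the sum of
the principal curvatures, up to the choice of the unit normal). -/
noncomputable def levelSetMeanCurvature (f : E3 → ℝ) (x : E3) : ℝ :=
  ∑ i : Fin 3,
    (fderiv ℝ (fun y : E3 => ‖gradient f y‖⁻¹ • gradient f y) x (EuclideanSpace.single i 1)) i

/-- `M` is a compact smooth embedded minimal surface in three-space, possibly with boundary (and
possibly disconnected). -/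
structure IsEmbeddedMinimalSurface (M : Set E3) : Prop where
  isCompact : IsCompact M
  isSurface : ∀ p ∈ M, IsInteriorPoint M p ∨ IsBoundaryPoint M p
  minimal : ∀ p, IsInteriorPoint M p → ∃ (U : Set E3) (f : E3 → ℝ), p ∈ U ∧
    IsDefiningFunction M U f ∧ ∀ x ∈ M ∩ U, levelSetMeanCurvature f x = 0

/-- The gluing that attaches to `M` the cone over each connected component of `B ⊆ M`: the base
`B × {0}` is glued to `B ⊆ M`, and the top of the cylinder over each component is collapsed to a
point. -/
inductive CapRel (M B : Set E3) : M ⊕ (B × unitInterval) → M ⊕ (B × unitInterval) → Prop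
  | glue (x : M) (b : B) (h : (x : E3) = b) : CapRel M B (Sum.inl x) (Sum.inr (b, 0))
  | tip (b b' : B) (h : (b' : E3) ∈ connectedComponentIn B b) :
      CapRel M B (Sum.inr (b, 1)) (Sum.inr (b', 1))

/-- The closed surface obtained from the compact surface `M` by adding a disk to each boundary
circle (a disk being the cone over its boundary circle), with the quotient topology. -/
abbrev CappedSurface (M : Set E3) : Type := Quot (CapRel M (surfaceBoundary M))

/-- The genus of a closed orientable surface `X`: the largest number of pairwise disjoint simple
closed curves in `X` whose removal does not disconnect any connected component of `X`. (For
disconnected `X` this is the sum of the genera of the components.) -/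
noncomputable def closedGenus (X : Type) [TopologicalSpace X] : ℕ∞ :=
  ⨆ (n : ℕ) (_ : ∃ γ : Fin n → Circle → X,
      (∀ i, Continuous (γ i)) ∧ (∀ i, Function.Injective (γ i)) ∧
      (∀ i j, i ≠ j → Disjoint (range (γ i)) (range (γ j))) ∧
      ∀ x : X, IsPreconnected (connectedComponent x \ ⋃ i, range (γ i))), (n : ℕ∞)

/-- The genus of a compact embedded surface with boundary: the genus of the closed surface obtained
by adding a disk to each boundary circle. -/
noncomputable def genus (M : Set E3) : ℕ∞ := closedGenus (CappedSurface M)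

/-- `M_{0,t}`: the connected component containing the origin of the intersection of `M` with the
(closed) ball of radius `t` centred at the origin. -/
def originComponent (M : Set E3) (t : ℝ) : Set E3 :=
  connectedComponentIn (closedBall 0 t ∩ M) 0

/-- The sphere of radius `t` centred at the origin meets the surface `M` transversally: at each
common point `p`, the normal to `M` (the gradient of some function that vanishes on `M` near `p`)
and the normal `p` to the sphere are linearly independent. -/
def MeetsSphereTransversally (M : Set E3) (t : ℝ) : Prop :=
  ∀ p ∈ M ∩ sphere 0 t, ∃ (U : Set E3) (f : E3 → ℝ), IsOpen U ∧ p ∈ U ∧ ContDiffOn ℝ ∞ f U ∧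
    (∀ x ∈ M ∩ U, f x = 0) ∧ LinearIndependent ℝ ![gradient f p, p]

/-!
The genus of the component `Σ_{i,0,t}` does not decrease with the radius
(`TransversalRadius.genus_mono`) and is at most `g` (`TransversalRadius.genus_originComponent_le`).
Let `L` be the largest genus that is reached, at some radius, infinitely often along the sequence.
Along a subsequence, the genus is then equal to `L` at this radius and, for every larger radius, at
all but finitely many indices. Suppose that for some bounded interval of radii beyond it, infinitely
many of the `Σ_{i,0,t}` have disconnected boundary at some transversal radius in the interval. Then
the boundary is also disconnected at a fixed radius beyond the interval, which is the second
alternative: when a disconnected boundary becomes connected at a larger radius, the genus increases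
(`TransversalRadius.add_one_le_genus`), but `L` is maximal. If there is no such interval, one gets
the first alternative, with outer radii that tend to infinity along a subsequence. Radii which are
transversal to all the surfaces at once are provided by `volume_nontransversal_radii`, a Sard
theorem for the distance to the origin: on a minimal surface, critical points of the distance are
not too degenerate, so that near each of them the critical points lie on a curve.

The increase of the genus is the geometric point. Let `s < t`, let `∂Σ_{0,s}` be disconnected and
`∂Σ_{0,t}` connected. To a system of curves that does not disconnect `Σ_{0,s}` one adds a curve
parallel to one component of `∂Σ_{0,s}`. Suppose that the enlarged system separates `Σ_{0,t}` with
its cap. The part inside stays connected and adheres to all the boundary curves, hence lies, with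
points beyond another component of `∂Σ_{0,s}`, on one side; the cap is connected. So either the
part of the other side, or the part of this side outside `Σ_{0,s}`, does not meet the cap, and it
is a piece of `Σ_{0,t}` disjoint from the part inside, all of whose boundary lies on the part
inside. That contradicts the maximum principle (`exists_norm_lt_of_isInteriorPoint`): the
distance to the origin has no local maximum at an interior point of a minimal surface.

The genus is defined here through curves in the capped surface, which may run through the caps, so
all comparisons rest on moving curves off the caps (`exists_curves_in_collar_extension`). A curve
has no interior points in a cap, so each cap has a point that is on none of the curves; the cap
without this point is homeomorphic to an annulus, hence to a collar of the corresponding boundary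
circle on the outer side (`TransversalRadius.exists_collar`). That the caps are discs uses the
classification of compact one-dimensional manifolds (`exists_circle_homeomorph`).
-/

/-! ### Level sets: tangent curves and local charts -/

/-- A vector tangent to a regular level set is the velocity of a curve in that level set. -/
theorem exists_curve_of_tangent {f : E3 → ℝ} {p v : E3} (hf : ContDiffAt ℝ 1 f p)
    (hn : gradient f p ≠ 0) (hv : inner ℝ (gradient f p) v = 0) :
    ∃ c : ℝ → E3, c 0 = p ∧ HasDerivAt c v 0 ∧ ∀ᶠ τ in 𝓝 (0 : ℝ), f (c τ) = f p := by
  have hs : HasStrictFDerivAt f (fderiv ℝ f p) p := hf.hasStrictFDerivAt one_ne_zero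
  have hr : ((fderiv ℝ f p : E3 →L[ℝ] ℝ) : E3 →ₗ[ℝ] ℝ).range = ⊤ := by
    refine LinearMap.range_eq_top.2 (LinearMap.surjective ?_)
    intro h
    apply hn
    have h2 : ∀ y, inner ℝ (gradient f p) y = 0 := fun y => by
      rw [inner_gradient_left]
      exact congrArg (fun L : E3 →ₗ[ℝ] ℝ => L y) h
    exact inner_self_eq_zero.1 (h2 _)
  have hk : v ∈ ((fderiv ℝ f p : E3 →L[ℝ] ℝ) : E3 →ₗ[ℝ] ℝ).ker := by
    rw [LinearMap.mem_ker]
    rw [inner_gradient_left] at hv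
    exact hv
  set k : ((fderiv ℝ f p : E3 →L[ℝ] ℝ) : E3 →ₗ[ℝ] ℝ).ker := ⟨v, hk⟩
  set φ := hs.implicitFunction f (fderiv ℝ f p) hr (f p)
  have hφ : HasStrictFDerivAt φ _ 0 := hs.to_implicitFunction hr
  have hline : HasDerivAt (fun τ : ℝ => τ • k) k 0 := by
    simpa using (hasDerivAt_id (0 : ℝ)).smul_const k
  have hφ' : HasFDerivAt φ (((fderiv ℝ f p : E3 →L[ℝ] ℝ) : E3 →ₗ[ℝ] ℝ).ker.subtypeL)
      ((fun τ : ℝ => τ • k) 0) := by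
    simpa using hφ.hasFDerivAt
  refine ⟨fun τ => φ (τ • k), ?_, ?_, ?_⟩
  · simp [φ]
  · exact hφ'.comp_hasDerivAt 0 hline
  · have h1 := hs.map_implicitFunction_eq hr
    have h2 : Tendsto (fun τ : ℝ => (f p, τ • k)) (𝓝 0) (𝓝 (f p, 0)) := by
      have : Continuous (fun τ : ℝ => (f p, τ • k)) := by fun_prop
      simpa using this.tendsto 0
    exact h2.eventually h1

/-- Two vectors are parallel if the second annihilates the orthogonal complement of the first. -/
theorem exists_smul_of_orthogonal {n w : E3} (h : ∀ v, inner ℝ n v = 0 → inner ℝ w v = 0) :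
    ∃ c : ℝ, w = c • n := by
  have : w ∈ (Submodule.span ℝ {n})ᗮᗮ := by
    rw [Submodule.mem_orthogonal]
    intro v hv
    rw [real_inner_comm]
    exact h v ((Submodule.mem_orthogonal_singleton_iff_inner_right).1 hv)
  rw [Submodule.orthogonal_orthogonal] at this
  obtain ⟨c, hc⟩ := Submodule.mem_span_singleton.1 this
  exact ⟨c, hc.symm⟩

theorem hasDerivAt_comp_gradient {f : E3 → ℝ} {c : ℝ → E3} {v : E3} {t : ℝ}
    (hf : DifferentiableAt ℝ f (c t)) (hc : HasDerivAt c v t) :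
    HasDerivAt (fun τ => f (c τ)) (inner ℝ (gradient f (c t)) v) t := by
  rw [inner_gradient_left]
  exact hf.hasFDerivAt.comp_hasDerivAt t hc

/-- A function vanishing on a regular level set near a point has gradient normal to it. -/
theorem gradient_parallel_of_vanishes {f k : E3 → ℝ} {p : E3} (hf : ContDiffAt ℝ 1 f p)
    (hn : gradient f p ≠ 0) (hk : DifferentiableAt ℝ k p)
    (h : ∀ᶠ x in 𝓝 p, f x = f p → k x = 0) : ∃ c : ℝ, gradient k p = c • gradient f p := by
  refine exists_smul_of_orthogonal fun v hv => ?_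
  obtain ⟨c, hc0, hc, hfc⟩ := exists_curve_of_tangent hf hn hv
  subst hc0
  have h1 := hasDerivAt_comp_gradient hk hc
  have h2 : ∀ᶠ τ in 𝓝 (0 : ℝ), k (c τ) = 0 := by
    filter_upwards [hfc, hc.continuousAt.eventually h] with τ h3 h4 using h4 h3
  exact h1.unique ((hasDerivAt_const (0 : ℝ) (0 : ℝ)).congr_of_eventuallyEq h2)

theorem eventually_pos_of_hasDerivAt {k : ℝ → ℝ} {a : ℝ} (hk : HasDerivAt k a 0) (h0 : k 0 = 0)
    (ha : 0 < a) : ∀ᶠ τ in 𝓝[>] (0 : ℝ), 0 < k τ := by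
  have h1 := hk.hasDerivWithinAt (s := Ioi 0)
  rw [hasDerivWithinAt_iff_tendsto_slope' (by simp)] at h1
  filter_upwards [h1.eventually (lt_mem_nhds ha), self_mem_nhdsWithin] with τ h2 h3
  rw [slope_def_field, h0, sub_zero, sub_zero] at h2
  exact (div_pos_iff_of_pos_right h3).1 h2

/-- A point cannot be both an interior and a boundary point of an embedded surface. -/
theorem not_isBoundaryPoint_of_isInteriorPoint {M : Set E3} {p : E3} (hi : IsInteriorPoint M p) :
    ¬ IsBoundaryPoint M p := by
  rintro ⟨U', f', h, hU', hpU', hf', hh, hli, hM', hf'p, hhp⟩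
  obtain ⟨hpM, U, f, hpU, hU⟩ := hi
  have hf : ContDiffAt ℝ 1 f p :=
    ((hU.smooth.contDiffAt (hU.isOpen.mem_nhds hpU)).of_le (by exact_mod_cast le_top))
  have hfp : f p = 0 := by
    have : p ∈ M ∩ U := ⟨hpM, hpU⟩
    rw [hU.eq_zeros] at this
    exact this.2
  have hf1 : ContDiffAt ℝ 1 f' p :=
    ((hf'.contDiffAt (hU'.mem_nhds hpU')).of_le (by exact_mod_cast le_top))
  have hh1 : ContDiffAt ℝ 1 h p :=
    ((hh.contDiffAt (hU'.mem_nhds hpU')).of_le (by exact_mod_cast le_top))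
  have hli' := LinearIndependent.pair_iff.1 (hli p hpU')
  have hn' : gradient f' p ≠ 0 := fun h0 => by
    have := hli' 1 0 (by simp [h0]); simp at this
  -- a tangent vector pointing out of the half-surface
  obtain ⟨v₀, hv0, hv0h⟩ : ∃ v, inner ℝ (gradient f' p) v = 0 ∧ 0 < inner ℝ (gradient h p) v := by
    by_contra hcon
    push Not at hcon
    obtain ⟨c, hc⟩ := exists_smul_of_orthogonal (n := gradient f' p) (w := gradient h p)
      fun v hv => by
        have h1 := hcon v hv
        have h2 := hcon (-v) (by rw [inner_neg_right, hv, neg_zero])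
        rw [inner_neg_right] at h2
        linarith
    have := hli' (-c) 1 (by rw [hc]; simp)
    simp at this
  have key : ∀ v, inner ℝ (gradient f' p) v = 0 → inner ℝ (gradient h p) v < 0 →
      inner ℝ (gradient f p) v = 0 := by
    intro v hv hvh
    obtain ⟨c, hc0, hc, hfc⟩ := exists_curve_of_tangent hf1 hn' hv
    subst hc0
    have h1 := hasDerivAt_comp_gradient (hf.differentiableAt one_ne_zero) hc
    have h2 := hasDerivAt_comp_gradient (hh1.differentiableAt one_ne_zero) hc
    have h3 := eventually_pos_of_hasDerivAt h2.neg (by simp [hhp]) (by linarith)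
    have h4 : ∀ᶠ τ in 𝓝[>] (0 : ℝ), f (c τ) = 0 := by
      have e1 := hc.continuousAt.eventually (hU'.mem_nhds hpU')
      have e2 := hc.continuousAt.eventually (hU.isOpen.mem_nhds hpU)
      filter_upwards [h3, e1.filter_mono nhdsWithin_le_nhds, e2.filter_mono nhdsWithin_le_nhds,
        hfc.filter_mono nhdsWithin_le_nhds] with τ a1 a2 a3 a4
      have a5 : c τ ∈ M ∩ U' := by
        rw [hM']
        exact ⟨a2, by rw [a4, hf'p], by simp at a1; linarith⟩
      have a6 : c τ ∈ M ∩ U := ⟨a5.1, a3⟩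
      rw [hU.eq_zeros] at a6
      exact a6.2
    have h5 : HasDerivWithinAt (fun τ => f (c τ)) 0 (Ioi 0) 0 :=
      (hasDerivWithinAt_const (0 : ℝ) (Ioi 0) (0 : ℝ)).congr_of_eventuallyEq h4 hfp
    exact (uniqueDiffWithinAt_Ioi 0).eq_deriv _ h1.hasDerivWithinAt h5
  have hneg := key (-v₀) (by rw [inner_neg_right, hv0, neg_zero])
    (by rw [inner_neg_right]; linarith)
  rw [inner_neg_right, neg_eq_zero] at hneg
  obtain ⟨c, hc0, hc, hfc⟩ := exists_curve_of_tangent hf (hU.regular p hpU) hneg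
  subst hc0
  have h2 := hasDerivAt_comp_gradient (hh1.differentiableAt one_ne_zero) hc
  have h3 := eventually_pos_of_hasDerivAt h2 hhp hv0h
  have e1 := hc.continuousAt.eventually (hU'.mem_nhds hpU')
  have e2 := hc.continuousAt.eventually (hU.isOpen.mem_nhds hpU)
  obtain ⟨τ, a1, a2, a3, a4⟩ := (h3.and ((e1.filter_mono nhdsWithin_le_nhds).and
    ((e2.filter_mono nhdsWithin_le_nhds).and (hfc.filter_mono nhdsWithin_le_nhds)))).exists
  have a5 : c τ ∈ M ∩ U := by
    rw [hU.eq_zeros]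
    exact ⟨a3, by rw [a4, hfp]⟩
  have a6 : c τ ∈ M ∩ U' := ⟨a5.1, a2⟩
  rw [hM'] at a6
  linarith [a6.2.2]

/-- The inverse function theorem, in the form of a chart whose image is a ball. -/
theorem exists_ball_chart {V : Type*} [NormedAddCommGroup V] [NormedSpace ℝ V]
    [FiniteDimensional ℝ V] {κ : V → V} {p : V} {U : Set V} (hκ : ContDiffAt ℝ 1 κ p)
    (hinj : ∀ v, fderiv ℝ κ p v = 0 → v = 0) (hU : U ∈ 𝓝 p) :
    ∃ (W : Set V) (ε : ℝ) (σ : V → V), IsOpen W ∧ p ∈ W ∧ W ⊆ U ∧ 0 < ε ∧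
      DifferentiableOn ℝ σ (ball (κ p) ε) ∧
      (∀ y ∈ ball (κ p) ε, σ y ∈ W ∧ κ (σ y) = y) ∧
      (∀ x ∈ W, κ x ∈ ball (κ p) ε ∧ σ (κ x) = x) := by
  have : CompleteSpace V := FiniteDimensional.complete ℝ V
  have hker : LinearMap.ker ((fderiv ℝ κ p : V →L[ℝ] V) : V →ₗ[ℝ] V) = ⊥ :=
    LinearMap.ker_eq_bot'.2 hinj
  have hrange : LinearMap.range ((fderiv ℝ κ p : V →L[ℝ] V) : V →ₗ[ℝ] V) = ⊤ :=
    LinearMap.range_eq_top.2 (LinearMap.injective_iff_surjective.1 (LinearMap.ker_eq_bot.1 hker))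
  set A : V ≃L[ℝ] V := ContinuousLinearEquiv.ofBijective (fderiv ℝ κ p) hker hrange
  have hA : HasFDerivAt κ (A : V →L[ℝ] V) p := (hκ.differentiableAt one_ne_zero).hasFDerivAt
  set e := hκ.toOpenPartialHomeomorph κ hA one_ne_zero
  have he : ∀ x, e x = κ x := fun x => rfl
  have hpe : p ∈ e.source := hκ.mem_toOpenPartialHomeomorph_source hA one_ne_zero
  have hsymm : e.symm (κ p) = p := e.left_inv hpe
  have hσ : ContDiffAt ℝ 1 e.symm (κ p) := hκ.to_localInverse hA one_ne_zero
  have htgt : e.target ∈ 𝓝 (κ p) := e.open_target.mem_nhds (e.map_source hpe)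
  have h1 : ∀ᶠ y in 𝓝 (κ p), ContDiffAt ℝ 1 e.symm y := hσ.eventually (by simp)
  have h2 : ∀ᶠ y in 𝓝 (κ p), e.symm y ∈ U :=
    hσ.continuousAt.eventually (by rwa [hsymm])
  obtain ⟨ε, hε, hball⟩ := Metric.eventually_nhds_iff_ball.1 (h1.and (h2.and htgt))
  refine ⟨e.source ∩ e ⁻¹' ball (κ p) ε, ε, e.symm, ?_, ⟨hpe, mem_ball_self hε⟩, ?_, hε, ?_, ?_, ?_⟩
  · exact e.isOpen_inter_preimage isOpen_ball
  · rintro x ⟨hx, hx2⟩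
    have := (hball (e x) hx2).2.1
    rwa [e.left_inv hx] at this
  · intro y hy
    exact ((hball y hy).1.differentiableAt one_ne_zero).differentiableWithinAt
  · intro y hy
    have ht := (hball y hy).2.2
    have : e (e.symm y) = y := e.right_inv ht
    exact ⟨⟨e.map_target ht, by rw [mem_preimage, this]; exact hy⟩, this⟩
  · rintro x ⟨hx, hx2⟩
    exact ⟨hx2, e.left_inv hx⟩

/-- Three functions with independent gradients are local coordinates. -/
theorem exists_ball_chart_of_gradients {f h l : E3 → ℝ} {p : E3} {U : Set E3}
    (hf : ContDiffAt ℝ 1 f p) (hh : ContDiffAt ℝ 1 h p) (hl : ContDiffAt ℝ 1 l p)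
    (hinj : ∀ v, inner ℝ (gradient f p) v = 0 → inner ℝ (gradient h p) v = 0 →
      inner ℝ (gradient l p) v = 0 → v = 0) (hU : U ∈ 𝓝 p) :
    ∃ (W : Set E3) (ε : ℝ) (σ : E3 → E3), IsOpen W ∧ p ∈ W ∧ W ⊆ U ∧ 0 < ε ∧
      DifferentiableOn ℝ σ (ball (!₂[f p, h p, l p] : E3) ε) ∧
      (∀ y ∈ ball (!₂[f p, h p, l p] : E3) ε,
        σ y ∈ W ∧ f (σ y) = y 0 ∧ h (σ y) = y 1 ∧ l (σ y) = y 2) ∧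
      (∀ x ∈ W, (!₂[f x, h x, l x] : E3) ∈ ball (!₂[f p, h p, l p] : E3) ε ∧
        σ !₂[f x, h x, l x] = x) := by
  set κ : E3 → E3 := fun x => !₂[f x, h x, l x]
  have hκ : ContDiffAt ℝ 1 κ p := by
    rw [contDiffAt_euclidean]
    intro i
    fin_cases i
    · exact hf
    · exact hh
    · exact hl
  have hd : ∀ v i, (fderiv ℝ κ p v) i = fderiv ℝ (fun x => κ x i) p v := by
    intro v i
    have h1 := (EuclideanSpace.proj (𝕜 := ℝ) i : E3 →L[ℝ] ℝ).hasFDerivAt.comp p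
      (hκ.differentiableAt one_ne_zero).hasFDerivAt
    exact (congrArg (fun L : E3 →L[ℝ] ℝ => L v) h1.fderiv).symm
  obtain ⟨W, ε, σ, h1, h2, h3, h4, h5, h6, h7⟩ := exists_ball_chart hκ (U := U) (fun v hv => by
    apply hinj v
    · rw [inner_gradient_left]; have := hd v 0; rw [hv] at this; exact this.symm
    · rw [inner_gradient_left]; have := hd v 1; rw [hv] at this; exact this.symm
    · rw [inner_gradient_left]; have := hd v 2; rw [hv] at this; exact this.symm) hU
  refine ⟨W, ε, σ, h1, h2, h3, h4, h5, fun y hy => ⟨(h6 y hy).1, ?_, ?_, ?_⟩, h7⟩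
  · exact congrArg (fun z : E3 => z 0) (h6 y hy).2
  · exact congrArg (fun z : E3 => z 1) (h6 y hy).2
  · exact congrArg (fun z : E3 => z 2) (h6 y hy).2

/-! ### The cross product -/

/-- The cross product of two vectors of Euclidean three-space. -/
noncomputable def crossE (a b : E3) : E3 :=
  !₂[a 1 * b 2 - a 2 * b 1, a 2 * b 0 - a 0 * b 2, a 0 * b 1 - a 1 * b 0]

theorem crossE_ne_zero {a b : E3} (h : LinearIndependent ℝ ![a, b]) : crossE a b ≠ 0 := by
  intro h0
  rw [LinearIndependent.pair_iff] at h
  have e0 : a 1 * b 2 - a 2 * b 1 = 0 := congrArg (fun z : E3 => z 0) h0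
  have e1 : a 2 * b 0 - a 0 * b 2 = 0 := congrArg (fun z : E3 => z 1) h0
  have e2 : a 0 * b 1 - a 1 * b 0 = 0 := congrArg (fun z : E3 => z 2) h0
  have ha : ∀ i, a i = 0 := by
    intro i
    have := (h (b i) (-a i) (by
      ext j
      fin_cases i <;> fin_cases j <;> simp <;> linarith)).2
    simpa using this
  have := (h 1 0 (by ext j; simp [ha j])).1
  exact one_ne_zero this

theorem inner_E3 (a b : E3) : inner ℝ a b = a 0 * b 0 + a 1 * b 1 + a 2 * b 2 := by
  simp [PiLp.inner_apply, Fin.sum_univ_three]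
  ring

theorem eq_zero_of_inner_crossE {a b d : E3} (hab : crossE a b ≠ 0) (ha : inner ℝ a d = 0)
    (hb : inner ℝ b d = 0) (hc : inner ℝ (crossE a b) d = 0) : d = 0 := by
  have key : inner ℝ (crossE a b) (crossE a b) * inner ℝ d d = (0 : ℝ) := by
    have h1 : inner ℝ (crossE a b) (crossE a b) * inner ℝ d d =
        (inner ℝ (crossE a b) d) ^ 2 + inner ℝ a a * (inner ℝ b d) ^ 2
          + inner ℝ b b * (inner ℝ a d) ^ 2 - 2 * inner ℝ a b * inner ℝ a d * inner ℝ b d := by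
      simp only [inner_E3, crossE, Matrix.cons_val]
      ring
    rw [h1, ha, hb, hc]; ring
  rcases mul_eq_zero.1 key with h | h
  · exact absurd (inner_self_eq_zero.1 h) hab
  · exact inner_self_eq_zero.1 h

theorem crossE_smul_left (c : ℝ) (a b : E3) : crossE (c • a) b = c • crossE a b := by
  ext i
  fin_cases i <;> simp [crossE] <;> ring

/-! ### The distance to the origin on a minimal surface -/

theorem hasGradientAt_inner (a x : E3) : HasGradientAt (fun x : E3 => (inner ℝ a x : ℝ)) a x := by
  rw [hasGradientAt_iff_hasFDerivAt]
  exact (InnerProductSpace.toDual ℝ E3 a).hasFDerivAt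

theorem hasGradientAt_norm_sq (x : E3) : HasGradientAt (fun y : E3 => ‖y‖ ^ 2) ((2 : ℝ) • x) x := by
  rw [hasGradientAt_iff_hasFDerivAt]
  have e : InnerProductSpace.toDual ℝ E3 ((2 : ℝ) • x) = 2 • innerSL ℝ x := by
    ext y
    simp
  rw [e]
  exact (hasStrictFDerivAt_norm_sq x).hasFDerivAt

theorem IsDefiningFunction.contDiffAt {M U : Set E3} {f : E3 → ℝ} (h : IsDefiningFunction M U f)
    {x : E3} (hx : x ∈ U) (n : ℕ) : ContDiffAt ℝ n f x :=
  (h.smooth.contDiffAt (h.isOpen.mem_nhds hx)).of_le (by exact_mod_cast le_top)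

theorem IsDefiningFunction.mem_iff {M U : Set E3} {f : E3 → ℝ} (h : IsDefiningFunction M U f)
    {x : E3} (hx : x ∈ U) : x ∈ M ↔ f x = 0 := by
  have := Set.ext_iff.1 h.eq_zeros x
  simpa [hx] using this

theorem contDiffAt_gradient {f : E3 → ℝ} {x : E3} {n : ℕ} (h : ContDiffAt ℝ (n + 1 : ℕ) f x) :
    ContDiffAt ℝ n (gradient f) x := by
  have h1 : ContDiffAt ℝ n (fderiv ℝ f) x := h.fderiv_right (by norm_cast)
  exact ((InnerProductSpace.toDual ℝ E3).symm.contDiff.contDiffAt (x := fderiv ℝ f x)).comp x h1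

/-- The second-order criterion for a function to increase along a curve leaving a critical
point. -/
theorem eventually_lt_of_second_order {G : E3 → ℝ} {Y : E3 → E3} {p v : E3} {L : E3 →L[ℝ] E3}
    {c : ℝ → E3} (hG : ∀ᶠ x in 𝓝 p, HasGradientAt G (Y x) x) (hY0 : Y p = 0)
    (hY : HasFDerivAt Y L p) (hpos : 0 < inner ℝ (L v) v) (hc0 : c 0 = p)
    (hc : HasDerivAt c v 0) : ∀ᶠ τ in 𝓝[>] (0 : ℝ), G p < G (c τ) := by
  set m := inner ℝ (L v) v
  set R := ‖v‖ + 1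
  have hR : 0 < R := by positivity
  have hslope : Tendsto (fun τ : ℝ => τ⁻¹ • (c τ - p)) (𝓝[>] 0) (𝓝 v) := by
    have h1 := hc.hasDerivWithinAt (s := Ioi 0)
    rw [hasDerivWithinAt_iff_tendsto_slope' (by simp)] at h1
    refine h1.congr fun τ => ?_
    rw [slope_def_module, hc0, sub_zero]
  have e1 : ∀ᶠ τ in 𝓝[>] (0 : ℝ), ‖τ⁻¹ • (c τ - p)‖ < R :=
    hslope.norm.eventually (gt_mem_nhds (by simp [R]))
  have e2 : ∀ᶠ τ in 𝓝[>] (0 : ℝ),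
      m / 2 < inner ℝ (L (τ⁻¹ • (c τ - p))) (τ⁻¹ • (c τ - p)) := by
    have : Tendsto (fun τ : ℝ => (inner ℝ (L (τ⁻¹ • (c τ - p))) (τ⁻¹ • (c τ - p)) : ℝ))
        (𝓝[>] 0) (𝓝 m) := ((L.continuous.tendsto v).comp hslope).inner hslope
    exact this.eventually (lt_mem_nhds (by linarith))
  have hε : 0 < m / (4 * R ^ 2) := by positivity
  have e3 := hY.isLittleO.def hε
  obtain ⟨ρ, hρ, hball⟩ := Metric.eventually_nhds_iff_ball.1 (e3.and hG)
  have e4 : ∀ᶠ τ in 𝓝[>] (0 : ℝ), c τ ∈ ball p ρ := by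
    have := hc.continuousAt.eventually (ball_mem_nhds (c 0) hρ)
    rw [hc0] at this
    exact this.filter_mono nhdsWithin_le_nhds
  filter_upwards [e1, e2, e4, self_mem_nhdsWithin] with τ h1 h2 h4 hτ
  have hτ : 0 < τ := hτ
  set q := τ⁻¹ • (c τ - p) with hq
  have hcq : c τ = p + τ • q := by
    rw [hq, smul_inv_smul₀ hτ.ne']; abel
  clear_value q
  have hw : ‖τ • q‖ < ρ := by
    rw [mem_ball, dist_eq_norm, hcq] at h4
    simpa using h4
  have hmem : ∀ s ∈ Icc (0 : ℝ) 1, p + s • (τ • q) ∈ ball p ρ := by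
    intro s hs
    rw [mem_ball, dist_eq_norm, add_sub_cancel_left, norm_smul, Real.norm_of_nonneg hs.1]
    calc s * ‖τ • q‖ ≤ 1 * ‖τ • q‖ := by gcongr; exact hs.2
      _ < ρ := by simpa using hw
  have hder : ∀ s ∈ Icc (0 : ℝ) 1, HasDerivAt (fun s : ℝ => G (p + s • (τ • q)))
      (inner ℝ (Y (p + s • (τ • q))) (τ • q)) s := by
    intro s hs
    have hg := (hball _ (hmem s hs)).2
    have h5 : HasDerivAt (fun s : ℝ => p + s • (τ • q)) (τ • q) s := by
      simpa using ((hasDerivAt_id s).smul_const (τ • q)).const_add p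
    have h6 := hasDerivAt_comp_gradient (f := G) (c := fun s : ℝ => p + s • (τ • q))
      hg.differentiableAt h5
    rwa [hg.gradient] at h6
  obtain ⟨ξ, hξ, hξe⟩ := exists_hasDerivAt_eq_slope (fun s : ℝ => G (p + s • (τ • q)))
    (fun s => inner ℝ (Y (p + s • (τ • q))) (τ • q)) zero_lt_one
    (fun s hs => (hder s hs).continuousAt.continuousWithinAt)
    (fun s hs => hder s (Ioo_subset_Icc_self hs))
  have hξ' := Ioo_subset_Icc_self hξ
  have h7 := (hball _ (hmem ξ hξ')).1
  rw [hY0, sub_zero, add_sub_cancel_left] at h7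
  have h8 : ‖ξ • τ • q‖ = ξ * τ * ‖q‖ := by
    rw [norm_smul, norm_smul, Real.norm_of_nonneg hξ'.1, Real.norm_of_nonneg hτ.le]; ring
  have h9 : 0 < inner ℝ (Y (p + ξ • (τ • q))) (τ • q) := by
    set y := Y (p + ξ • (τ • q))
    have h10 : inner ℝ y (τ • q) = ξ * τ ^ 2 * inner ℝ (L q) q
        + inner ℝ (y - L (ξ • τ • q)) (τ • q) := by
      rw [inner_sub_left, map_smul, map_smul]
      simp only [inner_smul_left, inner_smul_right, conj_trivial]
      ring
    have h11 : |(inner ℝ (y - L (ξ • τ • q)) (τ • q) : ℝ)| ≤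
        m / (4 * R ^ 2) * (ξ * τ * ‖q‖) * (τ * ‖q‖) := by
      refine (abs_real_inner_le_norm _ _).trans ?_
      rw [h8] at h7
      have : ‖τ • q‖ = τ * ‖q‖ := by rw [norm_smul, Real.norm_of_nonneg hτ.le]
      rw [this]
      gcongr
    have h12 : m / (4 * R ^ 2) * (ξ * τ * ‖q‖) * (τ * ‖q‖) ≤ ξ * τ ^ 2 * (m / 4) := by
      have : ‖q‖ ^ 2 ≤ R ^ 2 := by gcongr
      calc m / (4 * R ^ 2) * (ξ * τ * ‖q‖) * (τ * ‖q‖)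
          = ξ * τ ^ 2 * (m / (4 * R ^ 2)) * ‖q‖ ^ 2 := by ring
        _ ≤ ξ * τ ^ 2 * (m / (4 * R ^ 2)) * R ^ 2 := by
            have := hξ.1; gcongr
        _ = ξ * τ ^ 2 * (m / 4) := by field_simp
    have h13 : 0 < ξ * τ ^ 2 := by have := hξ.1; positivity
    have h14 := neg_abs_le (inner ℝ (y - L (ξ • τ • q)) (τ • q) : ℝ)
    rw [h10]
    nlinarith
  simp only [sub_zero, div_one, one_smul, zero_smul, add_zero] at hξe
  rw [hξe, ← hcq] at h9
  linarith

/-- On a minimal surface, the Hessian of the defining function has trace zero on the tangent plane.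
So no multiple of its quadratic form can dominate the squared length, whose trace is positive. -/
theorem exists_tangent_of_meanCurvature_zero {f : E3 → ℝ} {p : E3} (hf : ContDiffAt ℝ 2 f p)
    (hn : gradient f p ≠ 0) (hH : levelSetMeanCurvature f p = 0) (lam : ℝ) :
    ∃ v : E3, inner ℝ (gradient f p) v = 0 ∧
      lam * inner ℝ (fderiv ℝ (gradient f) p v) v < inner ℝ v v := by
  set n := gradient f p
  have hg : ContDiffAt ℝ 1 (gradient f) p := contDiffAt_gradient (n := 1) hf
  have hgd : DifferentiableAt ℝ (gradient f) p := hg.differentiableAt one_ne_zero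
  set H := fderiv ℝ (gradient f) p
  set X : E3 → E3 := fun y => ‖gradient f y‖⁻¹ • gradient f y with hX
  have hnormd : DifferentiableAt ℝ (fun y => ‖gradient f y‖⁻¹) p :=
    (hgd.norm ℝ hn).inv (norm_ne_zero_iff.2 hn)
  have hXd : DifferentiableAt ℝ X p := hnormd.smul hgd
  set A := fderiv ℝ X p with hA
  -- an orthonormal basis whose first vector is the unit normal
  have hs1 : ‖‖n‖⁻¹ • n‖ = 1 := by
    rw [norm_smul, norm_inv, norm_norm, inv_mul_cancel₀ (norm_ne_zero_iff.2 hn)]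
  obtain ⟨b, hb⟩ := Orthonormal.exists_orthonormalBasis_extension_of_card_eq (𝕜 := ℝ) (E := E3)
    (ι := Fin 3) (by simp) (v := fun _ => ‖n‖⁻¹ • n) (s := {0}) (by
      refine ⟨fun i => ?_, fun i j hij => absurd (Subsingleton.elim i j) hij⟩
      simpa using hs1)
  have hb0 : b 0 = ‖n‖⁻¹ • n := hb 0 rfl
  have hnb : n = ‖n‖ • b 0 := by rw [hb0, smul_inv_smul₀ (norm_ne_zero_iff.2 hn)]
  have hperp : ∀ i, i ≠ 0 → inner ℝ n (b i) = 0 := by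
    intro i hi
    rw [hnb, inner_smul_left, b.orthonormal.2 hi.symm, mul_zero]
  have htr : ∑ i, inner ℝ (b i) (A (b i)) = 0 := by
    have h1 := LinearMap.trace_eq_sum_inner (A : E3 →ₗ[ℝ] E3) b
    have h2 := LinearMap.trace_eq_sum_inner (A : E3 →ₗ[ℝ] E3) (EuclideanSpace.basisFun (Fin 3) ℝ)
    have h3 : levelSetMeanCurvature f p =
        ∑ i, inner ℝ (EuclideanSpace.basisFun (Fin 3) ℝ i)
          (A (EuclideanSpace.basisFun (Fin 3) ℝ i)) := by
      unfold levelSetMeanCurvature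
      refine Finset.sum_congr rfl fun i _ => ?_
      rw [EuclideanSpace.basisFun_apply, EuclideanSpace.inner_single_left]
      simp [hA, hX]
    rw [hH] at h3
    exact (h1.symm.trans h2).trans h3.symm
  have hA0 : inner ℝ (b 0) (A (b 0)) = 0 := by
    have h1 : HasFDerivAt (fun y => (inner ℝ (X y) (X y) : ℝ)) _ p :=
      hXd.hasFDerivAt.inner ℝ hXd.hasFDerivAt
    have h2 : (fun y => (inner ℝ (X y) (X y) : ℝ)) =ᶠ[𝓝 p] fun _ => 1 := by
      filter_upwards [hg.continuousAt.eventually_ne hn] with y hy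
      rw [real_inner_self_eq_norm_sq, hX]
      simp only
      rw [norm_smul, norm_inv, norm_norm, inv_mul_cancel₀ (norm_ne_zero_iff.2 hy), one_pow]
    have h3 := h1.unique ((hasFDerivAt_const (1 : ℝ) p).congr_of_eventuallyEq h2)
    have h4 := congrArg (fun L : E3 →L[ℝ] ℝ => L (b 0)) h3
    have h5 : X p = b 0 := hb0.symm
    simp only [ContinuousLinearMap.comp_apply, fderivInnerCLM_apply,
      ContinuousLinearMap.prod_apply, h5, zero_apply] at h4
    rw [real_inner_comm (b 0)] at h4
    linarith
  have hAi : ∀ u, inner ℝ n u = 0 → inner ℝ u (A u) = ‖n‖⁻¹ * inner ℝ (H u) u := by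
    intro u hu
    have h1 : HasFDerivAt X (‖n‖⁻¹ • H + (fderiv ℝ (fun y => ‖gradient f y‖⁻¹) p).smulRight n) p :=
      hnormd.hasFDerivAt.smul hgd.hasFDerivAt
    rw [hA, h1.fderiv]
    simp only [add_apply, smul_apply, ContinuousLinearMap.smulRight_apply, inner_add_right,
      inner_smul_right, real_inner_comm n u, hu, mul_zero, add_zero]
    rw [real_inner_comm]
  rw [Fin.sum_univ_three, hA0, hAi _ (hperp 1 (by decide)), hAi _ (hperp 2 (by decide)), zero_add,
    ← mul_add] at htr
  have htr' : inner ℝ (H (b 1)) (b 1) + inner ℝ (H (b 2)) (b 2) = 0 :=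
    (mul_eq_zero.1 htr).resolve_left (inv_ne_zero (norm_ne_zero_iff.2 hn))
  have h1 : ∀ i, inner ℝ (b i) (b i) = (1 : ℝ) := fun i => by
    rw [real_inner_self_eq_norm_sq, b.orthonormal.1 i, one_pow]
  by_contra hcon
  push Not at hcon
  have c1 := hcon (b 1) (hperp 1 (by decide))
  have c2 := hcon (b 2) (hperp 2 (by decide))
  rw [h1] at c1 c2
  have : lam * (inner ℝ (H (b 1)) (b 1) + inner ℝ (H (b 2)) (b 2)) = 0 := by rw [htr', mul_zero]
  linarith

/-- The maximum principle: the distance to the origin has no local maximum at an interior point of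
a minimal surface. -/
theorem exists_norm_lt_of_isInteriorPoint {M : Set E3} (hM : IsEmbeddedMinimalSurface M) {p : E3}
    (hp : IsInteriorPoint M p) {V : Set E3} (hV : V ∈ 𝓝 p) : ∃ x ∈ M ∩ V, ‖p‖ < ‖x‖ := by
  obtain ⟨U, f, hpU, hU, hH⟩ := hM.minimal p hp
  have hf1 := hU.contDiffAt hpU 1
  have hn := hU.regular p hpU
  have hfp : f p = 0 := (hU.mem_iff hpU).1 hp.1
  have key : ∀ v, inner ℝ (gradient f p) v = 0 → (∀ c : ℝ → E3, c 0 = p → HasDerivAt c v 0 →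
      (∀ᶠ τ in 𝓝 (0 : ℝ), f (c τ) = f p) → ∀ᶠ τ in 𝓝[>] (0 : ℝ), ‖p‖ ^ 2 < ‖c τ‖ ^ 2) →
      ∃ x ∈ M ∩ V, ‖p‖ < ‖x‖ := by
    intro v hv h
    obtain ⟨c, hc0, hc, hfc⟩ := exists_curve_of_tangent hf1 hn hv
    have h1 := h c hc0 hc hfc
    have h2 : ∀ᶠ τ in 𝓝 (0 : ℝ), c τ ∈ U ∩ V := hc.continuousAt.eventually_mem
      (by rw [hc0]; exact inter_mem (hU.isOpen.mem_nhds hpU) hV)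
    obtain ⟨τ, a1, a2, a3⟩ := (h1.and ((h2.filter_mono nhdsWithin_le_nhds).and
      (hfc.filter_mono nhdsWithin_le_nhds))).exists
    refine ⟨c τ, ⟨(hU.mem_iff a2.1).2 (a3.trans hfp), a2.2⟩, ?_⟩
    exact lt_of_pow_lt_pow_left₀ 2 (norm_nonneg _) a1
  by_cases hcrit : ∀ v, inner ℝ (gradient f p) v = 0 → inner ℝ p v = 0
  · obtain ⟨lam, hlam⟩ := exists_smul_of_orthogonal hcrit
    obtain ⟨v, hv, hlt⟩ := exists_tangent_of_meanCurvature_zero (hU.contDiffAt hpU 2) hn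
      (hH p ⟨hp.1, hpU⟩) lam
    refine key v hv fun c hc0 hc hfc => ?_
    -- `‖x‖²` agrees on the surface with `‖x‖² - 2 λ f`, of which `p` is a critical point
    have hgd : DifferentiableAt ℝ (gradient f) p :=
      (contDiffAt_gradient (n := 1) (hU.contDiffAt hpU 2)).differentiableAt one_ne_zero
    have h1 := eventually_lt_of_second_order (G := fun x => ‖x‖ ^ 2 - (2 * lam) * f x)
      (Y := fun x => (2 : ℝ) • x - (2 * lam) • gradient f x) (p := p) (v := v)
      (L := (2 : ℝ) • ContinuousLinearMap.id ℝ E3 - (2 * lam) • fderiv ℝ (gradient f) p) (c := c)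
      (by
        filter_upwards [hU.isOpen.mem_nhds hpU] with x hx
        have h2 := (hU.contDiffAt hx 1).differentiableAt one_ne_zero
        have h3 := h2.hasGradientAt
        have h4 := hasGradientAt_norm_sq x
        rw [hasGradientAt_iff_hasFDerivAt] at h3 h4 ⊢
        have e : InnerProductSpace.toDual ℝ E3 ((2 : ℝ) • x - (2 * lam) • gradient f x) =
            InnerProductSpace.toDual ℝ E3 ((2 : ℝ) • x) -
              (2 * lam) • InnerProductSpace.toDual ℝ E3 (gradient f x) := by
          ext y
          simp
        rw [e]
        exact h4.sub (h3.const_smul (2 * lam)))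
      (by
        simp only [mul_smul, ← hlam, sub_self])
      (((hasFDerivAt_id p).const_smul (2 : ℝ)).sub (hgd.hasFDerivAt.const_smul (2 * lam)))
      (by
        simp only [sub_apply, smul_apply, ContinuousLinearMap.id_apply, inner_sub_left,
          inner_smul_left, conj_trivial]
        linarith) hc0 hc
    filter_upwards [h1, hfc.filter_mono nhdsWithin_le_nhds] with τ h2 h3
    simp only [h3, hfp, mul_zero, sub_zero] at h2
    exact h2
  · push Not at hcrit
    obtain ⟨v, hv, hpv⟩ := hcrit
    obtain ⟨u, hu, hpu⟩ : ∃ v, inner ℝ (gradient f p) v = 0 ∧ 0 < inner ℝ p v := by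
      rcases lt_or_gt_of_ne hpv with h | h
      · exact ⟨-v, by rw [inner_neg_right, hv, neg_zero], by rw [inner_neg_right]; linarith⟩
      · exact ⟨v, hv, h⟩
    refine key u hu fun c hc0 hc _ => ?_
    have h1 := hasDerivAt_comp_gradient (f := fun y : E3 => ‖y‖ ^ 2) (c := c)
      (hasGradientAt_norm_sq _).differentiableAt hc
    rw [(hasGradientAt_norm_sq _).gradient, hc0, inner_smul_left] at h1
    have h2 := eventually_pos_of_hasDerivAt (h1.sub_const (‖p‖ ^ 2)) (by simp [hc0])
      (by simpa using hpu)
    filter_upwards [h2] with τ h3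
    linarith

/-! ### Transversal spheres -/

theorem linearIndependent_of_gradient {n p : E3} (hn : n ≠ 0) (h : ∀ a : ℝ, p ≠ a • n) :
    LinearIndependent ℝ ![n, p] :=
  (LinearIndependent.pair_iff' hn).2 fun a ha => h a ha.symm

/-- Transversality can be tested with any defining function. -/
theorem MeetsSphereTransversally.linearIndependent {M U : Set E3} {f : E3 → ℝ} {p : E3} {t : ℝ}
    (h : MeetsSphereTransversally M t) (hU : IsDefiningFunction M U f) (hpU : p ∈ U)
    (hpM : p ∈ M) (hpt : ‖p‖ = t) : LinearIndependent ℝ ![gradient f p, p] := by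
  obtain ⟨V, k, hV, hpV, hk, hkM, hli⟩ := h p ⟨hpM, by simpa using hpt⟩
  have hfp := (hU.mem_iff hpU).1 hpM
  obtain ⟨c, hc⟩ := gradient_parallel_of_vanishes (f := f) (k := k) (hU.contDiffAt hpU 1)
    (hU.regular p hpU)
    ((hk.contDiffAt (hV.mem_nhds hpV)).differentiableAt (by simp)) (by
      filter_upwards [hV.mem_nhds hpV, hU.isOpen.mem_nhds hpU] with x hxV hxU hfx
      exact hkM x ⟨(hU.mem_iff hxU).2 (hfx.trans hfp), hxV⟩)
  rw [hc] at hli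
  refine linearIndependent_of_gradient (hU.regular p hpU) fun a ha => ?_
  rw [LinearIndependent.pair_iff] at hli
  obtain ⟨h1, h2⟩ := hli a (-c) (by
    nth_rewrite 2 [ha]
    rw [smul_smul, smul_smul, ← add_smul]
    ring_nf
    simp)
  rw [neg_eq_zero] at h2
  subst h1 h2
  have := hli
  simp only [zero_smul] at this
  exact one_ne_zero (this 1 0 (by simp)).1

/-- The set of points of `M` at which the sphere through the point fails to be transversal to
`M`. -/
def tangencySet (M : Set E3) : Set E3 :=
  {p | p ∈ M ∧ ¬ ∃ (U : Set E3) (f : E3 → ℝ), IsOpen U ∧ p ∈ U ∧ ContDiffOn ℝ ∞ f U ∧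
    (∀ x ∈ M ∩ U, f x = 0) ∧ LinearIndependent ℝ ![gradient f p, p]}

theorem exists_smul_of_mem_tangencySet {M U : Set E3} {f : E3 → ℝ} {p : E3}
    (hp : p ∈ tangencySet M) (hU : IsDefiningFunction M U f) (hpU : p ∈ U) :
    ∃ a : ℝ, p = a • gradient f p := by
  by_contra hcon
  push Not at hcon
  exact hp.2 ⟨U, f, hU.isOpen, hpU, hU.smooth, fun x hx => (hU.mem_iff hx.2).1 hx.1,
    linearIndependent_of_gradient (hU.regular p hpU) hcon⟩

/-- At a critical point of the distance to the origin on a minimal surface, the second derivative of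
the squared distance is positive in some tangent direction `v`. So the points where its derivative
in the direction of a tangent field extending `v` vanishes form a smooth curve, which contains all
critical points nearby, and the critical values are critical values of a function of one variable:
they form a null set. -/
theorem volume_critical_radii_local {M : Set E3} (hM : IsEmbeddedMinimalSurface M) {p : E3}
    (hp : IsInteriorPoint M p) (hpt : p ∈ tangencySet M) (hp0 : p ≠ 0) :
    ∃ V ∈ 𝓝 p, MeasureTheory.volume (norm '' (tangencySet M ∩ V)) = 0 := by
  obtain ⟨U, f, hpU, hU, hH⟩ := hM.minimal p hp
  obtain ⟨lam, hlam⟩ := exists_smul_of_mem_tangencySet hpt hU hpU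
  have hn := hU.regular p hpU
  obtain ⟨v, hv, hlt⟩ := exists_tangent_of_meanCurvature_zero (hU.contDiffAt hpU 2) hn
    (hH p ⟨hp.1, hpU⟩) lam
  set n := gradient f p with hn_def
  have hg : ContDiffAt ℝ 1 (gradient f) p := contDiffAt_gradient (n := 1) (hU.contDiffAt hpU 2)
  -- `w x` is the inner product of `x` with the tangent vector `⟪∇f, n⟫ v - ⟪∇f, v⟫ n` at `x`,
  -- so it vanishes at the points where the sphere is tangent to the surface
  set w : E3 → ℝ := fun x => inner ℝ (gradient f x) n * inner ℝ x v
    - inner ℝ x n * inner ℝ (gradient f x) v with hw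
  have hwd : ContDiffAt ℝ 1 w p :=
    ((hg.inner ℝ contDiffAt_const).mul (contDiffAt_id.inner ℝ contDiffAt_const)).sub
      ((contDiffAt_id.inner ℝ contDiffAt_const).mul (hg.inner ℝ contDiffAt_const))
  have hgd : HasFDerivAt (gradient f) (fderiv ℝ (gradient f) p) p :=
    (hg.differentiableAt one_ne_zero).hasFDerivAt
  have hwv : inner ℝ (gradient w p) v ≠ 0 := by
    have hline : HasDerivAt (fun τ : ℝ => p + τ • v) v 0 := by
      simpa using ((hasDerivAt_id (0 : ℝ)).smul_const v).const_add p
    have hline0 : p + (0 : ℝ) • v = p := by simp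
    have h1 : HasDerivAt (fun τ : ℝ => gradient f (p + τ • v)) (fderiv ℝ (gradient f) p v) 0 :=
      HasFDerivAt.comp_hasDerivAt (l := gradient f) (f := fun τ : ℝ => p + τ • v) 0
        (by rwa [hline0]) hline
    have h2 : HasDerivAt (fun τ : ℝ => w (p + τ • v)) (inner ℝ (gradient w p) v) 0 := by
      have := hasDerivAt_comp_gradient (f := w) (c := fun τ : ℝ => p + τ • v) (t := 0)
        (by rw [hline0]; exact hwd.differentiableAt one_ne_zero) hline
      rwa [hline0] at this
    have hc : ∀ u : E3, HasDerivAt (fun _ : ℝ => u) 0 0 := fun u => hasDerivAt_const _ _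
    have h3 := (((h1.inner ℝ (hc n)).mul (hline.inner ℝ (hc v))).sub
      ((hline.inner ℝ (hc n)).mul (h1.inner ℝ (hc v))))
    have h4 := h2.unique h3
    simp only [zero_smul, add_zero, inner_zero_right, zero_add] at h4
    rw [h4, ← hn_def, real_inner_comm n v, hv]
    have h5 : (inner ℝ p v : ℝ) = 0 := by rw [hlam, inner_smul_left, hv, mul_zero]
    have h6 : (inner ℝ p n : ℝ) = lam * inner ℝ n n := by
      conv_lhs => rw [hlam]
      rw [inner_smul_left]; rfl
    rw [h5, h6]
    have h7 : 0 < (inner ℝ n n : ℝ) := real_inner_self_pos.2 hn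
    nlinarith
  have hli : LinearIndependent ℝ ![n, gradient w p] := by
    refine linearIndependent_of_gradient hn fun a ha => hwv ?_
    rw [ha, inner_smul_left, hv, mul_zero]
  set a := crossE n (gradient w p) with ha
  obtain ⟨W, ε, σ, hWo, hpW, hWU, hε, hσ, hσ1, hσ2⟩ := exists_ball_chart_of_gradients
    (hU.contDiffAt hpU 1) hwd (l := fun x : E3 => (inner ℝ a x : ℝ))
    (contDiffAt_const.inner ℝ contDiffAt_id) (fun u h1 h2 h3 => by
      rw [(hasGradientAt_inner a p).gradient] at h3
      exact eq_zero_of_inner_crossE (crossE_ne_zero hli) h1 h2 h3)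
    (U := U ∩ {0}ᶜ) (inter_mem (hU.isOpen.mem_nhds hpU) (isOpen_ne.mem_nhds hp0))
  refine ⟨W, hWo.mem_nhds hpW, ?_⟩
  set B := ball (!₂[f p, w p, inner ℝ a p] : E3) ε
  set ι : ℝ → E3 := fun s => !₂[0, 0, s] with hι
  have hιd : Differentiable ℝ ι := by
    rw [differentiable_euclidean]
    intro i
    fin_cases i
    · exact differentiable_const (0 : ℝ)
    · exact differentiable_const (0 : ℝ)
    · exact differentiable_id
  set J := ι ⁻¹' B
  have hJ : IsOpen J := isOpen_ball.preimage hιd.continuous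
  set D := {s | s ∈ J ∧ σ (ι s) ∈ tangencySet M}
  have hsub : norm '' (tangencySet M ∩ W) ⊆ (fun s => ‖σ (ι s)‖) '' D := by
    rintro _ ⟨x, ⟨hxt, hxW⟩, rfl⟩
    have hxU := (hWU hxW).1
    have h1 : f x = 0 := (hU.mem_iff hxU).1 hxt.1
    have h2 : w x = 0 := by
      obtain ⟨μ, hμ⟩ := exists_smul_of_mem_tangencySet hxt hU hxU
      have e : ∀ u : E3, (inner ℝ x u : ℝ) = μ * inner ℝ (gradient f x) u := fun u => by
        conv_lhs => rw [hμ]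
        rw [inner_smul_left]; rfl
      simp only [hw, e]; ring
    have h3 := hσ2 x hxW
    rw [h1, h2] at h3
    refine ⟨inner ℝ a x, ⟨h3.1, ?_⟩, ?_⟩
    · simp only [hι]; rw [h3.2]; exact hxt
    · simp only [hι]; rw [h3.2]
  refine MeasureTheory.measure_mono_null hsub ?_
  refine MeasureTheory.addHaar_image_eq_zero_of_det_fderivWithin_eq_zero MeasureTheory.volume
    (f' := fun _ => 0) ?_ (fun x _ => by
      rw [ContinuousLinearMap.det]; simp)
  rintro s ⟨hsJ, hst⟩
  have hd : DifferentiableAt ℝ (fun s => σ (ι s)) s :=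
    DifferentiableAt.comp (g := σ) s (hσ.differentiableAt (isOpen_ball.mem_nhds hsJ)) (hιd s)
  set c := fun s => σ (ι s) with hc
  have hcW : c s ∈ W := (hσ1 _ hsJ).1
  have hcU := hWU hcW
  obtain ⟨μ, hμ⟩ := exists_smul_of_mem_tangencySet hst hU hcU.1
  have hfd := hasDerivAt_comp_gradient (f := f)
    ((hU.contDiffAt hcU.1 1).differentiableAt one_ne_zero) hd.hasDerivAt
  have hf0 : (fun τ => f (c τ)) =ᶠ[𝓝 s] fun _ => 0 := by
    filter_upwards [hJ.mem_nhds hsJ] with τ hτ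
    exact (hσ1 _ hτ).2.1
  have h1 : inner ℝ (gradient f (c s)) (deriv c s) = 0 :=
    hfd.unique ((hasDerivAt_const s (0 : ℝ)).congr_of_eventuallyEq hf0)
  have h2 : (inner ℝ (c s) (deriv c s) : ℝ) = 0 := by
    change c s = _ at hμ
    rw [hμ, inner_smul_left, h1, mul_zero]
  have h3 : HasDerivAt (fun τ => ‖c τ‖ ^ 2) 0 s := by
    have := hd.hasDerivAt.norm_sq
    rwa [h2, mul_zero] at this
  have h4 : HasDerivAt (fun τ => ‖c τ‖) 0 s := by
    have := h3.sqrt (pow_ne_zero 2 (norm_ne_zero_iff.2 hcU.2))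
    simpa [Real.sqrt_sq] using this
  have h5 := h4.hasFDerivAt.hasFDerivWithinAt (s := D)
  have e : ContinuousLinearMap.toSpanSingleton ℝ (0 : ℝ) = (0 : ℝ →L[ℝ] ℝ) := by
    ext
    simp
  rw [e] at h5
  exact h5

theorem IsEmbeddedMinimalSurface.isInteriorPoint {M : Set E3} (hM : IsEmbeddedMinimalSurface M)
    {S : ℝ} (hb : surfaceBoundary M ⊆ sphere 0 S) {p : E3} (hp : p ∈ M) (hpS : ‖p‖ < S) :
    IsInteriorPoint M p := by
  refine (hM.isSurface p hp).resolve_right fun h => ?_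
  have := hb h
  rw [mem_sphere_zero_iff_norm] at this
  exact hpS.ne this

/-- Almost every sphere meets a minimal surface transversally. -/
theorem volume_nontransversal_radii {M : Set E3} (hM : IsEmbeddedMinimalSurface M) {S : ℝ}
    (hb : surfaceBoundary M ⊆ sphere 0 S) :
    MeasureTheory.volume {t | 0 < t ∧ t < S ∧ ¬ MeetsSphereTransversally M t} = 0 := by
  set Z := {p | p ∈ tangencySet M ∧ 0 < ‖p‖ ∧ ‖p‖ < S}
  have hloc : ∀ p ∈ Z, ∃ V ∈ 𝓝 p, MeasureTheory.volume (norm '' (tangencySet M ∩ V)) = 0 :=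
    fun p hp => volume_critical_radii_local hM (hM.isInteriorPoint hb hp.1.1 hp.2.2) hp.1
      (norm_pos_iff.1 hp.2.1)
  choose! V hV hV0 using hloc
  obtain ⟨T, hTZ, hTc, hcov⟩ := TopologicalSpace.countable_cover_nhdsWithin
    (fun p hp => mem_nhdsWithin_of_mem_nhds (hV p hp))
  refine MeasureTheory.measure_mono_null (t := ⋃ p ∈ T, norm '' (tangencySet M ∩ V p)) ?_
    ((MeasureTheory.measure_biUnion_null_iff hTc).2 fun p hp => hV0 p (hTZ hp))
  rintro t ⟨h0, hS, hnt⟩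
  unfold MeetsSphereTransversally at hnt
  push Not at hnt
  obtain ⟨p, ⟨hpM, hps⟩, hp⟩ := hnt
  rw [mem_sphere_zero_iff_norm] at hps
  have hpt : p ∈ tangencySet M := by
    refine ⟨hpM, ?_⟩
    push Not
    exact hp
  have hpZ : p ∈ Z := ⟨hpt, by rw [hps]; exact h0, by rw [hps]; exact hS⟩
  obtain ⟨q, hq, hpq⟩ := mem_iUnion₂.1 (hcov hpZ)
  exact mem_iUnion₂.2 ⟨q, hq, p, ⟨hpt, hpq⟩, hps⟩

/-! ### Charts of an embedded surface -/

theorem linearIndependent_of_crossE_ne_zero {a b : E3} (h : crossE a b ≠ 0) :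
    LinearIndependent ℝ ![a, b] := by
  have ha : a ≠ 0 := by
    rintro rfl
    apply h
    ext i
    fin_cases i <;> simp [crossE]
  refine linearIndependent_of_gradient ha fun c hc => h ?_
  rw [hc]
  ext i
  fin_cases i <;> simp [crossE] <;> ring

/-- Near a point of an embedded surface, a function `h` whose gradient is not normal to the surface
is one of the two coordinates of a chart `σ`, the other one being a linear function `l`. -/
theorem exists_surface_chart {M U V : Set E3} {f h : E3 → ℝ} {p : E3}
    (hU : IsDefiningFunction M U f) (hpU : p ∈ U) (hpM : p ∈ M) (hh : ContDiffAt ℝ 1 h p)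
    (hli : LinearIndependent ℝ ![gradient f p, gradient h p]) (hV : V ∈ 𝓝 p) :
    ∃ (W : Set E3) (ε : ℝ) (σ : E3 → E3) (l : E3 → ℝ), IsOpen W ∧ p ∈ W ∧ W ⊆ V ∧ 0 < ε ∧
      Continuous l ∧ ContinuousOn σ (ball (!₂[0, h p, l p] : E3) ε) ∧
      (∀ y ∈ ball (!₂[0, h p, l p] : E3) ε, y 0 = 0 →
        σ y ∈ M ∩ W ∧ h (σ y) = y 1 ∧ l (σ y) = y 2) ∧
      (∀ x ∈ M ∩ W, (!₂[0, h x, l x] : E3) ∈ ball (!₂[0, h p, l p] : E3) ε ∧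
        σ !₂[0, h x, l x] = x) := by
  set a := crossE (gradient f p) (gradient h p)
  have hfp : f p = 0 := (hU.mem_iff hpU).1 hpM
  obtain ⟨W, ε, σ, hWo, hpW, hWU, hε, hσ, hσ1, hσ2⟩ := exists_ball_chart_of_gradients
    (hU.contDiffAt hpU 1) hh (l := fun x : E3 => (inner ℝ a x : ℝ))
    (contDiffAt_const.inner ℝ contDiffAt_id) (fun u h1 h2 h3 => by
      rw [(hasGradientAt_inner a p).gradient] at h3
      exact eq_zero_of_inner_crossE (crossE_ne_zero hli) h1 h2 h3)
    (U := U ∩ V) (inter_mem (hU.isOpen.mem_nhds hpU) hV)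
  rw [hfp] at hσ hσ1 hσ2
  refine ⟨W, ε, σ, fun x => inner ℝ a x, hWo, hpW, fun x hx => (hWU hx).2, hε, by fun_prop,
    hσ.continuousOn, fun y hy hy0 => ?_, fun x hx => ?_⟩
  · have h1 := hσ1 y hy
    exact ⟨⟨(hU.mem_iff (hWU h1.1).1).2 (by rw [h1.2.1, hy0]), h1.1⟩, h1.2.2⟩
  · have h1 := hσ2 x hx.2
    rwa [(hU.mem_iff (hWU hx.2).1).1 hx.1] at h1

/-- A surface is locally connected, and so is its part where the values of the function `h` lie in a
convex set, if the gradient of `h` is not normal to the surface. -/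
theorem exists_nhds_isPreconnected {M U V : Set E3} {f h : E3 → ℝ} {p : E3} {C : Set ℝ}
    (hU : IsDefiningFunction M U f) (hpU : p ∈ U) (hpM : p ∈ M) (hh : ContDiffAt ℝ 1 h p)
    (hli : LinearIndependent ℝ ![gradient f p, gradient h p]) (hV : V ∈ 𝓝 p) (hC : Convex ℝ C) :
    ∃ W, IsOpen W ∧ p ∈ W ∧ W ⊆ V ∧ IsPreconnected (M ∩ W ∩ h ⁻¹' C) := by
  obtain ⟨W, ε, σ, l, hWo, hpW, hWV, hε, hl, hσ, hσ1, hσ2⟩ :=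
    exists_surface_chart hU hpU hpM hh hli hV
  refine ⟨W, hWo, hpW, hWV, ?_⟩
  set B := ball (!₂[0, h p, l p] : E3) ε
  set Q : Set E3 := B ∩ ({y | y 0 = 0} ∩ {y | y 1 ∈ C})
  have hQ : Convex ℝ Q := by
    refine (convex_ball _ _).inter (Convex.inter ?_ ?_)
    · intro x hx y hy a b _ _ _
      simp only [mem_ofPred_eq] at hx hy ⊢
      simp [hx, hy]
    · intro x hx y hy a b ha hb hab
      exact hC hx hy ha hb hab
  have : M ∩ W ∩ h ⁻¹' C = σ '' Q := by
    ext x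
    constructor
    · rintro ⟨hx, hxC⟩
      have h1 := hσ2 x hx
      exact ⟨_, ⟨h1.1, rfl, hxC⟩, h1.2⟩
    · rintro ⟨y, ⟨hyB, hy0, hyC⟩, rfl⟩
      have h1 := hσ1 y hyB hy0
      refine ⟨h1.1, ?_⟩
      rw [mem_preimage, h1.2.1]
      exact hyC
  rw [this]
  exact hQ.isPreconnected.image σ (hσ.mono inter_subset_left)

theorem contDiffAt_norm_sq (x : E3) {n : WithTop ℕ∞} : ContDiffAt ℝ n (fun y : E3 => ‖y‖ ^ 2) x :=
  (contDiff_norm_sq ℝ).contDiffAt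

theorem linearIndependent_norm_sq {n p : E3} (h : LinearIndependent ℝ ![n, p]) :
    LinearIndependent ℝ ![n, gradient (fun y : E3 => ‖y‖ ^ 2) p] := by
  rw [(hasGradientAt_norm_sq p).gradient]
  rw [LinearIndependent.pair_iff] at h ⊢
  intro s t hst
  obtain ⟨h1, h2⟩ := h s (t * 2) (by rwa [smul_smul] at hst)
  exact ⟨h1, by linarith⟩

/-- The intersection of a surface with a ball is locally connected, if the bounding sphere is
transversal to the surface. -/
theorem exists_nhds_isPreconnected_closedBall {M : Set E3} {p : E3} {s : ℝ}
    (hp : IsInteriorPoint M p) (ht : MeetsSphereTransversally M s) (hps : ‖p‖ ≤ s) {V : Set E3}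
    (hV : V ∈ 𝓝 p) :
    ∃ W, IsOpen W ∧ p ∈ W ∧ W ⊆ V ∧ IsPreconnected (M ∩ W ∩ closedBall 0 s) := by
  obtain ⟨hpM, U, f, hpU, hU⟩ := hp
  have hs0 : 0 ≤ s := (norm_nonneg p).trans hps
  rcases hps.lt_or_eq with hlt | heq
  · obtain ⟨u, hu⟩ : ∃ u : E3, ∀ a : ℝ, u ≠ a • gradient f p := by
      by_contra hcon
      push Not at hcon
      obtain ⟨a, ha⟩ := hcon (EuclideanSpace.single 0 1)
      obtain ⟨b, hb⟩ := hcon (EuclideanSpace.single 1 1)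
      have a0 := congrArg (fun z : E3 => z 0) ha
      have a1 := congrArg (fun z : E3 => z 1) ha
      have b0 := congrArg (fun z : E3 => z 0) hb
      have b1 := congrArg (fun z : E3 => z 1) hb
      simp at a0 a1 b0 b1
      rcases a1 with h | h
      · rw [h] at a0; simp at a0
      · rw [h] at b1; simp at b1
    obtain ⟨W, hW, hpW, hWV, hWc⟩ := exists_nhds_isPreconnected
      (h := fun x : E3 => (inner ℝ u x : ℝ)) (C := univ) (V := V ∩ ball 0 s) hU hpU hpM
      (contDiffAt_const.inner ℝ contDiffAt_id) (by
        rw [(hasGradientAt_inner u p).gradient]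
        exact linearIndependent_of_gradient (hU.regular p hpU) hu)
      (inter_mem hV (isOpen_ball.mem_nhds (by simpa using hlt))) convex_univ
    refine ⟨W, hW, hpW, fun x hx => (hWV hx).1, ?_⟩
    have : M ∩ W ∩ closedBall 0 s = M ∩ W := by
      refine inter_eq_left.2 fun x hx => ball_subset_closedBall (hWV hx.2).2
    rw [this]
    simpa using hWc
  · obtain ⟨W, hW, hpW, hWV, hWc⟩ := exists_nhds_isPreconnected (h := fun y : E3 => ‖y‖ ^ 2)
      (C := Iic (s ^ 2)) hU hpU hpM (contDiffAt_norm_sq p)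
      (linearIndependent_norm_sq (ht.linearIndependent hU hpU hpM heq)) hV (convex_Iic _)
    refine ⟨W, hW, hpW, hWV, ?_⟩
    have : (closedBall 0 s : Set E3) = (fun y : E3 => ‖y‖ ^ 2) ⁻¹' Iic (s ^ 2) := by
      ext x
      simp only [mem_closedBall_zero_iff, mem_preimage, mem_Iic]
      exact (pow_le_pow_iff_left₀ (norm_nonneg x) hs0 two_ne_zero).symm
    rwa [this]

/-- The intersection of a surface with a transversal sphere is locally an open arc. -/
theorem exists_isOpenEmbedding_arc {M : Set E3} {p : E3} {s : ℝ} (hp : IsInteriorPoint M p)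
    (ht : MeetsSphereTransversally M s) (hps : ‖p‖ = s) {B V : Set E3} (hV : V ∈ 𝓝 p)
    (hB : ∀ x ∈ V, x ∈ B ↔ x ∈ M ∩ sphere 0 s) (hpB : p ∈ B) :
    ∃ v : ℝ → B, IsOpenEmbedding v ∧ (⟨p, hpB⟩ : B) ∈ range v := by
  obtain ⟨hpM, U, f, hpU, hU⟩ := hp
  have hs0 : 0 ≤ s := hps ▸ norm_nonneg p
  obtain ⟨W, ε, σ, l, hWo, hpW, hWV, hε, hl, hσ, hσ1, hσ2⟩ :=
    exists_surface_chart hU hpU hpM (contDiffAt_norm_sq p)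
      (linearIndependent_norm_sq (ht.linearIndependent hU hpU hpM hps)) hV
  have hmemS : ∀ x : E3, x ∈ sphere (0 : E3) s ↔ ‖x‖ ^ 2 = s ^ 2 := fun x => by
    rw [mem_sphere_zero_iff_norm]
    exact (pow_left_inj₀ (norm_nonneg x) hs0 two_ne_zero).symm
  rw [hps] at hσ hσ1 hσ2
  have hball : ∀ r : ℝ, (!₂[0, s ^ 2, r] : E3) ∈ ball (!₂[0, s ^ 2, l p] : E3) ε ↔
      r ∈ ball (l p) ε := by
    intro r
    rw [mem_ball, mem_ball, EuclideanSpace.dist_eq, Fin.sum_univ_three]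
    simp [Real.dist_eq, Real.sqrt_sq_eq_abs]
  set e := OpenPartialHomeomorph.univBall (l p) ε
  have het : e.target = ball (l p) ε := OpenPartialHomeomorph.univBall_target _ hε
  have hes : e.source = univ := OpenPartialHomeomorph.univBall_source _ _
  have he : ∀ r, e r ∈ ball (l p) ε := fun r => het ▸ e.map_source (hes ▸ mem_univ r)
  have hy : ∀ r, σ !₂[0, s ^ 2, e r] ∈ M ∩ W ∧ ‖σ !₂[0, s ^ 2, e r]‖ ^ 2 = s ^ 2 ∧
      l (σ !₂[0, s ^ 2, e r]) = e r := fun r => by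
    have := hσ1 !₂[0, s ^ 2, e r] ((hball _).2 (he r)) rfl
    simpa using this
  have hyB : ∀ r, σ !₂[0, s ^ 2, e r] ∈ B := fun r =>
    (hB _ (hWV (hy r).1.2)).2 ⟨(hy r).1.1, (hmemS _).2 (hy r).2.1⟩
  have hsub : IsOpen {x : B | (x : E3) ∈ W} := hWo.preimage continuous_subtype_val
  have hW2 : ∀ x : {x : B | (x : E3) ∈ W}, l x ∈ ball (l p) ε ∧ σ !₂[0, s ^ 2, l x] = x := by
    rintro ⟨⟨x, hxB⟩, hxW⟩
    have h1 := (hB x (hWV hxW)).1 hxB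
    have h2 := hσ2 x ⟨h1.1, hxW⟩
    rw [(hmemS x).1 h1.2] at h2
    exact ⟨(hball _).1 h2.1, h2.2⟩
  let H : ℝ ≃ₜ {x : B | (x : E3) ∈ W} :=
    { toFun := fun r => ⟨⟨σ !₂[0, s ^ 2, e r], hyB r⟩, (hy r).1.2⟩
      invFun := fun x => e.symm (l x)
      left_inv := fun r => by
        simp only [(hy r).2.2]
        exact e.left_inv (hes ▸ mem_univ r)
      right_inv := fun x => by
        have h1 := hW2 x
        apply Subtype.ext
        apply Subtype.ext
        simp only
        rw [e.right_inv (by rw [het]; exact h1.1)]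
        exact h1.2
      continuous_toFun := by
        refine Continuous.subtype_mk (Continuous.subtype_mk ?_ _) _
        refine hσ.comp_continuous ?_ fun r => (hball _).2 (he r)
        have : Continuous e := OpenPartialHomeomorph.continuous_univBall _ _
        refine (PiLp.continuous_toLp 2 _).comp (continuous_pi fun i => ?_)
        fin_cases i
        · exact continuous_const
        · exact continuous_const
        · exact this
      continuous_invFun := by
        refine e.continuousOn_symm.comp_continuous ?_ fun x => by rw [het]; exact (hW2 x).1
        exact hl.comp (continuous_subtype_val.comp continuous_subtype_val) }
  refine ⟨fun r => (H r : B), hsub.isOpenEmbedding_subtypeVal.comp H.isOpenEmbedding, ?_⟩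
  refine ⟨H.symm ⟨⟨p, hpB⟩, hpW⟩, ?_⟩
  simp

/-! ### The component of the origin in a ball -/

/-- `M` is a compact surface, minimal, with boundary in the sphere of radius `S`, and contains the
origin; the sphere of radius `s < S` is transversal to it. -/
structure TransversalRadius (M : Set E3) (S s : ℝ) : Prop where
  minimal : IsEmbeddedMinimalSurface M
  zero_mem : (0 : E3) ∈ M
  bdry : surfaceBoundary M ⊆ sphere 0 S
  pos : 0 < s
  lt : s < S
  transversal : MeetsSphereTransversally M s

namespace TransversalRadius

variable {M : Set E3} {S s : ℝ}

theorem isInteriorPoint (h : TransversalRadius M S s) {p : E3} (hp : p ∈ M) (hpS : ‖p‖ < S) :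
    IsInteriorPoint M p :=
  h.minimal.isInteriorPoint h.bdry hp hpS

theorem zero_mem_inter (h : TransversalRadius M S s) : (0 : E3) ∈ closedBall 0 s ∩ M :=
  ⟨by simpa using h.pos.le, h.zero_mem⟩

theorem zero_mem_originComponent (h : TransversalRadius M S s) : (0 : E3) ∈ originComponent M s :=
  mem_connectedComponentIn h.zero_mem_inter

theorem originComponent_subset : originComponent M s ⊆ closedBall 0 s ∩ M :=
  connectedComponentIn_subset _ _

theorem norm_le {x : E3} (hx : x ∈ originComponent M s) : ‖x‖ ≤ s := by
  simpa using (originComponent_subset hx).1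

theorem isPreconnected : IsPreconnected (originComponent M s) :=
  isPreconnected_connectedComponentIn

theorem isCompact (h : TransversalRadius M S s) : IsCompact (originComponent M s) := by
  have h1 : IsCompact (closedBall 0 s ∩ M) := h.minimal.isCompact.inter_left isClosed_closedBall
  rw [originComponent, connectedComponentIn_eq_image h.zero_mem_inter]
  have h2 : CompactSpace ↥(closedBall (0 : E3) s ∩ M) := isCompact_iff_compactSpace.1 h1
  exact isClosed_connectedComponent.isCompact.image continuous_subtype_val

theorem subset_of_isPreconnected {Q : Set E3} (hQ : IsPreconnected Q) {x : E3} (hxQ : x ∈ Q)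
    (hx : x ∈ originComponent M s) (hQM : Q ⊆ closedBall 0 s ∩ M) : Q ⊆ originComponent M s := by
  have := hQ.subset_connectedComponentIn hxQ hQM
  rwa [originComponent, connectedComponentIn_eq hx]

/-- The component is open in the part of `M` in the ball, which is locally connected. -/
theorem exists_nhds (h : TransversalRadius M S s) {p : E3} (hp : p ∈ originComponent M s) :
    ∃ W, IsOpen W ∧ p ∈ W ∧ M ∩ W ∩ closedBall 0 s ⊆ originComponent M s := by
  have hps := norm_le hp
  obtain ⟨W, hW, hpW, -, hc⟩ := exists_nhds_isPreconnected_closedBall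
    (h.isInteriorPoint (originComponent_subset hp).2 (hps.trans_lt h.lt)) h.transversal hps univ_mem
  exact ⟨W, hW, hpW, subset_of_isPreconnected hc
    ⟨⟨(originComponent_subset hp).2, hpW⟩, (originComponent_subset hp).1⟩ hp
    fun x hx => ⟨hx.2, hx.1.1⟩⟩

theorem exists_nhds_of_lt (h : TransversalRadius M S s) {p : E3} (hp : p ∈ originComponent M s)
    (hps : ‖p‖ < s) : ∃ W, IsOpen W ∧ p ∈ W ∧ W ⊆ ball 0 s ∧ M ∩ W ⊆ originComponent M s := by
  obtain ⟨W, hW, hpW, hWs⟩ := h.exists_nhds hp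
  exact ⟨W ∩ ball 0 s, hW.inter isOpen_ball, ⟨hpW, by simpa using hps⟩, inter_subset_right,
    fun x hx => hWs ⟨⟨hx.1, hx.2.1⟩, ball_subset_closedBall hx.2.2⟩⟩

/-- The boundary of the component of the origin is its intersection with the sphere. -/
theorem surfaceBoundary_eq (h : TransversalRadius M S s) :
    surfaceBoundary (originComponent M s) = originComponent M s ∩ sphere 0 s := by
  ext p
  constructor
  · intro hp
    have hpN : p ∈ originComponent M s := by
      obtain ⟨U, f, k, -, hpU, -, -, -, hM, hfp, hkp⟩ := hp
      have : p ∈ originComponent M s ∩ U := by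
        rw [hM]
        exact ⟨hpU, hfp, hkp.le⟩
      exact this.1
    refine ⟨hpN, ?_⟩
    rw [mem_sphere_zero_iff_norm]
    by_contra hne
    have hlt := lt_of_le_of_ne (norm_le hpN) hne
    obtain ⟨W, hW, hpW, -, hWN⟩ := h.exists_nhds_of_lt hpN hlt
    obtain ⟨-, U, f, hpU, hU⟩ :=
      h.isInteriorPoint (originComponent_subset hpN).2 (hlt.trans h.lt)
    refine not_isBoundaryPoint_of_isInteriorPoint (M := originComponent M s)
      ⟨hpN, U ∩ W, f, ⟨hpU, hpW⟩, hU.isOpen.inter hW, hU.smooth.mono inter_subset_left,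
        fun x hx => hU.regular x hx.1, ?_⟩ hp
    ext x
    constructor
    · rintro ⟨hx, hxU⟩
      exact ⟨hxU, (hU.mem_iff hxU.1).1 (originComponent_subset hx).2⟩
    · rintro ⟨hxU, hx⟩
      exact ⟨hWN ⟨(hU.mem_iff hxU.1).2 hx, hxU.2⟩, hxU⟩
  · rintro ⟨hpN, hps⟩
    rw [mem_sphere_zero_iff_norm] at hps
    have hpM := (originComponent_subset hpN).2
    obtain ⟨W, hW, hpW, hWN⟩ := h.exists_nhds hpN
    obtain ⟨-, U, f, hpU, hU⟩ := h.isInteriorPoint hpM (hps.trans_lt h.lt)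
    have hcont : ContinuousOn (fun x => crossE (gradient f x) x) (U ∩ W) := by
      have hg : ContinuousOn (gradient f) (U ∩ W) := fun x hx =>
        (contDiffAt_gradient (n := 0) (hU.contDiffAt hx.1 1)).continuousAt.continuousWithinAt
      have hgi : ∀ i, ContinuousOn (fun x => gradient f x i) (U ∩ W) := fun i =>
        (EuclideanSpace.proj (𝕜 := ℝ) i : E3 →L[ℝ] ℝ).continuous.comp_continuousOn hg
      have hi : ∀ i, ContinuousOn (fun x : E3 => x i) (U ∩ W) := fun i =>
        (EuclideanSpace.proj (𝕜 := ℝ) i : E3 →L[ℝ] ℝ).continuous.continuousOn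
      refine (PiLp.continuous_toLp 2 _).comp_continuousOn (continuousOn_pi.2 fun i => ?_)
      fin_cases i
      · exact ((hgi 1).mul (hi 2)).sub ((hgi 2).mul (hi 1))
      · exact ((hgi 2).mul (hi 0)).sub ((hgi 0).mul (hi 2))
      · exact ((hgi 0).mul (hi 1)).sub ((hgi 1).mul (hi 0))
    have hO := hcont.isOpen_inter_preimage (hU.isOpen.inter hW) (isOpen_compl_singleton (x := 0))
    refine ⟨_, f, fun x => ‖x‖ ^ 2 - s ^ 2, hO, ⟨⟨hpU, hpW⟩, ?_⟩, hU.smooth.mono fun x hx => hx.1.1,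
      (contDiff_norm_sq ℝ).contDiffOn.sub contDiffOn_const, fun x hx => ?_, ?_,
      (hU.mem_iff hpU).1 hpM, by simp [hps]⟩
    · exact crossE_ne_zero (h.transversal.linearIndependent hU hpU hpM hps)
    · have h1 : gradient (fun x : E3 => ‖x‖ ^ 2 - s ^ 2) x =
          gradient (fun x : E3 => ‖x‖ ^ 2) x := by
        rw [(hasGradientAt_norm_sq x).gradient]
        refine HasGradientAt.gradient ?_
        have := hasGradientAt_norm_sq x
        rw [hasGradientAt_iff_hasFDerivAt] at this ⊢
        exact this.sub_const _
      rw [h1]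
      exact linearIndependent_norm_sq (linearIndependent_of_crossE_ne_zero hx.2)
    · ext x
      constructor
      · rintro ⟨hx, hxO⟩
        refine ⟨hxO, (hU.mem_iff hxO.1.1).1 (originComponent_subset hx).2, ?_⟩
        have := norm_le hx
        simp only [sub_nonpos]
        gcongr
      · rintro ⟨hxO, hx, hxs⟩
        refine ⟨hWN ⟨⟨(hU.mem_iff hxO.1.1).2 hx, hxO.1.2⟩, ?_⟩, hxO⟩
        rw [mem_closedBall_zero_iff]
        exact (pow_le_pow_iff_left₀ (norm_nonneg x) h.pos.le two_ne_zero).1 (by linarith)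

/-- The boundary of the component of the origin is a one-dimensional manifold. -/
theorem exists_boundary_arc (h : TransversalRadius M S s)
    (x : surfaceBoundary (originComponent M s)) :
    ∃ v : ℝ → surfaceBoundary (originComponent M s), IsOpenEmbedding v ∧ x ∈ range v := by
  obtain ⟨p, hp⟩ := x
  have hp' := hp
  rw [h.surfaceBoundary_eq] at hp'
  obtain ⟨W, hW, hpW, hWN⟩ := h.exists_nhds hp'.1
  have hps : ‖p‖ = s := by simpa using hp'.2
  refine exists_isOpenEmbedding_arc
    (h.isInteriorPoint (originComponent_subset hp'.1).2 (hps.trans_lt h.lt)) h.transversal hps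
    (hW.mem_nhds hpW) (fun x hx => ?_) hp
  rw [h.surfaceBoundary_eq]
  constructor
  · exact fun hxB => ⟨(originComponent_subset hxB.1).2, hxB.2⟩
  · exact fun hxM => ⟨hWN ⟨⟨hxM.1, hx⟩, sphere_subset_closedBall hxM.2⟩, hxM.2⟩

/-- The distance function has no local maximum in the interior, so the boundary is not empty. -/
theorem surfaceBoundary_nonempty (h : TransversalRadius M S s) :
    (surfaceBoundary (originComponent M s)).Nonempty := by
  obtain ⟨p, hp, hmax⟩ := h.isCompact.exists_isMaxOn ⟨0, h.zero_mem_originComponent⟩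
    continuous_norm.continuousOn
  refine ⟨p, ?_⟩
  rw [h.surfaceBoundary_eq]
  refine ⟨hp, ?_⟩
  rw [mem_sphere_zero_iff_norm]
  by_contra hne
  have hlt := lt_of_le_of_ne (norm_le hp) hne
  obtain ⟨W, hW, hpW, -, hWN⟩ := h.exists_nhds_of_lt hp hlt
  obtain ⟨x, hx, hlt'⟩ := exists_norm_lt_of_isInteriorPoint h.minimal
    (h.isInteriorPoint (originComponent_subset hp).2 (hlt.trans h.lt)) (hW.mem_nhds hpW)
  exact absurd (hmax (hWN hx)) (not_le.2 hlt')

end TransversalRadius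

/-! ### The collar of a transversal sphere -/

theorem ContDiffAt.crossE {F : Type*} [NormedAddCommGroup F] [NormedSpace ℝ F] {a b : F → E3}
    {x : F} {n : WithTop ℕ∞} (ha : ContDiffAt ℝ n a x) (hb : ContDiffAt ℝ n b x) :
    ContDiffAt ℝ n (fun y => crossE (a y) (b y)) x := by
  have ha' := contDiffAt_euclidean.1 ha
  have hb' := contDiffAt_euclidean.1 hb
  rw [contDiffAt_euclidean]
  intro i
  fin_cases i
  · exact ((ha' 1).mul (hb' 2)).sub ((ha' 2).mul (hb' 1))
  · exact ((ha' 2).mul (hb' 0)).sub ((ha' 0).mul (hb' 2))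
  · exact ((ha' 0).mul (hb' 1)).sub ((ha' 1).mul (hb' 0))

/-- The inverse function theorem with a parameter. -/
theorem exists_parametric_chart {h₁ h₂ h₃ : E3 × E3 → ℝ} {b a₁ a₂ a₃ : E3}
    (c₁ : ContDiffAt ℝ 1 h₁ (b, b)) (c₂ : ContDiffAt ℝ 1 h₂ (b, b)) (c₃ : ContDiffAt ℝ 1 h₃ (b, b))
    (g₁ : HasGradientAt (fun x => h₁ (b, x)) a₁ b) (g₂ : HasGradientAt (fun x => h₂ (b, x)) a₂ b)
    (g₃ : HasGradientAt (fun x => h₃ (b, x)) a₃ b)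
    (ha : ∀ v, inner ℝ a₁ v = 0 → inner ℝ a₂ v = 0 → inner ℝ a₃ v = 0 → v = 0)
    {ε : ℝ} (hε : 0 < ε) :
    ∃ δ > 0, (∀ p x x', p ∈ ball b δ → x ∈ ball b δ → x' ∈ ball b δ → h₁ (p, x) = h₁ (p, x') →
        h₂ (p, x) = h₂ (p, x') → h₃ (p, x) = h₃ (p, x') → x = x') ∧
      (∀ p y₁ y₂ y₃, p ∈ ball b δ → |y₁ - h₁ (b, b)| < δ → |y₂ - h₂ (b, b)| < δ →
        |y₃ - h₃ (b, b)| < δ →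
        ∃ x ∈ ball b ε, h₁ (p, x) = y₁ ∧ h₂ (p, x) = y₂ ∧ h₃ (p, x) = y₃) := by
  set H : E3 × E3 → E3 := fun z => !₂[h₁ z, h₂ z, h₃ z]
  set κ : E3 × E3 → E3 × E3 := fun z => (z.1, H z) with hκ_def
  have hH : ContDiffAt ℝ 1 H (b, b) := by
    rw [contDiffAt_euclidean]
    intro i
    fin_cases i
    · exact c₁
    · exact c₂
    · exact c₃
  have hκ : ContDiffAt ℝ 1 κ (b, b) := contDiffAt_fst.prodMk hH
  have hpart : ∀ (k : E3 × E3 → ℝ) (a v : E3), ContDiffAt ℝ 1 k (b, b) →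
      HasGradientAt (fun x => k (b, x)) a b → fderiv ℝ k (b, b) (0, v) = inner ℝ a v := by
    intro k a v hk hg
    have h1 : HasFDerivAt (fun x : E3 => (b, x)) (ContinuousLinearMap.inr ℝ E3 E3) b :=
      hasFDerivAt_prodMk_right b b
    have h2 := ((hk.differentiableAt one_ne_zero).hasFDerivAt (x := (b, b))).comp b h1
    have h3 := h2.unique (hasGradientAt_iff_hasFDerivAt.1 hg)
    simpa using congrArg (fun L : E3 →L[ℝ] ℝ => L v) h3
  have hinj : ∀ v, fderiv ℝ κ (b, b) v = 0 → v = 0 := by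
    rintro ⟨v₁, v₂⟩ hv
    have h1 : HasFDerivAt κ ((ContinuousLinearMap.fst ℝ E3 E3).prod (fderiv ℝ H (b, b))) (b, b) :=
      hasFDerivAt_fst.prodMk (hH.differentiableAt one_ne_zero).hasFDerivAt
    rw [h1.fderiv] at hv
    have hv1 : v₁ = 0 := congrArg Prod.fst hv
    have hv2 : fderiv ℝ H (b, b) (v₁, v₂) = 0 := congrArg Prod.snd hv
    subst hv1
    have hd : ∀ i, (fderiv ℝ H (b, b) (0, v₂)) i = fderiv ℝ (fun x => H x i) (b, b) (0, v₂) := by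
      intro i
      have h1 := (EuclideanSpace.proj (𝕜 := ℝ) i : E3 →L[ℝ] ℝ).hasFDerivAt.comp (b, b)
        (hH.differentiableAt one_ne_zero).hasFDerivAt
      exact (congrArg (fun L : E3 × E3 →L[ℝ] ℝ => L (0, v₂)) h1.fderiv).symm
    rw [hv2] at hd
    rw [ha v₂ ((hpart h₁ a₁ v₂ c₁ g₁).symm.trans (hd 0).symm)
      ((hpart h₂ a₂ v₂ c₂ g₂).symm.trans (hd 1).symm)
      ((hpart h₃ a₃ v₂ c₃ g₃).symm.trans (hd 2).symm)]
    rfl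
  obtain ⟨W, r, σ, hWo, hbW, hWU, hr, -, hσ1, hσ2⟩ := exists_ball_chart hκ hinj
    (U := univ ×ˢ ball b ε) (prod_mem_nhds univ_mem (ball_mem_nhds b hε))
  obtain ⟨δ₁, hδ₁, hball⟩ := Metric.isOpen_iff.1 hWo _ hbW
  refine ⟨min δ₁ (r / 3), by positivity, ?_, ?_⟩
  · intro p x x' hp hx hx' e₁ e₂ e₃
    have hW : ∀ y ∈ ball b (min δ₁ (r / 3)), (p, y) ∈ W := fun y hy => hball (by
      rw [mem_ball, Prod.dist_eq]
      exact max_lt (lt_of_lt_of_le hp (min_le_left _ _)) (lt_of_lt_of_le hy (min_le_left _ _)))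
    have h1 := (hσ2 _ (hW x hx)).2
    have h2 := (hσ2 _ (hW x' hx')).2
    have h3 : κ (p, x) = κ (p, x') := by simp only [hκ_def, H, e₁, e₂, e₃]
    rw [h3, h2] at h1
    exact (congrArg Prod.snd h1).symm
  · intro p y₁ y₂ y₃ hp e₁ e₂ e₃
    have hy : ((p, !₂[y₁, y₂, y₃]) : E3 × E3) ∈ ball (κ (b, b)) r := by
      rw [mem_ball, Prod.dist_eq]
      refine max_lt (lt_of_lt_of_le hp ((min_le_right _ _).trans (by linarith))) ?_
      have hle : ∀ y h : ℝ, |y - h| < min δ₁ (r / 3) → |y - h| < r / 3 := fun y h hh =>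
        hh.trans_le (min_le_right _ _)
      have a1 := hle _ _ e₁
      have a2 := hle _ _ e₂
      have a3 := hle _ _ e₃
      rw [EuclideanSpace.dist_eq, Fin.sum_univ_three]
      refine (Real.sqrt_lt' hr).2 ?_
      simp only [hκ_def, H, Real.dist_eq, Matrix.cons_val]
      have b1 := abs_nonneg (y₁ - h₁ (b, b))
      have b2 := abs_nonneg (y₂ - h₂ (b, b))
      have b3 := abs_nonneg (y₃ - h₃ (b, b))
      nlinarith
    have h1 := hσ1 _ hy
    have h2 : (σ (p, !₂[y₁, y₂, y₃])).1 = p := congrArg Prod.fst h1.2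
    have h3 : H (σ (p, !₂[y₁, y₂, y₃])) = !₂[y₁, y₂, y₃] := congrArg Prod.snd h1.2
    have h4 : σ (p, !₂[y₁, y₂, y₃]) = (p, (σ (p, !₂[y₁, y₂, y₃])).2) := Prod.ext h2 rfl
    rw [h4] at h3
    exact ⟨_, (hWU h1.1).2, congrArg (fun z : E3 => z 0) h3, congrArg (fun z : E3 => z 1) h3,
      congrArg (fun z : E3 => z 2) h3⟩

/-- `x` lies in the plane through `b` which is normal, at `b`, to the intersection of the surface
(with normal `n` at `b`) with the sphere. -/
def InNormalPlane (n b x : E3) : Prop := inner ℝ (crossE n b) (x - b) = 0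

namespace TransversalRadius

variable {M : Set E3} {S s : ℝ}

/-- The normals along the intersection with the sphere can be chosen once and for all: the normal
planes do not depend on the defining function, as different defining functions have parallel
gradients on the surface. -/
theorem exists_normal (h : TransversalRadius M S s) : ∃ ν : E3 → E3, ∀ b₀ ∈ M ∩ sphere 0 s,
    ∃ (U : Set E3) (f : E3 → ℝ), b₀ ∈ U ∧ IsDefiningFunction M U f ∧
      LinearIndependent ℝ ![gradient f b₀, b₀] ∧
      ∀ b ∈ M ∩ U, ‖b‖ = s → ∀ x, InNormalPlane (ν b) b x ↔ InNormalPlane (gradient f b) b x := by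
  have h1 : ∀ b ∈ M ∩ sphere 0 s, ∃ n : E3, ∃ (U : Set E3) (f : E3 → ℝ), b ∈ U ∧
      IsDefiningFunction M U f ∧ n = gradient f b := by
    rintro b ⟨hbM, hbs⟩
    rw [mem_sphere_zero_iff_norm] at hbs
    obtain ⟨-, U, f, hbU, hU⟩ := h.isInteriorPoint hbM (hbs.trans_lt h.lt)
    exact ⟨_, U, f, hbU, hU, rfl⟩
  choose! ν hν using h1
  refine ⟨ν, fun b₀ hb₀ => ?_⟩
  obtain ⟨U, f, hbU, hU, -⟩ := hν b₀ hb₀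
  refine ⟨U, f, hbU, hU, h.transversal.linearIndependent hU hbU hb₀.1 (by simpa using hb₀.2),
    fun b hb hbs x => ?_⟩
  obtain ⟨U', f', hbU', hU', hn⟩ := hν b ⟨hb.1, by simpa using hbs⟩
  obtain ⟨c, hc⟩ := gradient_parallel_of_vanishes (f := f') (k := f) (hU'.contDiffAt hbU' 1)
    (hU'.regular b hbU') ((hU.contDiffAt hb.2 1).differentiableAt one_ne_zero) (by
      filter_upwards [hU.isOpen.mem_nhds hb.2, hU'.isOpen.mem_nhds hbU'] with x hx hx' hfx
      exact (hU.mem_iff hx).1 ((hU'.mem_iff hx').2 (hfx.trans ((hU'.mem_iff hbU').1 hb.1))))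
  have hc0 : c ≠ 0 := fun h0 => hU.regular b hb.2 (by rw [hc, h0, zero_smul])
  rw [hn, hc]
  simp [InNormalPlane, crossE_smul_left, inner_smul_left, hc0]

/-- The local form of the collar: near a point of the intersection with the sphere, pairs `(b, x)`
with `x` in the normal plane at `b` are determined by `b` and `‖x‖`, and also by `x`. -/
theorem exists_local_collar (h : TransversalRadius M S s) {ν : E3 → E3} {U : Set E3} {f : E3 → ℝ}
    {b₀ : E3} (hb₀ : b₀ ∈ M ∩ sphere 0 s) (hbU : b₀ ∈ U) (hU : IsDefiningFunction M U f)
    (hli : LinearIndependent ℝ ![gradient f b₀, b₀])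
    (hν : ∀ b ∈ M ∩ U, ‖b‖ = s → ∀ x, InNormalPlane (ν b) b x ↔ InNormalPlane (gradient f b) b x)
    {ε : ℝ} (hε : 0 < ε) :
    ∃ δ > 0,
      (∀ b x x', b ∈ M ∩ sphere 0 s → x ∈ M → x' ∈ M → b ∈ ball b₀ δ → x ∈ ball b₀ δ →
        x' ∈ ball b₀ δ → InNormalPlane (ν b) b x → InNormalPlane (ν b) b x' → ‖x‖ = ‖x'‖ →
        x = x') ∧
      (∀ x b b', b ∈ M ∩ sphere 0 s → b' ∈ M ∩ sphere 0 s → x ∈ ball b₀ δ → b ∈ ball b₀ δ →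
        b' ∈ ball b₀ δ → InNormalPlane (ν b) b x → InNormalPlane (ν b') b' x → b = b') ∧
      (∀ b τ, b ∈ M ∩ sphere 0 s → b ∈ ball b₀ δ → |τ| < δ →
        ∃ x ∈ M, x ∈ ball b₀ ε ∧ InNormalPlane (ν b) b x ∧ ‖x‖ = s + τ) ∧
      (∀ x, x ∈ ball b₀ δ → ∃ b ∈ M ∩ sphere 0 s, b ∈ ball b₀ ε ∧ InNormalPlane (ν b) b x) := by
  have hbs : ‖b₀‖ = s := by simpa using hb₀.2
  obtain ⟨r, hr, hrU⟩ := Metric.isOpen_iff.1 hU.isOpen b₀ hbU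
  set T : E3 → E3 := fun b => crossE (gradient f b) b
  have hT : ContDiffAt ℝ 1 T b₀ :=
    (contDiffAt_gradient (n := 1) (hU.contDiffAt hbU 2)).crossE contDiffAt_id
  have hf := hU.contDiffAt hbU 1
  have hT0 : T b₀ ≠ 0 := crossE_ne_zero hli
  have hf0 : f b₀ = 0 := (hU.mem_iff hbU).1 hb₀.1
  have hgf : HasGradientAt f (gradient f b₀) b₀ := (hf.differentiableAt one_ne_zero).hasGradientAt
  have hε' : 0 < min ε r := lt_min hε hr
  have hindep : ∀ c : ℝ, c ≠ 0 → ∀ v, inner ℝ (gradient f b₀) v = 0 →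
      inner ℝ ((2 : ℝ) • b₀) v = 0 → inner ℝ (c • T b₀) v = 0 → v = 0 := by
    intro c hc v h1 h2 h3
    rw [inner_smul_left] at h2 h3
    exact eq_zero_of_inner_crossE hT0 h1 ((mul_eq_zero.1 h2).resolve_left (by simp))
      ((mul_eq_zero.1 h3).resolve_left (by simpa using hc))
  -- the unknown is the point of the surface
  have hfst : ContDiffAt ℝ 1 (Prod.fst : E3 × E3 → E3) (b₀, b₀) := contDiffAt_fst
  have hsnd : ContDiffAt ℝ 1 (Prod.snd : E3 × E3 → E3) (b₀, b₀) := contDiffAt_snd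
  have hf2 : ContDiffAt ℝ 1 (fun z : E3 × E3 => f z.2) (b₀, b₀) :=
    ContDiffAt.comp (g := f) (b₀, b₀) hf hsnd
  have hn2 : ContDiffAt ℝ 1 (fun z : E3 × E3 => ‖z.2‖ ^ 2) (b₀, b₀) := hsnd.norm_sq ℝ
  have hT1 : ContDiffAt ℝ 1 (fun z : E3 × E3 => T z.1) (b₀, b₀) :=
    ContDiffAt.comp (g := T) (b₀, b₀) hT hfst
  have hT2 : ContDiffAt ℝ 1 (fun z : E3 × E3 => T z.2) (b₀, b₀) :=
    ContDiffAt.comp (g := T) (b₀, b₀) hT hsnd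
  obtain ⟨δ₁, hδ₁, u₁, v₁⟩ := exists_parametric_chart (b := b₀)
    (h₃ := fun z => inner ℝ (T z.1) (z.2 - z.1)) hf2 hn2 (hT1.inner ℝ (hsnd.sub hfst))
    (a₃ := (1 : ℝ) • T b₀) hgf (hasGradientAt_norm_sq b₀) (by
      have := hasGradientAt_inner (T b₀) b₀
      rw [hasGradientAt_iff_hasFDerivAt] at this ⊢
      simpa only [inner_sub_right, one_smul] using this.sub_const (inner ℝ (T b₀) b₀))
    (hindep 1 one_ne_zero) hε'
  -- the unknown is the point of the sphere
  obtain ⟨δ₂, hδ₂, u₂, v₂⟩ := exists_parametric_chart (b := b₀)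
    (h₃ := fun z => inner ℝ (T z.2) (z.1 - z.2)) hf2 hn2 (hT2.inner ℝ (hfst.sub hsnd))
    (a₃ := (-1 : ℝ) • T b₀) hgf (hasGradientAt_norm_sq b₀) (by
      rw [hasGradientAt_iff_hasFDerivAt]
      have h1 := (hT.differentiableAt one_ne_zero).hasFDerivAt.inner ℝ
        ((hasFDerivAt_id b₀).const_sub b₀)
      have e : InnerProductSpace.toDual ℝ E3 ((-1 : ℝ) • T b₀) =
          (fderivInnerCLM ℝ (T b₀, b₀ - id b₀)).comp
            ((fderiv ℝ T b₀).prod (-ContinuousLinearMap.id ℝ E3)) := by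
        ext v
        simp
      rw [e]
      exact h1)
    (hindep (-1) (by norm_num)) hε'
  -- the radii `s` and `s + τ` are compared through their squares
  obtain ⟨δ₃, hδ₃, hδ₃'⟩ : ∃ δ > 0, ∀ τ : ℝ, |τ| < δ → |(s + τ) ^ 2 - s ^ 2| < δ₁ ∧ 0 ≤ s + τ := by
    have h1 : ContinuousAt (fun τ : ℝ => (s + τ) ^ 2) 0 := by fun_prop
    have h2 : ∀ᶠ τ : ℝ in 𝓝 0, |(s + τ) ^ 2 - s ^ 2| < δ₁ := by
      have := h1.eventually (ball_mem_nhds _ hδ₁)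
      simpa [Real.dist_eq] using this
    have h3 : ∀ᶠ τ : ℝ in 𝓝 0, 0 ≤ s + τ := by
      filter_upwards [eventually_gt_nhds (show -s < 0 by linarith [h.pos])] with τ hτ
      linarith
    obtain ⟨δ, hδ, hb⟩ := Metric.eventually_nhds_iff.1 (h2.and h3)
    exact ⟨δ, hδ, fun τ hτ => hb (by simpa using hτ)⟩
  have hball : ∀ {x : E3}, x ∈ ball b₀ (min (min δ₁ δ₂) (min δ₃ r)) → x ∈ ball b₀ δ₁ ∧
      x ∈ ball b₀ δ₂ ∧ x ∈ U := by
    intro x hx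
    simp only [mem_ball, lt_min_iff] at hx
    exact ⟨hx.1.1, hx.1.2, hrU hx.2.2⟩
  have hnorm : ∀ {b : E3}, b ∈ M ∩ sphere 0 s → ‖b‖ = s := fun hb => by simpa using hb.2
  refine ⟨min (min δ₁ δ₂) (min δ₃ r), by positivity, ?_, ?_, ?_, ?_⟩
  · intro b x x' hb hx hx' hb1 hx1 hx1' hR hR' hxx
    have hR := (hν b ⟨hb.1, (hball hb1).2.2⟩ (hnorm hb) x).1 hR
    have hR' := (hν b ⟨hb.1, (hball hb1).2.2⟩ (hnorm hb) x').1 hR'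
    refine u₁ b x x' (hball hb1).1 (hball hx1).1 (hball hx1').1 ?_ ?_ ?_
    · exact ((hU.mem_iff (hball hx1).2.2).1 hx).trans ((hU.mem_iff (hball hx1').2.2).1 hx').symm
    · simp only [hxx]
    · exact hR.trans hR'.symm
  · intro x b b' hb hb' hx1 hb1 hb1' hR hR'
    have hR := (hν b ⟨hb.1, (hball hb1).2.2⟩ (hnorm hb) x).1 hR
    have hR' := (hν b' ⟨hb'.1, (hball hb1').2.2⟩ (hnorm hb') x).1 hR'
    refine u₂ x b b' (hball hx1).2.1 (hball hb1).2.1 (hball hb1').2.1 ?_ ?_ ?_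
    · exact ((hU.mem_iff (hball hb1).2.2).1 hb.1).trans
        ((hU.mem_iff (hball hb1').2.2).1 hb'.1).symm
    · simp only [hnorm hb, hnorm hb']
    · exact hR.trans hR'.symm
  · intro b τ hb hb1 hτ
    simp only [lt_min_iff] at hτ
    have h3 := hδ₃' τ hτ.2.1
    obtain ⟨x, hx, e₁, e₂, e₃⟩ := v₁ b 0 ((s + τ) ^ 2) 0 (hball hb1).1 (by simpa [hf0] using hδ₁)
      (by simpa [hbs] using h3.1) (by simpa using hδ₁)
    have hx' : x ∈ ball b₀ ε ∧ x ∈ U := by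
      simp only [mem_ball, lt_min_iff] at hx
      exact ⟨hx.1, hrU hx.2⟩
    exact ⟨x, (hU.mem_iff hx'.2).2 e₁, hx'.1,
      (hν b ⟨hb.1, (hball hb1).2.2⟩ (hnorm hb) x).2 e₃,
      (pow_left_inj₀ (norm_nonneg x) h3.2 two_ne_zero).1 e₂⟩
  · intro x hx
    obtain ⟨b, hb, e₁, e₂, e₃⟩ := v₂ x 0 (s ^ 2) 0 (hball hx).2.1 (by simpa [hf0] using hδ₂)
      (by simpa [hbs] using hδ₂) (by simpa using hδ₂)
    have hb' : b ∈ ball b₀ ε ∧ b ∈ U := by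
      simp only [mem_ball, lt_min_iff] at hb
      exact ⟨hb.1, hrU hb.2⟩
    have hbM := (hU.mem_iff hb'.2).2 e₁
    have hbn : ‖b‖ = s := (pow_left_inj₀ (norm_nonneg b) h.pos.le two_ne_zero).1 e₂
    exact ⟨b, ⟨hbM, by simpa using hbn⟩, hb'.1, (hν b ⟨hbM, hb'.2⟩ hbn x).2 e₃⟩

end TransversalRadius

/-- A collar of width `δ` of the intersection of `M` with the sphere of radius `s`:
`(b, τ) ↦ toFun b τ` is a homeomorphism from `(M ∩ sphere) × [-δ, δ]` onto the part of `M` whose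
distance to the origin is within `δ` of `s`, and `toFun b τ` is at distance `s + τ` from the
origin. The inverse is `x ↦ (proj x, ‖x‖ - s)`. -/
structure Collar (M : Set E3) (s δ : ℝ) where
  /-- The parametrisation, with arbitrary values outside `(M ∩ sphere) × [-δ, δ]`. -/
  toFun : E3 → ℝ → E3
  /-- The first component of the inverse, with arbitrary values outside the collar. -/
  proj : E3 → E3
  pos : 0 < δ
  mem : ∀ b ∈ M ∩ sphere 0 s, ∀ τ, |τ| ≤ δ → toFun b τ ∈ M
  norm_eq : ∀ b ∈ M ∩ sphere 0 s, ∀ τ, |τ| ≤ δ → ‖toFun b τ‖ = s + τ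
  proj_toFun : ∀ b ∈ M ∩ sphere 0 s, ∀ τ, |τ| ≤ δ → proj (toFun b τ) = b
  toFun_zero : ∀ b ∈ M ∩ sphere 0 s, toFun b 0 = b
  proj_mem : ∀ x ∈ M, |‖x‖ - s| ≤ δ → proj x ∈ M ∩ sphere 0 s
  toFun_proj : ∀ x ∈ M, |‖x‖ - s| ≤ δ → toFun (proj x) (‖x‖ - s) = x
  continuousOn_toFun : ContinuousOn (fun z : E3 × ℝ => toFun z.1 z.2)
    ((M ∩ sphere 0 s) ×ˢ Icc (-δ) δ)
  continuousOn_proj : ContinuousOn proj {x | x ∈ M ∧ |‖x‖ - s| ≤ δ}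

namespace TransversalRadius

variable {M : Set E3} {S s : ℝ}

/-- The collar is swept out by the normal planes of the intersection of `M` with the sphere: near
`b`, the surface meets the plane at `b` in exactly one point at each distance close to `s`, and each
point of `M` near the sphere lies in exactly one of the planes at nearby points. -/
theorem exists_collar (h : TransversalRadius M S s) {S' : ℝ} (hS' : s < S') :
    ∃ δ, s + δ < S' ∧ Nonempty (Collar M s δ) := by
  obtain ⟨ν, hν⟩ := h.exists_normal
  set K := M ∩ sphere (0 : E3) s with hK_def
  have hK : IsCompact K := h.minimal.isCompact.inter_right isClosed_sphere
  choose! U f hbU hU hli hloc using hν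
  have hlocal := fun b₀ (hb₀ : b₀ ∈ K) (ε : ℝ) (hε : 0 < ε) =>
    h.exists_local_collar hb₀ (hbU b₀ hb₀) (hU b₀ hb₀) (hli b₀ hb₀) (hloc b₀ hb₀) hε
  set R : E3 → E3 → Prop := fun b x => InNormalPlane (ν b) b x with hR_def
  -- compactness of `K` makes the local statements uniform
  have unif : ∀ P : ℝ → E3 → Prop, (∀ b₀ ∈ K, ∃ δ > 0, ∀ r, 0 < r → r < δ → ∀ b ∈ K,
      dist b b₀ < δ → P r b) → ∃ δ > 0, ∀ r, 0 < r → r < δ → ∀ b ∈ K, P r b := by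
    intro P hP
    have h1 : ∀ᶠ r in 𝓝 (0 : ℝ), ∀ b ∈ K, 0 < r → b ∈ K → P r b := by
      refine hK.eventually_forall_of_forall_eventually fun b₀ hb₀ => ?_
      obtain ⟨δ, hδ, hPδ⟩ := hP b₀ hb₀
      rw [nhds_prod_eq]
      have e1 : ∀ᶠ r in 𝓝 (0 : ℝ), r < δ := gt_mem_nhds hδ
      have e2 : ∀ᶠ b in 𝓝 b₀, dist b b₀ < δ := ball_mem_nhds b₀ hδ
      filter_upwards [e1.prod_mk e2] with z hz h0 hzK using hPδ z.1 h0 hz.1 z.2 hzK hz.2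
    obtain ⟨δ, hδ, hb⟩ := Metric.eventually_nhds_iff.1 h1
    refine ⟨δ, hδ, fun r hr0 hr b hbK => hb ?_ b hbK hr0 hbK⟩
    rwa [Real.dist_eq, sub_zero, abs_of_pos hr0]
  obtain ⟨η₁, hη₁, huniq₁⟩ := unif (fun r b => ∀ x ∈ M, ∀ x' ∈ M, dist x b < r → dist x' b < r →
      R b x → R b x' → ‖x‖ = ‖x'‖ → x = x') (fun b₀ hb₀ => by
    obtain ⟨δ, hδ, h1, -⟩ := hlocal b₀ hb₀ 1 one_pos
    refine ⟨δ / 2, by positivity, fun r _ hr b hb hbb x hx x' hx' hxb hxb' => ?_⟩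
    refine h1 b x x' hb hx hx' (by rw [mem_ball]; linarith) ?_ ?_
    · rw [mem_ball]; linarith [dist_triangle x b b₀]
    · rw [mem_ball]; linarith [dist_triangle x' b b₀])
  obtain ⟨η₂, hη₂, huniq₂⟩ := unif (fun r b => ∀ b' ∈ K, ∀ x, dist x b < r → dist x b' < r →
      R b x → R b' x → b = b') (fun b₀ hb₀ => by
    obtain ⟨δ, hδ, -, h1, -⟩ := hlocal b₀ hb₀ 1 one_pos
    refine ⟨δ / 3, by positivity, fun r _ hr b hb hbb b' hb' x hxb hxb' => ?_⟩
    have := dist_triangle x b b₀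
    have := dist_triangle b' x b₀
    rw [dist_comm b' x] at this
    refine h1 x b b' hb hb' ?_ ?_ ?_ <;> rw [mem_ball] <;> linarith)
  set η := min η₁ η₂ / 2
  have hη : 0 < η := by positivity
  have hη1 : η < η₁ := by have := min_le_left η₁ η₂; simp only [η]; linarith
  have hη2 : η < η₂ := by have := min_le_right η₁ η₂; simp only [η]; linarith
  have uniq₁ := huniq₁ η hη hη1
  have uniq₂ := huniq₂ η hη hη2
  clear_value η
  obtain ⟨δ₁, hδ₁, hex₁⟩ := unif (fun r b => ∀ τ, |τ| ≤ r →
      ∃ x ∈ M, dist x b ≤ η / 2 ∧ R b x ∧ ‖x‖ = s + τ) (fun b₀ hb₀ => by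
    obtain ⟨δ, hδ, -, -, h1, -⟩ := hlocal b₀ hb₀ (η / 4) (by positivity)
    refine ⟨min δ (η / 4), by positivity, fun r _ hr b hb hbb τ hτ => ?_⟩
    rw [lt_min_iff] at hr hbb
    obtain ⟨x, hxM, hx, hR, hn⟩ := h1 b τ hb hbb.1 (hτ.trans_lt hr.1)
    rw [mem_ball] at hx
    have := dist_triangle_right x b b₀
    exact ⟨x, hxM, by linarith, hR, hn⟩)
  obtain ⟨δ₂, hδ₂, hex₂⟩ := unif (fun r b₁ => ∀ x, dist x b₁ ≤ r →
      ∃ b ∈ K, dist x b ≤ η / 2 ∧ R b x) (fun b₀ hb₀ => by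
    obtain ⟨δ, hδ, -, -, -, h1⟩ := hlocal b₀ hb₀ (η / 4) (by positivity)
    refine ⟨min δ (η / 4) / 2, by positivity, fun r _ hr b hb hbb x hx => ?_⟩
    have h2 := dist_triangle x b b₀
    have h3 : dist x b₀ < min δ (η / 4) := by linarith
    rw [lt_min_iff] at h3
    obtain ⟨b', hb', hd, hR⟩ := h1 x h3.1
    rw [mem_ball] at hd
    exact ⟨b', hb', by linarith [dist_triangle_right x b' b₀], hR⟩)
  obtain ⟨δ₃, hδ₃, hnear⟩ : ∃ δ > 0, ∀ x ∈ M, |‖x‖ - s| ≤ δ → ∃ b ∈ K, dist x b ≤ δ₂ / 2 := by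
    by_contra hcon
    push Not at hcon
    have hseq : ∀ n : ℕ, ∃ x ∈ M, |‖x‖ - s| ≤ 1 / (n + 1) ∧ ∀ b ∈ K, δ₂ / 2 < dist x b :=
      fun n => hcon (1 / (n + 1)) (by positivity)
    choose x hxM hxn hxd using hseq
    obtain ⟨a, haM, φ, hφ, ha⟩ := h.minimal.isCompact.tendsto_subseq hxM
    have h1 : Tendsto (fun n => |‖x (φ n)‖ - s|) atTop (𝓝 0) :=
      squeeze_zero (fun _ => abs_nonneg _) (fun n => hxn (φ n))
        (tendsto_one_div_add_atTop_nhds_zero_nat.comp hφ.tendsto_atTop)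
    have h2 : Tendsto (fun n => |‖x (φ n)‖ - s|) atTop (𝓝 |‖a‖ - s|) :=
      (ha.norm.sub_const s).abs
    have h3 := tendsto_nhds_unique h1 h2
    have haK : a ∈ K := by
      refine ⟨haM, ?_⟩
      rw [mem_sphere_zero_iff_norm]
      linarith [abs_eq_zero.1 h3.symm]
    have h4 : Tendsto (fun n => dist (x (φ n)) a) atTop (𝓝 0) := by
      have := ha.dist (tendsto_const_nhds (x := a))
      rwa [dist_self] at this
    obtain ⟨n, hn⟩ := (h4.eventually (gt_mem_nhds (half_pos hδ₂))).exists
    exact absurd hn (not_lt.2 (hxd (φ n) a haK).le)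
  set δ := min (min (δ₁ / 2) δ₃) ((S' - s) / 2)
  have hδ : 0 < δ := lt_min (lt_min (half_pos hδ₁) hδ₃) (by linarith)
  have hδ1 : δ < δ₁ := by
    have : δ ≤ δ₁ / 2 := (min_le_left _ _).trans (min_le_left _ _)
    linarith
  have hδ3 : δ ≤ δ₃ := (min_le_left _ _).trans (min_le_right _ _)
  have hδS : s + δ < S' := by
    have : δ ≤ (S' - s) / 2 := min_le_right _ _
    linarith
  clear_value δ
  have hΦ : ∀ b ∈ K, ∀ τ, |τ| ≤ δ → ∃ x ∈ M, dist x b ≤ η / 2 ∧ R b x ∧ ‖x‖ = s + τ :=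
    fun b hb τ hτ => hex₁ δ hδ hδ1 b hb τ hτ
  choose! Φ hΦM hΦd hΦR hΦn using hΦ
  have hβ : ∀ x, x ∈ M ∧ |‖x‖ - s| ≤ δ → ∃ b ∈ K, dist x b ≤ η / 2 ∧ R b x := by
    rintro x ⟨hx, hxs⟩
    obtain ⟨b, hb, hd⟩ := hnear x hx (hxs.trans hδ3)
    exact hex₂ (δ₂ / 2) (by positivity) (by linarith) b hb x hd
  choose! β hβK hβd hβR using hβ
  have hη' : ∀ {r : ℝ}, r ≤ η / 2 → r < η := fun hr => by linarith
  have hΦs : ∀ b ∈ K, ∀ τ, |τ| ≤ δ → |‖Φ b τ‖ - s| ≤ δ := fun b hb τ hτ => by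
    rw [hΦn b hb τ hτ, add_sub_cancel_left]; exact hτ
  have hβΦ : ∀ b ∈ K, ∀ τ, |τ| ≤ δ → β (Φ b τ) = b := fun b hb τ hτ => by
    have hx : Φ b τ ∈ M ∧ |‖Φ b τ‖ - s| ≤ δ := ⟨hΦM b hb τ hτ, hΦs b hb τ hτ⟩
    exact uniq₂ _ (hβK _ hx) b hb _ (hη' (hβd _ hx)) (hη' (hΦd b hb τ hτ)) (hβR _ hx)
      (hΦR b hb τ hτ)
  have hΦβ : ∀ x ∈ M, |‖x‖ - s| ≤ δ → Φ (β x) (‖x‖ - s) = x := fun x hx hxs => by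
    have hb := hβK x ⟨hx, hxs⟩
    refine uniq₁ _ hb _ (hΦM _ hb _ hxs) x hx (hη' (hΦd _ hb _ hxs)) (hη' (hβd x ⟨hx, hxs⟩))
      (hΦR _ hb _ hxs) (hβR x ⟨hx, hxs⟩) ?_
    rw [hΦn _ hb _ hxs]; ring
  have hR0 : ∀ b, R b b := fun b => by simp [hR_def, InNormalPlane]
  have hKn : ∀ b ∈ K, ‖b‖ = s := fun b hb => by simpa using hb.2
  have hΦ0 : ∀ b ∈ K, Φ b 0 = b := fun b hb => by
    have h0 : |(0 : ℝ)| ≤ δ := by rw [abs_zero]; exact hδ.le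
    exact uniq₁ b hb _ (hΦM b hb 0 h0) b hb.1 (hη' (hΦd b hb 0 h0)) (by rw [dist_self]; exact hη)
      (hΦR b hb 0 h0) (hR0 b) (by rw [hΦn b hb 0 h0, hKn b hb, add_zero])
  have hΦc : ContinuousOn (fun z : E3 × ℝ => Φ z.1 z.2) (K ×ˢ Icc (-δ) δ) := by
    rintro ⟨b, τ⟩ ⟨hb, hτ⟩
    rw [mem_Icc, ← abs_le] at hτ
    refine h.minimal.isCompact.tendsto_nhds_of_unique_mapClusterPt ?_ ?_
    · filter_upwards [self_mem_nhdsWithin] with z hz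
      exact hΦM z.1 hz.1 z.2 (abs_le.2 hz.2)
    · intro y hyM hy
      obtain ⟨𝓤, h𝓤, hlim⟩ := mapClusterPt_iff_ultrafilter.1 hy
      have hmem : ∀ᶠ z : E3 × ℝ in 𝓤, z ∈ K ×ˢ Icc (-δ) δ :=
        h𝓤 self_mem_nhdsWithin
      have h1 : Tendsto Prod.fst (𝓤 : Filter (E3 × ℝ)) (𝓝 b) :=
        (continuous_fst.tendsto (b, τ)).mono_left (h𝓤.trans nhdsWithin_le_nhds)
      have h2 : Tendsto Prod.snd (𝓤 : Filter (E3 × ℝ)) (𝓝 τ) :=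
        (continuous_snd.tendsto (b, τ)).mono_left (h𝓤.trans nhdsWithin_le_nhds)
      have hyd : dist y b ≤ η / 2 := by
        refine le_of_tendsto (hlim.dist h1) ?_
        filter_upwards [hmem] with z hz using hΦd z.1 hz.1 z.2 (abs_le.2 hz.2)
      have hyn : ‖y‖ = s + τ := by
        refine tendsto_nhds_unique hlim.norm ((h2.const_add s).congr' ?_)
        filter_upwards [hmem] with z hz using (hΦn z.1 hz.1 z.2 (abs_le.2 hz.2)).symm
      have hyR : R b y := by
        have hbs := hKn b hb
        refine (hloc b hb b ⟨hb.1, hbU b hb⟩ hbs y).2 ?_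
        have hT : ContinuousAt (fun x => crossE (gradient (f b) x) x) b :=
          ((contDiffAt_gradient (n := 0) ((hU b hb).contDiffAt (hbU b hb) 1)).crossE
            contDiffAt_id).continuousAt
        have h3 : Tendsto (fun z : E3 × ℝ => (inner ℝ (crossE (gradient (f b) z.1) z.1)
            (Φ z.1 z.2 - z.1) : ℝ)) 𝓤 (𝓝 (inner ℝ (crossE (gradient (f b) b) b) (y - b))) :=
          (hT.tendsto.comp h1).inner (hlim.sub h1)
        refine tendsto_nhds_unique h3 (tendsto_const_nhds.congr' ?_)
        filter_upwards [hmem, h1.eventually ((hU b hb).isOpen.mem_nhds (hbU b hb))] with z hz hzU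
        exact ((hloc b hb z.1 ⟨hz.1.1, hzU⟩ (hKn _ hz.1) _).1
          (hΦR z.1 hz.1 z.2 (abs_le.2 hz.2))).symm
      exact uniq₁ b hb y hyM _ (hΦM b hb τ hτ) (hη' hyd) (hη' (hΦd b hb τ hτ)) hyR
        (hΦR b hb τ hτ) (hyn.trans (hΦn b hb τ hτ).symm)
  refine ⟨δ, hδS, ⟨{
    toFun := Φ
    proj := β
    pos := hδ
    mem := hΦM
    norm_eq := hΦn
    proj_toFun := hβΦ
    toFun_zero := hΦ0
    proj_mem := fun x hx hxs => hβK x ⟨hx, hxs⟩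
    toFun_proj := hΦβ
    continuousOn_toFun := hΦc
    continuousOn_proj := ?_ }⟩⟩
  intro x hx
  refine hK.tendsto_nhds_of_unique_mapClusterPt ?_ ?_
  · filter_upwards [self_mem_nhdsWithin] with y hy using hβK y hy
  · intro b hb hcl
    obtain ⟨𝓤, h𝓤, hlim⟩ := mapClusterPt_iff_ultrafilter.1 hcl
    have hmem : ∀ᶠ y in (𝓤 : Filter E3), y ∈ {x | x ∈ M ∧ |‖x‖ - s| ≤ δ} :=
      h𝓤 self_mem_nhdsWithin
    have h1 : Tendsto id (𝓤 : Filter E3) (𝓝 x) := h𝓤.trans nhdsWithin_le_nhds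
    have h2 : Tendsto (fun y => Φ (β y) (‖y‖ - s)) (𝓤 : Filter E3) (𝓝 (Φ b (‖x‖ - s))) := by
      refine (hΦc (b, ‖x‖ - s) ⟨hb, abs_le.1 hx.2⟩).tendsto.comp
        (f := fun y => (β y, ‖y‖ - s)) (tendsto_nhdsWithin_iff.2 ⟨?_, ?_⟩)
      · exact hlim.prodMk_nhds (h1.norm.sub_const s)
      · filter_upwards [hmem] with y hy using ⟨hβK y hy, abs_le.1 hy.2⟩
    have h3 : Φ b (‖x‖ - s) = x := by
      refine tendsto_nhds_unique h2 (h1.congr' ?_)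
      filter_upwards [hmem] with y hy using (hΦβ y hy.1 hy.2).symm
    rw [← h3]
    exact (hβΦ b hb _ hx.2).symm

end TransversalRadius

/-! ### Compact connected one-dimensional manifolds -/

section OneManifold

variable {C : Type*} [TopologicalSpace C]

theorem Topology.IsOpenEmbedding.exists_lift {u : ℝ → C} (hu : IsOpenEmbedding u) {φ : ℝ → C}
    {s : Set ℝ} (hφ : ContinuousOn φ s) (hs : ∀ x ∈ s, φ x ∈ range u) :
    ∃ g : ℝ → ℝ, ContinuousOn g s ∧ ∀ x ∈ s, u (g x) = φ x := by
  set e := hu.toOpenPartialHomeomorph u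
  have ht : e.target = range u := by simp [e]
  refine ⟨fun x => e.symm (φ x), ?_, fun x hx => ?_⟩
  · exact e.continuousOn_symm.comp hφ fun x hx => by rw [ht]; exact hs x hx
  · have := e.right_inv (x := φ x) (by rw [ht]; exact hs x hx)
    simpa [e] using this

theorem isOpenEmbedding_comp_neg {u : ℝ → C} (hu : IsOpenEmbedding u) :
    IsOpenEmbedding fun t => u (-t) :=
  hu.comp (Homeomorph.neg ℝ).isOpenEmbedding

theorem range_comp_neg {C : Type*} (u : ℝ → C) : (range fun t => u (-t)) = range u :=
  (Equiv.neg ℝ).surjective.range_comp u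

/-- Invariance of domain for one-dimensional manifolds. -/
theorem image_Ioo_mem_nhds {w v : ℝ → C} (hv : IsOpenEmbedding v) {a b t : ℝ} (ht : t ∈ Ioo a b)
    (hw : ContinuousOn w (Ioo a b)) (hi : InjOn w (Ioo a b)) (htv : w t ∈ range v) :
    w '' Ioo a b ∈ 𝓝 (w t) := by
  have h1 : w ⁻¹' range v ∈ 𝓝 t :=
    (hw.continuousAt (Ioo_mem_nhds ht.1 ht.2)).preimage_mem_nhds (hv.isOpen_range.mem_nhds htv)
  obtain ⟨ε, hε, hball⟩ := Metric.nhds_basis_closedBall.mem_iff.1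
    (inter_mem h1 (Ioo_mem_nhds ht.1 ht.2))
  rw [Real.closedBall_eq_Icc] at hball
  obtain ⟨g, hg, hgw⟩ := hv.exists_lift (hw.mono fun x hx => (hball hx).2)
    fun x hx => (hball hx).1
  have hgi : InjOn g (Icc (t - ε) (t + ε)) := fun x hx y hy hxy =>
    hi (hball hx).2 (hball hy).2 (by rw [← hgw x hx, ← hgw y hy, hxy])
  have m1 : t - ε ∈ Icc (t - ε) (t + ε) := ⟨le_rfl, by linarith⟩
  have m2 : t ∈ Icc (t - ε) (t + ε) := ⟨by linarith, by linarith⟩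
  have m3 : t + ε ∈ Icc (t - ε) (t + ε) := ⟨by linarith, le_rfl⟩
  have key : g '' Icc (t - ε) (t + ε) ∈ 𝓝 (g t) := by
    rcases hg.strictMonoOn_of_injOn_Icc' (by linarith) hgi with h | h
    · exact mem_of_superset (Icc_mem_nhds (h m1 m2 (by linarith)) (h m2 m3 (by linarith)))
        (intermediate_value_Icc (by linarith) hg)
    · exact mem_of_superset (Icc_mem_nhds (h m2 m3 (by linarith)) (h m1 m2 (by linarith)))
        (intermediate_value_Icc' (by linarith) hg)
  have h2 := hv.isOpenMap.image_mem_nhds key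
  rw [hgw t m2, image_image] at h2
  refine mem_of_superset h2 ?_
  rintro _ ⟨x, hx, rfl⟩
  simp only
  rw [hgw x hx]
  exact ⟨x, (hball hx).2, rfl⟩

theorem isOpenEmbedding_of_injective (hC : ∀ x : C, ∃ v : ℝ → C, IsOpenEmbedding v ∧ x ∈ range v)
    {w : ℝ → C} (hw : Continuous w) (hi : Function.Injective w) : IsOpenEmbedding w := by
  refine IsOpenEmbedding.of_continuous_injective_isOpenMap hw hi
    (isOpenMap_iff_nhds_le.2 fun t => ?_)
  intro s hs
  rw [mem_map] at hs
  obtain ⟨ε, hε, hball⟩ := Metric.mem_nhds_iff.1 hs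
  obtain ⟨v, hv, htv⟩ := hC (w t)
  rw [Real.ball_eq_Ioo] at hball
  refine mem_of_superset (image_Ioo_mem_nhds hv (a := t - ε) (b := t + ε)
    ⟨by linarith, by linarith⟩ hw.continuousOn hi.injOn htv) ?_
  rintro _ ⟨x, hx, rfl⟩
  exact hball hx

theorem exists_first_exit {O : Set ℝ} (hO : IsOpen O) {o c₀ : ℝ} (ho : o ∈ O) (hc₀ : c₀ ∉ O)
    (hlt : o < c₀) : ∃ c, o < c ∧ c ≤ c₀ ∧ c ∉ O ∧ ∀ x ∈ Ico o c, x ∈ O := by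
  have hcpt : IsCompact (Icc o c₀ \ O) := isCompact_Icc.diff hO
  obtain ⟨c, hc, hleast⟩ := hcpt.exists_isLeast ⟨c₀, ⟨hlt.le, le_rfl⟩, hc₀⟩
  refine ⟨c, lt_of_le_of_ne hc.1.1 fun h => hc.2 (h ▸ ho), hc.1.2, hc.2, fun x hx => ?_⟩
  by_contra hxO
  exact absurd (hleast ⟨⟨hx.1, hx.2.le.trans hc.1.2⟩, hxO⟩) (not_le.2 hx.2)

theorem exists_last_entry {O : Set ℝ} (hO : IsOpen O) {o c₀ : ℝ} (ho : o ∈ O) (hc₀ : c₀ ∉ O)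
    (hlt : c₀ < o) : ∃ c, c₀ ≤ c ∧ c < o ∧ c ∉ O ∧ ∀ x ∈ Ioc c o, x ∈ O := by
  have hcpt : IsCompact (Icc c₀ o \ O) := isCompact_Icc.diff hO
  obtain ⟨c, hc, hgr⟩ := hcpt.exists_isGreatest ⟨c₀, ⟨le_rfl, hlt.le⟩, hc₀⟩
  refine ⟨c, hc.1.1, lt_of_le_of_ne hc.1.2 fun h => hc.2 (h ▸ ho), hc.2, fun x hx => ?_⟩
  by_contra hxO
  exact absurd (hgr ⟨⟨hc.1.1.trans hx.1.le, hx.2⟩, hxO⟩) (not_le.2 hx.1)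

/-- The concatenation of `u`, up to the parameter `T`, with `v` run backwards from the
parameter `o`. -/
noncomputable def concatArc {C : Type*} (u v : ℝ → C) (T o : ℝ) : ℝ → C :=
  fun t => if t ≤ T then u t else v (o - (t - T))

theorem continuous_concatArc {u v : ℝ → C} (hu : Continuous u) (hv : Continuous v) {T o : ℝ}
    (hT : u T = v o) : Continuous (concatArc u v T o) := by
  refine Continuous.if_le hu (by fun_prop) continuous_id continuous_const fun t ht => ?_
  rw [ht, hT]; simp

/-- A closed curve parametrised by an interval, simple except for its end points, is parametrised by
the circle. -/
theorem exists_circle_of_closed_curve {w : ℝ → C} {p q : ℝ} (hpq : p < q) (hw : Continuous w)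
    (hi : InjOn w (Ico p q)) (he : w p = w q) :
    ∃ e : Circle → C, Continuous e ∧ Function.Injective e ∧ range e = w '' Icc p q := by
  have hfact : Fact (0 < q - p) := ⟨by linarith⟩
  have hpq' : p + (q - p) = q := by ring
  set L : AddCircle (q - p) → C := AddCircle.liftIco (q - p) p w
  have hL : Continuous L := AddCircle.liftIco_continuous (by rw [hpq', he]) hw.continuousOn
  set φ := AddCircle.homeomorphCircle (T := q - p) (by linarith : q - p ≠ 0)
  have hmem : ∀ x, (AddCircle.equivIco (q - p) p x : ℝ) ∈ Ico p q := fun x =>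
    ⟨(AddCircle.equivIco (q - p) p x).2.1, by linarith [(AddCircle.equivIco (q - p) p x).2.2]⟩
  have hLi : Function.Injective L := by
    intro x y hxy
    have hx := hmem x
    have hy := hmem y
    exact (AddCircle.equivIco (q - p) p).injective (Subtype.ext (hi hx hy hxy))
  refine ⟨L ∘ φ.symm, hL.comp φ.symm.continuous, hLi.comp φ.symm.injective, ?_⟩
  rw [φ.symm.surjective.range_comp]
  refine Subset.antisymm ?_ ?_
  · rintro _ ⟨x, rfl⟩
    exact ⟨_, Ico_subset_Icc_self (hmem x), rfl⟩
  · rintro _ ⟨t, ht, rfl⟩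
    rcases eq_or_lt_of_le ht.2 with h | h
    · refine ⟨(p : AddCircle (q - p)), ?_⟩
      rw [h, ← he]
      exact AddCircle.liftIco_coe_apply ⟨le_rfl, by linarith⟩
    · exact ⟨(t : AddCircle (q - p)), AddCircle.liftIco_coe_apply ⟨ht.1, by linarith⟩⟩

variable [T2Space C]

/-- If the arc `v` enters the open arc `u` at the parameter `a` and stays in it up to the parameter
`o`, then the part of `v` in between is an entire end of `u`. -/
theorem image_Ioc_eq_end {u v : ℝ → C} (hu : IsOpenEmbedding u) (hv : IsOpenEmbedding v)
    {a o T : ℝ} (hao : a < o) (hO : ∀ x ∈ Ioc a o, v x ∈ range u) (ha : v a ∉ range u)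
    (hT : u T = v o) : v '' Ioc a o = u '' Ici T ∨ v '' Ioc a o = u '' Iic T := by
  obtain ⟨g, hg, hgv⟩ := hu.exists_lift hv.continuous.continuousOn hO
  have hoI : o ∈ Ioc a o := ⟨hao, le_rfl⟩
  have hgo : g o = T := hu.injective ((hgv o hoI).trans hT.symm)
  have hgi : InjOn g (Ioc a o) := fun x hx y hy hxy =>
    hv.injective (by rw [← hgv x hx, ← hgv y hy, hxy])
  have himg : v '' Ioc a o = u '' (g '' Ioc a o) := by
    rw [image_image]
    exact image_congr fun x hx => (hgv x hx).symm
  -- the image of `g` is not contained in a compact interval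
  have hunb : ∀ m K : ℝ, ¬ g '' Ioc a o ⊆ Icc m K := by
    intro m K hsub
    have h1 : IsClosed (u '' Icc m K) := (isCompact_Icc.image hu.continuous).isClosed
    have h2 : v a ∈ closure (v '' Ioc a o) := by
      refine image_closure_subset_closure_image hv.continuous ⟨a, ?_, rfl⟩
      rw [closure_Ioc hao.ne]
      exact ⟨le_rfl, hao.le⟩
    rw [himg] at h2
    have h3 := closure_minimal (image_mono hsub) h1 h2
    exact ha (image_subset_range _ _ h3)
  have hsub : ∀ {x y : ℝ}, a < x → y ≤ o → Icc x y ⊆ Ioc a o := fun hx hy z hz =>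
    ⟨hx.trans_le hz.1, hz.2.trans hy⟩
  have hside : (∀ x ∈ Ioo a o, T < g x) ∨ (∀ x ∈ Ioo a o, g x < T) := by
    by_contra hcon
    push Not at hcon
    obtain ⟨⟨x, hx, hxT⟩, y, hy, hyT⟩ := hcon
    have hpre : IsPreconnected (g '' Ioo a o) :=
      isPreconnected_Ioo.image g (hg.mono Ioo_subset_Ioc_self)
    have : T ∈ g '' Ioo a o := hpre.Icc_subset (mem_image_of_mem g hx) (mem_image_of_mem g hy)
      ⟨hxT, hyT⟩
    obtain ⟨z, hz, hzT⟩ := this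
    exact hz.2.ne (hgi (Ioo_subset_Ioc_self hz) hoI (hzT.trans hgo.symm))
  have hpre : IsPreconnected (g '' Ioc a o) := isPreconnected_Ioc.image g hg
  have hTm : T ∈ g '' Ioc a o := ⟨o, hoI, hgo⟩
  rcases hside with h | h
  · left
    rw [himg]
    congr 1
    refine Subset.antisymm ?_ fun K hK => ?_
    · rintro _ ⟨x, hx, rfl⟩
      rcases hx.2.lt_or_eq with h1 | h1
      · exact (h x ⟨hx.1, h1⟩).le
      · rw [h1, hgo]; exact self_mem_Ici
    · by_contra hcon
      refine hunb T K ?_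
      rintro _ ⟨x, hx, rfl⟩
      refine ⟨?_, ?_⟩
      · rcases hx.2.lt_or_eq with h1 | h1
        · exact (h x ⟨hx.1, h1⟩).le
        · rw [h1, hgo]
      · by_contra hlt
        exact hcon (hpre.Icc_subset hTm (mem_image_of_mem g hx) ⟨hK, (not_le.1 hlt).le⟩)
  · right
    rw [himg]
    congr 1
    refine Subset.antisymm ?_ fun K hK => ?_
    · rintro _ ⟨x, hx, rfl⟩
      rcases hx.2.lt_or_eq with h1 | h1
      · exact (h x ⟨hx.1, h1⟩).le
      · rw [h1, hgo]; exact self_mem_Iic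
    · by_contra hcon
      refine hunb K T ?_
      rintro _ ⟨x, hx, rfl⟩
      refine ⟨?_, ?_⟩
      · by_contra hlt
        exact hcon (hpre.Icc_subset (mem_image_of_mem g hx) hTm ⟨(not_le.1 hlt).le, hK⟩)
      · rcases hx.2.lt_or_eq with h1 | h1
        · exact (h x ⟨hx.1, h1⟩).le
        · rw [h1, hgo]

theorem image_Ico_eq_end {u v : ℝ → C} (hu : IsOpenEmbedding u) (hv : IsOpenEmbedding v)
    {c o T : ℝ} (hoc : o < c) (hO : ∀ x ∈ Ico o c, v x ∈ range u) (hc : v c ∉ range u)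
    (hT : u T = v o) : v '' Ico o c = u '' Ici T ∨ v '' Ico o c = u '' Iic T := by
  have h := image_Ioc_eq_end hu (isOpenEmbedding_comp_neg hv) (a := -c) (o := -o) (T := T)
    (by linarith) (fun x hx => hO (-x) ⟨by linarith [hx.2], by linarith [hx.1]⟩) (by simpa using hc)
    (by simpa using hT)
  have e : (fun t => v (-t)) '' Ioc (-c) (-o) = v '' Ico o c := by
    rw [← image_image v (fun t => -t)]
    simp
  rwa [e] at h

/-- Two overlapping open arcs, neither containing the other, are contained in an open arc, or form a
closed curve. -/
theorem exists_arc_or_closed_curve {u v : ℝ → C} (hu : IsOpenEmbedding u) (hv : IsOpenEmbedding v)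
    {a o T : ℝ} (hao : a < o) (ha : v a ∉ range u) (hT : u T = v o)
    (hend : v '' Ioc a o = u '' Ici T) (hUV : ¬ range u ⊆ range v) :
    (∃ w : ℝ → C, Continuous w ∧ Function.Injective w ∧ range u ∪ range v ⊆ range w) ∨
    (∃ (w : ℝ → C) (p q : ℝ), p < q ∧ Continuous w ∧ InjOn w (Ico p q) ∧ w p = w q ∧
      IsOpen (w '' Icc p q)) := by
  set O := v ⁻¹' range u with hO_def
  have hO : IsOpen O := hu.isOpen_range.preimage hv.continuous
  have haO : a ∉ O := ha
  have hendO : ∀ x ∈ Ioc a o, x ∈ O := fun x hx =>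
    image_subset_range u _ (hend ▸ mem_image_of_mem v hx)
  have hoO : o ∈ O := hendO o ⟨hao, le_rfl⟩
  -- two different ends of `v` in `u` cannot be the same end of `u`
  have hdisj : ∀ {A : Set ℝ} {K : ℝ}, v '' A = u '' Ici K → Disjoint A (Ioo a o) → False := by
    intro A K hA hd
    have h1 : u (max K (T + 1)) ∈ v '' A := hA ▸ mem_image_of_mem u (mem_Ici.2 (le_max_left _ _))
    have h2 : u (max K (T + 1)) ∈ v '' Ioc a o :=
      hend ▸ mem_image_of_mem u (mem_Ici.2 ((by linarith : T ≤ T + 1).trans (le_max_right _ _)))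
    obtain ⟨x, hx, hx'⟩ := h1
    obtain ⟨y, hy, hy'⟩ := h2
    have hxy := hv.injective (hx'.trans hy'.symm)
    subst hxy
    rcases hy.2.lt_or_eq with h3 | h3
    · exact disjoint_left.1 hd hx ⟨hy.1, h3⟩
    · rw [h3, ← hT] at hx'
      have := hu.injective hx'
      have h4 := le_max_right K (T + 1)
      linarith
  by_cases hcase : ∃ x ∈ O, x < a
  · right
    obtain ⟨o', ho', hlt'⟩ := hcase
    obtain ⟨c, hoc, hca, hcO, hIco⟩ := exists_first_exit hO ho' haO hlt'
    obtain ⟨T', hT'⟩ := ho'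
    have hend' : v '' Ico o' c = u '' Iic T' := by
      refine (image_Ico_eq_end hu hv hoc hIco hcO hT').resolve_left fun h => hdisj h ?_
      exact disjoint_left.2 fun x hx hx' => by linarith [hx.2, hx'.1]
    have hmid : ∀ x ∈ Icc c a, x ∉ O := by
      intro x hx hxO
      have hxa : x < a := lt_of_le_of_ne hx.2 fun h => haO (h ▸ hxO)
      have hcx : c < x := lt_of_le_of_ne hx.1 fun h => hcO (h ▸ hxO)
      obtain ⟨d, hxd, hda, hdO, hIco'⟩ := exists_first_exit hO hxO haO hxa
      obtain ⟨T₂, hT₂⟩ := hxO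
      rcases image_Ico_eq_end hu hv hxd hIco' hdO hT₂ with h | h
      · exact hdisj h (disjoint_left.2 fun y hy hy' => by linarith [hy.2, hy'.1])
      · have h1 : u (min T₂ T') ∈ v '' Ico x d :=
          h ▸ mem_image_of_mem u (mem_Iic.2 (min_le_left _ _))
        have h2 : u (min T₂ T') ∈ v '' Ico o' c :=
          hend' ▸ mem_image_of_mem u (mem_Iic.2 (min_le_right _ _))
        obtain ⟨y, hy, hy'⟩ := h1
        obtain ⟨z, hz, hz'⟩ := h2
        have := hv.injective (hy'.trans hz'.symm)
        linarith [hy.1, hz.2]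
    have hTT : T' < T := by
      by_contra hcon
      have h1 : u T ∈ v '' Ico o' c := hend' ▸ mem_image_of_mem u (not_lt.1 hcon)
      obtain ⟨x, hx, hx'⟩ := h1
      have := hv.injective (hx'.trans hT)
      linarith [hx.2]
    -- a common point of the two pieces of the curve is a common end point
    have hmeet : ∀ x ∈ Icc o' o, ∀ t ∈ Icc T' T, v x = u t → x = o ∧ t = T ∨ x = o' ∧ t = T' := by
      intro x hx t ht hxt
      rcases lt_or_ge x c with h1 | h1
      · have h2 : v x ∈ u '' Iic T' := hend' ▸ mem_image_of_mem v ⟨hx.1, h1⟩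
        obtain ⟨r, hr, hr'⟩ := h2
        have h3 := hu.injective (hr'.trans hxt)
        have h4 : t = T' := le_antisymm (h3 ▸ hr) ht.1
        subst h4
        exact Or.inr ⟨hv.injective (hxt.trans hT'), rfl⟩
      · rcases le_or_gt x a with h2 | h2
        · exact absurd ⟨t, hxt.symm⟩ (hmid x ⟨h1, h2⟩)
        · have h3 : v x ∈ u '' Ici T := hend ▸ mem_image_of_mem v ⟨h2, hx.2⟩
          obtain ⟨r, hr, hr'⟩ := h3
          have h3 := hu.injective (hr'.trans hxt)
          have h4 : t = T := le_antisymm ht.2 (h3 ▸ hr)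
          subst h4
          exact Or.inl ⟨hv.injective (hxt.trans hT), rfl⟩
    have hoo : o' < o := by linarith
    have hw1 : ∀ t, t ≤ T → concatArc u v T o t = u t := fun t ht => if_pos ht
    have hw2 : ∀ t, T < t → concatArc u v T o t = v (o - (t - T)) := fun t ht =>
      if_neg (not_le.2 ht)
    refine ⟨concatArc u v T o, T', T + (o - o'), by linarith,
      continuous_concatArc hu.continuous hv.continuous hT, ?_, ?_, ?_⟩
    · have hcross : ∀ s ∈ Ico T' (T + (o - o')), ∀ t ∈ Ico T' (T + (o - o')), s ≤ T → T < t →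
          concatArc u v T o s = concatArc u v T o t → False := by
        intro s hs t ht h1 h2 hst
        rw [hw1 s h1, hw2 t h2] at hst
        rcases hmeet (o - (t - T)) ⟨by linarith [ht.2], by linarith⟩ s ⟨hs.1, h1⟩ hst.symm
          with h | h
        · linarith [h.1]
        · linarith [h.1, ht.2]
      intro s hs t ht hst
      rcases le_or_gt s T with h1 | h1 <;> rcases le_or_gt t T with h2 | h2
      · rw [hw1 s h1, hw1 t h2] at hst
        exact hu.injective hst
      · exact (hcross s hs t ht h1 h2 hst).elim
      · exact (hcross t ht s hs h2 h1 hst.symm).elim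
      · rw [hw2 s h1, hw2 t h2] at hst
        linarith [hv.injective hst]
    · rw [hw1 _ hTT.le, hw2 _ (by linarith), hT']
      congr 1; ring
    · have himg : concatArc u v T o '' Icc T' (T + (o - o')) = range u ∪ v '' Ioo o' o := by
        refine Subset.antisymm ?_ (union_subset ?_ ?_)
        · rintro _ ⟨t, ht, rfl⟩
          rcases le_or_gt t T with h1 | h1
          · rw [hw1 t h1]; exact Or.inl (mem_range_self t)
          · rw [hw2 t h1]
            rcases eq_or_lt_of_le ht.2 with h2 | h2
            · left
              rw [h2]
              exact ⟨T', by rw [hT']; congr 1; ring⟩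
            · exact Or.inr ⟨_, ⟨by linarith, by linarith⟩, rfl⟩
        · rintro _ ⟨t, rfl⟩
          have hvmem : ∀ x ∈ Icc o' o, v x ∈ concatArc u v T o '' Icc T' (T + (o - o')) := by
            intro x hx
            refine ⟨T + (o - x), ⟨by linarith [hx.2], by linarith [hx.1]⟩, ?_⟩
            rcases eq_or_lt_of_le hx.2 with h1 | h1
            · rw [h1, hw1 _ (by linarith), sub_self, add_zero, hT]
            · rw [hw2 _ (by linarith)]; congr 1; ring
          rcases le_or_gt t T' with h1 | h1
          · have h2 : u t ∈ v '' Ico o' c := hend' ▸ mem_image_of_mem u h1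
            obtain ⟨x, hx, hx'⟩ := h2
            rw [← hx']
            exact hvmem x ⟨hx.1, by linarith [hx.2]⟩
          · rcases le_or_gt t T with h2 | h2
            · exact ⟨t, ⟨h1.le, by linarith⟩, hw1 t h2⟩
            · have h2 : u t ∈ v '' Ioc a o := hend ▸ mem_image_of_mem u h2.le
              obtain ⟨x, hx, hx'⟩ := h2
              rw [← hx']
              exact hvmem x ⟨by linarith [hx.1], hx.2⟩
        · rintro _ ⟨x, hx, rfl⟩
          refine ⟨T + (o - x), ⟨by linarith [hx.2], by linarith [hx.1]⟩, ?_⟩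
          rw [hw2 _ (by linarith [hx.2])]; congr 1; ring
      rw [himg]
      exact hu.isOpen_range.union (hv.isOpenMap _ isOpen_Ioo)
  · left
    push Not at hcase
    have hleft : ∀ x ∈ O, a < x := fun x hx =>
      lt_of_le_of_ne (hcase x hx) fun h => haO (h ▸ hx)
    have hright : ∀ x, o ≤ x → x ∈ O := by
      by_contra hcon
      push Not at hcon
      obtain ⟨c₀, hc₀, hc₀O⟩ := hcon
      obtain ⟨c, hoc, -, hcO, hIco⟩ := exists_first_exit hO hoO hc₀O
        (lt_of_le_of_ne hc₀ fun h => hc₀O (h ▸ hoO))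
      have h1 := (image_Ico_eq_end hu hv hoc hIco hcO hT).resolve_left fun h => hdisj h
        (disjoint_left.2 fun x hx hx' => by linarith [hx.1, hx'.2])
      refine hUV ?_
      rintro _ ⟨t, rfl⟩
      rcases le_total t T with h2 | h2
      · have : u t ∈ v '' Ico o c := h1 ▸ mem_image_of_mem u h2
        exact image_subset_range _ _ this
      · have : u t ∈ v '' Ioc a o := hend ▸ mem_image_of_mem u h2
        exact image_subset_range _ _ this
    have hw1 : ∀ t, t ≤ T → concatArc u v T o t = u t := fun t ht => if_pos ht
    have hw2 : ∀ t, T < t → concatArc u v T o t = v (o - (t - T)) := fun t ht =>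
      if_neg (not_le.2 ht)
    have hcross : ∀ s t, s ≤ T → T < t → concatArc u v T o s = concatArc u v T o t → False := by
      intro s t h1 h2 hst
      rw [hw1 s h1, hw2 t h2] at hst
      have h3 := hleft (o - (t - T)) ⟨s, hst⟩
      have h4 : v (o - (t - T)) ∈ u '' Ici T := hend ▸ mem_image_of_mem v ⟨h3, by linarith⟩
      obtain ⟨r, hr, hr'⟩ := h4
      have h5 := hu.injective (hr'.trans hst.symm)
      have h6 : s = T := le_antisymm h1 (h5 ▸ hr)
      rw [h6, hT] at hst
      linarith [hv.injective hst]
    refine ⟨concatArc u v T o, continuous_concatArc hu.continuous hv.continuous hT, ?_, ?_⟩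
    · intro s t hst
      rcases le_or_gt s T with h1 | h1 <;> rcases le_or_gt t T with h2 | h2
      · rw [hw1 s h1, hw1 t h2] at hst
        exact hu.injective hst
      · exact (hcross s t h1 h2 hst).elim
      · exact (hcross t s h2 h1 hst.symm).elim
      · rw [hw2 s h1, hw2 t h2] at hst
        linarith [hv.injective hst]
    · have hvmem : ∀ x, x ≤ o → v x ∈ range (concatArc u v T o) := by
        intro x hx
        refine ⟨T + (o - x), ?_⟩
        rcases eq_or_lt_of_le hx with h1 | h1
        · rw [h1, hw1 _ (by linarith), sub_self, add_zero, hT]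
        · rw [hw2 _ (by linarith)]; congr 1; ring
      have humem : range u ⊆ range (concatArc u v T o) := by
        rintro _ ⟨t, rfl⟩
        rcases le_or_gt t T with h1 | h1
        · exact ⟨t, hw1 t h1⟩
        · have : u t ∈ v '' Ioc a o := hend ▸ mem_image_of_mem u h1.le
          obtain ⟨x, hx, hx'⟩ := this
          rw [← hx']
          exact hvmem x hx.2
      refine union_subset humem ?_
      rintro _ ⟨x, rfl⟩
      rcases le_or_gt x o with h1 | h1
      · exact hvmem x h1
      · exact humem (hright x h1.le)

/-- An open arc `u` and an arc `v` around a limit point of `u` are contained in an open arc, or form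
a closed curve. -/
theorem exists_arc_or_closed_curve_of_mem_closure {u v : ℝ → C} (hu : IsOpenEmbedding u)
    (hv : IsOpenEmbedding v) {z : C} (hzv : z ∈ range v) (hzu : z ∈ closure (range u) \ range u)
    (hUV : ¬ range u ⊆ range v) :
    (∃ w : ℝ → C, Continuous w ∧ Function.Injective w ∧ range u ∪ range v ⊆ range w) ∨
    (∃ (w : ℝ → C) (p q : ℝ), p < q ∧ Continuous w ∧ InjOn w (Ico p q) ∧ w p = w q ∧
      IsOpen (w '' Icc p q)) := by
  -- by reversing the two arcs, one can assume that `v` leaves `u` at the end `+∞` of `u`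
  have main : ∀ u v : ℝ → C, IsOpenEmbedding u → IsOpenEmbedding v → ¬ range u ⊆ range v →
      ∀ z₀ o, z₀ < o → v z₀ ∉ range u → v o ∈ range u →
      (∃ w : ℝ → C, Continuous w ∧ Function.Injective w ∧ range u ∪ range v ⊆ range w) ∨
      (∃ (w : ℝ → C) (p q : ℝ), p < q ∧ Continuous w ∧ InjOn w (Ico p q) ∧ w p = w q ∧
        IsOpen (w '' Icc p q)) := by
    intro u v hu hv hUV z₀ o hlt hz₀ ho
    obtain ⟨a, -, hao, haO, hIoc⟩ := exists_last_entry (O := v ⁻¹' range u)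
      (hu.isOpen_range.preimage hv.continuous) ho hz₀ hlt
    obtain ⟨T, hT⟩ := ho
    rcases image_Ioc_eq_end hu hv hao hIoc haO hT with h | h
    · exact exists_arc_or_closed_curve hu hv hao haO hT h hUV
    · have h1 := exists_arc_or_closed_curve (isOpenEmbedding_comp_neg hu) hv hao (T := -T)
        (by rwa [range_comp_neg]) (by simpa using hT) (by
          rw [h, ← image_image u (fun t => -t)]
          simp) (by rwa [range_comp_neg])
      rwa [range_comp_neg] at h1
  obtain ⟨z₀, rfl⟩ := hzv
  obtain ⟨_, hy, t, rfl⟩ := mem_closure_iff.1 hzu.1 (range v) hv.isOpen_range (mem_range_self z₀)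
  obtain ⟨o, ho⟩ := hy
  rcases lt_trichotomy z₀ o with h | h | h
  · exact main u v hu hv hUV z₀ o h hzu.2 ⟨t, ho.symm⟩
  · exact absurd ⟨t, by rw [← ho, h]⟩ hzu.2
  · have h1 := main u (fun t => v (-t)) hu (isOpenEmbedding_comp_neg hv) (by rwa [range_comp_neg])
      (-z₀) (-o) (by linarith) (by simpa using hzu.2) ⟨t, by simpa using ho.symm⟩
    rwa [range_comp_neg] at h1

/-- A compact connected one-dimensional manifold is a circle. A maximal open arc, made of arcs of a
finite cover, has a limit point; an arc around this point either extends it or closes it up. -/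
theorem exists_circle_homeomorph [CompactSpace C] [ConnectedSpace C]
    (hC : ∀ x : C, ∃ v : ℝ → C, IsOpenEmbedding v ∧ x ∈ range v) :
    ∃ e : Circle → C, Continuous e ∧ Function.Injective e ∧ Function.Surjective e := by
  classical
  choose v hv hxv using hC
  obtain ⟨F, hF⟩ := isCompact_univ.elim_nhds_subcover (fun x => range (v x))
    fun x _ => (hv x).isOpen_range.mem_nhds (hxv x)
  by_contra hno
  have hclosed : ∀ (w : ℝ → C) (p q : ℝ), p < q → Continuous w → InjOn w (Ico p q) → w p = w q →
      IsOpen (w '' Icc p q) → False := by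
    intro w p q hpq hw hi he hop
    obtain ⟨e, he1, he2, he3⟩ := exists_circle_of_closed_curve hpq hw hi he
    refine hno ⟨e, he1, he2, range_eq_univ.1 ?_⟩
    rw [he3]
    refine IsClopen.eq_univ ⟨(isCompact_Icc.image hw).isClosed, hop⟩ ?_
    exact (nonempty_Icc.2 hpq.le).image w
  have hstep : ∀ k : ℕ, ∃ u : ℝ → C, IsOpenEmbedding u ∧
      k ≤ (F.filter fun x => range (v x) ⊆ range u).card := by
    intro k
    induction k with
    | zero =>
      obtain ⟨x⟩ : Nonempty C := inferInstance
      exact ⟨v x, hv x, Nat.zero_le _⟩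
    | succ k ih =>
      obtain ⟨u, hu, hk⟩ := ih
      have hne : range u ≠ univ := by
        intro h
        have : IsCompact (univ : Set ℝ) := by
          rw [hu.isEmbedding.isCompact_iff, image_univ, h]
          exact isCompact_univ
        exact noncompact_univ ℝ this
      have hncl : ¬ IsClosed (range u) := fun h =>
        hne (IsClopen.eq_univ ⟨h, hu.isOpen_range⟩ (range_nonempty u))
      obtain ⟨z, hz1, hz2⟩ : ∃ z ∈ closure (range u), z ∉ range u := by
        by_contra hcon
        push Not at hcon
        exact hncl (isClosed_of_closure_subset hcon)
      obtain ⟨x, hxF, hzx⟩ := mem_iUnion₂.1 (hF.2 (mem_univ z))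
      have hgrow : ∀ u' : ℝ → C, range u ⊆ range u' → range (v x) ⊆ range u' →
          k + 1 ≤ (F.filter fun x => range (v x) ⊆ range u').card := by
        intro u' h1 h2
        refine Nat.succ_le_of_lt (hk.trans_lt (Finset.card_lt_card ?_))
        rw [Finset.ssubset_iff_of_subset]
        · exact ⟨x, Finset.mem_filter.2 ⟨hxF, h2⟩, fun h =>
            hz2 ((Finset.mem_filter.1 h).2 hzx)⟩
        · intro y hy
          rw [Finset.mem_filter] at hy ⊢
          exact ⟨hy.1, hy.2.trans h1⟩
      by_cases hUV : range u ⊆ range (v x)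
      · exact ⟨v x, hv x, hgrow _ hUV subset_rfl⟩
      · rcases exists_arc_or_closed_curve_of_mem_closure hu (hv x) hzx ⟨hz1, hz2⟩ hUV with
          ⟨w, hw, hwi, hsub⟩ | ⟨w, p, q, hpq, hw, hi, he, hop⟩
        · exact ⟨w, isOpenEmbedding_of_injective (fun y => ⟨v y, hv y, hxv y⟩) hw hwi,
            hgrow w (subset_union_left.trans hsub) (subset_union_right.trans hsub)⟩
        · exact (hclosed w p q hpq hw hi he hop).elim
  obtain ⟨u, -, hcard⟩ := hstep (F.card + 1)
  have := Finset.card_filter_le F fun x => range (v x) ⊆ range u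
  omega

end OneManifold

/-! ### Closed curves and discs in the plane -/

/-- Whether removing `Γ` disconnects a connected set `C` can be tested in a neighbourhood `U` of
`Γ`: a separation of `C \ Γ` with `(C ∩ U) \ Γ` on one side extends to a separation of `C`. -/
theorem IsPreconnected.sdiff_of_isOpen {X : Type*} [TopologicalSpace X] {C Γ U : Set X}
    (hC : IsPreconnected C) (hΓ : IsClosed Γ) (hU : IsOpen U) (hΓU : C ∩ Γ ⊆ U)
    (h : IsPreconnected ((C ∩ U) \ Γ)) : IsPreconnected (C \ Γ) := by
  rw [isPreconnected_iff_subset_of_disjoint] at h ⊢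
  intro u v hu hv huv hd
  wlog hUu : (C ∩ U) \ Γ ⊆ u generalizing u v
  · have hsub : (C ∩ U) \ Γ ⊆ C \ Γ := sdiff_subset_sdiff_left inter_subset_left
    have hUv := (h u v hu hv (hsub.trans huv)
      (subset_eq_empty (inter_subset_inter_left _ hsub) hd)).resolve_left hUu
    exact (this v u hv hu (by rwa [union_comm]) (by rwa [inter_comm v]) hUv).symm
  rw [isPreconnected_iff_subset_of_disjoint] at hC
  have := hC (u ∪ U) (v \ Γ) (hu.union hU) (hv.sdiff hΓ) ?_ ?_
  · refine this.imp (fun H x hx => ?_) (fun H x hx => (H hx.1).1)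
    exact (H hx.1).elim id fun h => hUu ⟨⟨hx.1, h⟩, hx.2⟩
  · intro x hx
    by_cases hxΓ : x ∈ Γ
    · exact Or.inl (Or.inr (hΓU ⟨hx, hxΓ⟩))
    · exact (huv ⟨hx, hxΓ⟩).elim (fun h => Or.inl (Or.inl h)) fun h => Or.inr ⟨h, hxΓ⟩
  · refine eq_empty_of_forall_notMem fun x hx => ?_
    obtain ⟨hxC, hxu, hxv, hxΓ⟩ := hx
    have : x ∈ u := hxu.elim id fun h => hUu ⟨⟨hxC, h⟩, hxΓ⟩
    have h3 : x ∈ (C \ Γ) ∩ (u ∩ v) := ⟨⟨hxC, hxΓ⟩, this, hxv⟩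
    rwa [hd] at h3

/-- The direction of a nonzero complex number (and `1` for zero). -/
noncomputable def direction (z : ℂ) : Circle :=
  if h : z = 0 then 1 else ⟨z / ‖z‖, by simp [Submonoid.unitSphere, h]⟩

theorem coe_direction {z : ℂ} (h : z ≠ 0) : (direction z : ℂ) = z / ‖z‖ := by
  simp [direction, h]

theorem continuousOn_direction : ContinuousOn direction {0}ᶜ := by
  have h : IsInducing (fun a : Circle => (a : ℂ)) := ⟨rfl⟩
  rw [h.continuousOn_iff]
  refine ContinuousOn.congr (f := fun z : ℂ => z / ‖z‖) ?_ fun z hz => coe_direction hz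
  refine continuousOn_id.div (by fun_prop) fun z hz => ?_
  simpa using hz

theorem norm_smul_direction {z : ℂ} (h : z ≠ 0) : (‖z‖ : ℂ) * direction z = z := by
  rw [coe_direction h]
  have : (‖z‖ : ℂ) ≠ 0 := by simpa using h
  field_simp

theorem direction_smul {r : ℝ} (hr : 0 < r) (a : Circle) : direction (r * a) = a := by
  apply Circle.ext
  have h0 : (r : ℂ) * a ≠ 0 := by simp [hr.ne']
  rw [coe_direction h0]
  have : (r : ℂ) ≠ 0 := by simp [hr.ne']
  simp only [norm_mul, Circle.norm_coe, Complex.norm_real, Real.norm_eq_abs, abs_of_pos hr, mul_one]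
  field_simp

theorem direction_coe (a : Circle) : direction a = a := by
  simpa using direction_smul one_pos a

/-- The automorphism of the unit disc that moves `ξ` to the origin; its inverse is the one that
moves `-ξ` to the origin. -/
noncomputable def discAutomorphism (ξ z : ℂ) : ℂ := (z - ξ) / (1 - star ξ * z)

theorem one_sub_star_mul_ne_zero {ξ z : ℂ} (hξ : ‖ξ‖ < 1) (hz : ‖z‖ ≤ 1) : 1 - star ξ * z ≠ 0 := by
  intro h
  have h1 : star ξ * z = 1 := (sub_eq_zero.1 h).symm
  have h2 : ‖ξ‖ * ‖z‖ = 1 := by simpa using congrArg norm h1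
  nlinarith [norm_nonneg ξ, norm_nonneg z]

theorem discAutomorphism_identity (ξ z : ℂ) :
    ‖1 - star ξ * z‖ ^ 2 - ‖z - ξ‖ ^ 2 = (1 - ‖z‖ ^ 2) * (1 - ‖ξ‖ ^ 2) := by
  simp only [← Complex.normSq_eq_norm_sq, Complex.normSq_apply]
  simp
  ring

theorem norm_discAutomorphism_le {ξ z : ℂ} (hξ : ‖ξ‖ < 1) (hz : ‖z‖ ≤ 1) :
    ‖discAutomorphism ξ z‖ ≤ 1 := by
  have h := discAutomorphism_identity ξ z
  have h0 : 0 < ‖1 - star ξ * z‖ := norm_pos_iff.2 (one_sub_star_mul_ne_zero hξ hz)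
  rw [discAutomorphism, norm_div, div_le_one h0]
  have : 0 ≤ (1 - ‖z‖ ^ 2) * (1 - ‖ξ‖ ^ 2) :=
    mul_nonneg (by nlinarith [norm_nonneg z]) (by nlinarith [norm_nonneg ξ])
  exact abs_le_of_sq_le_sq' (by linarith) h0.le |>.2

theorem norm_discAutomorphism_eq {ξ z : ℂ} (hξ : ‖ξ‖ < 1) (hz : ‖z‖ = 1) :
    ‖discAutomorphism ξ z‖ = 1 := by
  have h := discAutomorphism_identity ξ z
  have h0 : 0 < ‖1 - star ξ * z‖ := norm_pos_iff.2 (one_sub_star_mul_ne_zero hξ hz.le)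
  rw [discAutomorphism, norm_div, div_eq_one_iff_eq h0.ne']
  rw [hz] at h
  exact (sq_eq_sq₀ (norm_nonneg _) h0.le).1 (by linarith)

theorem discAutomorphism_neg_apply {ξ z : ℂ} (hξ : ‖ξ‖ < 1) (hz : ‖z‖ ≤ 1) :
    discAutomorphism (-ξ) (discAutomorphism ξ z) = z := by
  have h0 := one_sub_star_mul_ne_zero hξ hz
  have h1 : 1 - star ξ * ξ ≠ 0 := one_sub_star_mul_ne_zero hξ hξ.le
  have h2 := one_sub_star_mul_ne_zero (ξ := -ξ) (by simpa using hξ) (norm_discAutomorphism_le hξ hz)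
  rw [discAutomorphism, div_eq_iff h2]
  simp only [discAutomorphism, star_neg]
  rw [sub_neg_eq_add, neg_mul, sub_neg_eq_add, mul_add, mul_one, ← sub_eq_zero]
  have h3 : (z - ξ) / (1 - star ξ * z) * (1 - star ξ * z) = z - ξ := div_mul_cancel₀ _ h0
  linear_combination h3

theorem continuousOn_discAutomorphism {ξ : ℂ} (hξ : ‖ξ‖ < 1) :
    ContinuousOn (discAutomorphism ξ) (closedBall 0 1) := by
  refine ContinuousOn.div (by fun_prop) (by fun_prop) fun z hz => ?_
  exact one_sub_star_mul_ne_zero hξ (by simpa using hz)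

theorem discAutomorphism_ne_zero {ξ z : ℂ} (hξ : ‖ξ‖ < 1) (hz : ‖z‖ ≤ 1) (h : z ≠ ξ) :
    discAutomorphism ξ z ≠ 0 :=
  div_ne_zero (sub_ne_zero.2 h) (one_sub_star_mul_ne_zero hξ hz)

/-- The closed unit disc punctured at an interior point `ξ` is a half-open annulus, by a
homeomorphism that fixes the unit circle. -/
theorem exists_punctured_disc_annulus {ξ : ℂ} (hξ : ‖ξ‖ < 1) :
    ∃ (d : ℂ → Circle) (r : ℂ → ℝ), ContinuousOn d (closedBall 0 1 \ {ξ}) ∧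
      ContinuousOn r (closedBall 0 1 \ {ξ}) ∧ (∀ a : Circle, d a = a ∧ r a = 1) ∧
      (∀ z ∈ closedBall 0 1 \ {ξ}, 0 < r z ∧ r z ≤ 1) ∧
      (∀ z ∈ closedBall 0 1 \ {ξ}, ∀ z' ∈ closedBall 0 1 \ {ξ}, d z = d z' → r z = r z' → z = z') ∧
      (∀ (a : Circle) (ρ : ℝ), 0 < ρ → ρ ≤ 1 → ∃ z ∈ closedBall 0 1 \ {ξ}, d z = a ∧ r z = ρ) := by
  have hξ' : ‖-ξ‖ < 1 := by simpa using hξ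
  -- `μ` moves the puncture to the origin; its inverse on the unit circle corrects the direction
  set μ := discAutomorphism ξ
  set μ' := discAutomorphism (-ξ)
  have hμ0 : ∀ z ∈ closedBall 0 1 \ {ξ}, μ z ≠ 0 := fun z hz =>
    discAutomorphism_ne_zero hξ (by simpa using hz.1) hz.2
  have hμ1 : ∀ z ∈ closedBall (0 : ℂ) 1, μ z ∈ closedBall (0 : ℂ) 1 := fun z hz => by
    simpa using norm_discAutomorphism_le hξ (by simpa using hz)
  have hμ'μ : ∀ z ∈ closedBall (0 : ℂ) 1, μ' (μ z) = z := fun z hz =>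
    discAutomorphism_neg_apply hξ (by simpa using hz)
  have hμμ' : ∀ z ∈ closedBall (0 : ℂ) 1, μ (μ' z) = z := fun z hz => by
    have := discAutomorphism_neg_apply hξ' (z := z) (by simpa using hz)
    rwa [neg_neg] at this
  have hcirc : ∀ a : Circle, (a : ℂ) ∈ closedBall (0 : ℂ) 1 := fun a => by
    simp [Circle.norm_coe]
  have hdir : ∀ (η : ℂ), ‖η‖ < 1 → ∀ a : Circle,
      ((direction (discAutomorphism η a) : Circle) : ℂ) = discAutomorphism η a := by
    intro η hη a
    have h1 : ‖discAutomorphism η a‖ = 1 := norm_discAutomorphism_eq hη a.norm_coe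
    rw [coe_direction (norm_ne_zero_iff.1 (by rw [h1]; exact one_ne_zero)), h1]; simp
  have hcancel : ∀ a b : Circle, direction (μ' a) = direction (μ' b) → a = b := by
    intro a b h
    have h1 := congrArg (fun c : Circle => μ (c : ℂ)) h
    simp only [μ', hdir _ hξ'] at h1
    exact Circle.ext (by rw [← hμμ' a (hcirc a), ← hμμ' b (hcirc b)]; exact h1)
  refine ⟨fun z => direction (μ' (direction (μ z))), fun z => ‖μ z‖, ?_, ?_, ?_, ?_, ?_, ?_⟩
  · have hc : ContinuousOn (fun z => ((direction (μ z) : Circle) : ℂ)) (closedBall 0 1 \ {ξ}) :=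
      (continuous_subtype_val (p := (· ∈ Submonoid.unitSphere ℂ))).comp_continuousOn
        (continuousOn_direction.comp ((continuousOn_discAutomorphism hξ).mono sdiff_subset) hμ0)
    refine continuousOn_direction.comp ((continuousOn_discAutomorphism hξ').comp hc
      fun z _ => hcirc _) fun z _ => ?_
    have : ‖μ' (direction (μ z))‖ = 1 := norm_discAutomorphism_eq hξ' (Circle.norm_coe _)
    exact norm_ne_zero_iff.1 (by rw [this]; exact one_ne_zero)
  · exact ((continuousOn_discAutomorphism hξ).mono sdiff_subset).norm
  · refine fun a => ⟨?_, norm_discAutomorphism_eq hξ a.norm_coe⟩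
    simp only [μ, hdir _ hξ]
    change direction (μ' (μ a)) = a
    rw [hμ'μ a (hcirc a), direction_coe]
  · exact fun z hz => ⟨norm_pos_iff.2 (hμ0 z hz), by simpa using hμ1 z hz.1⟩
  · intro z hz z' hz' h1 h2
    have h3 := hcancel _ _ h1
    have h2' : ‖μ z‖ = ‖μ z'‖ := h2
    have h4 : μ z = μ z' := by
      rw [← norm_smul_direction (hμ0 z hz), ← norm_smul_direction (hμ0 z' hz'), h3, h2']
    rw [← hμ'μ z hz.1, h4, hμ'μ z' hz'.1]
  · intro a ρ h0 h1
    set b : Circle := direction (μ a)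
    have hb : (ρ : ℂ) * b ∈ closedBall (0 : ℂ) 1 := by
      simpa [abs_of_pos h0, Circle.norm_coe] using h1
    have hm : μ (μ' (ρ * b)) = ρ * b := hμμ' _ hb
    refine ⟨μ' (ρ * b), ⟨?_, ?_⟩, ?_, ?_⟩
    · simpa using norm_discAutomorphism_le hξ' (by simpa using hb)
    · intro h
      rw [mem_singleton_iff] at h
      rw [h] at hm
      have : (ρ : ℂ) * b = 0 := by rw [← hm]; simp [μ, discAutomorphism]
      simp [h0.ne'] at this
    · simp only [hm]
      rw [direction_smul h0, show (b : ℂ) = μ a from hdir _ hξ a, hμ'μ a (hcirc a), direction_coe]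
    · simp only [hm]; simp [abs_of_pos h0, Circle.norm_coe]

/-- A plane does not embed in a circle: the complement of two points in the plane is connected. -/
theorem not_injective_complex_to_circle {g : ℂ → Circle} (hg : Continuous g) :
    ¬ Function.Injective g := by
  intro hi
  set p := g 0
  -- `h` is an injective real function on the plane without the origin
  set h : ℂ → ℝ := fun z => Complex.arg (-(g z / p : Circle))
  have hslit : ∀ z ≠ 0, -((g z / p : Circle) : ℂ) ∈ Complex.slitPlane := by
    intro z hz
    have hne : ((g z / p : Circle) : ℂ) ≠ 1 := by
      intro h1
      have h1' : g z / p = 1 := Circle.ext (by simpa using h1)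
      exact hz (hi (div_eq_one.1 h1'))
    rw [Complex.mem_slitPlane_iff]
    by_contra hle
    apply hne
    have h2 := Circle.norm_coe (g z / p)
    rw [not_or, not_lt, not_not, Complex.neg_re, Complex.neg_im] at hle
    have hre' : 0 ≤ ((g z / p : Circle) : ℂ).re := by linarith [hle.1]
    have him' : ((g z / p : Circle) : ℂ).im = 0 := by linarith [hle.2]
    rw [← Complex.abs_re_eq_norm.2 him', abs_of_nonneg hre'] at h2
    exact Complex.ext (by simpa using h2) (by simpa using him')
  have hc : ContinuousOn h {0}ᶜ := by
    intro z hz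
    have h1 := Complex.continuousAt_arg (hslit z hz)
    have h2 : Continuous fun z => -((g z / p : Circle) : ℂ) := by fun_prop
    exact (ContinuousAt.comp (f := fun z => -((g z / p : Circle) : ℂ)) h1
      h2.continuousAt).continuousWithinAt
  have hinj : InjOn h {0}ᶜ := by
    intro z hz w hw hzw
    have h1 : -((g z / p : Circle) : ℂ) = -((g w / p : Circle) : ℂ) :=
      Complex.ext_norm_arg (by rw [norm_neg, norm_neg, Circle.norm_coe, Circle.norm_coe]) hzw
    have h2 : g z / p = g w / p := Circle.ext (neg_injective h1)
    exact hi (by simpa using h2)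
  have hconn : ∀ s : Set ℂ, s.Countable → IsPreconnected sᶜ := fun s hs =>
    (hs.isConnected_compl_of_one_lt_rank (by simp)).2
  have h12 : h 1 ≠ h 2 := fun hh => by
    have := hinj (by simp) (by simp) hh
    norm_num at this
  have hmid : ∀ a b : ℝ, a ≠ b → (a + b) / 2 ∈ uIcc a b := fun a b _ => by
    rw [mem_uIcc]
    rcases le_total a b with hab | hab
    · left; constructor <;> linarith
    · right; constructor <;> linarith
  have key : ∀ s : Set ℂ, s.Countable → (0 : ℂ) ∈ s → (1 : ℂ) ∉ s → (2 : ℂ) ∉ s →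
      ∃ m ∉ s, h m = (h 1 + h 2) / 2 := by
    intro s hs h0 h1 h2
    have hp : IsPreconnected (h '' sᶜ) :=
      (hconn s hs).image h (hc.mono (compl_subset_compl.2 (by simpa using h0)))
    exact hp.ordConnected.uIcc_subset (mem_image_of_mem h h1) (mem_image_of_mem h h2)
      (hmid _ _ h12)
  -- the value halfway between `h 1` and `h 2` is taken at some `m`, and again away from `m`
  obtain ⟨m, hm0, hm⟩ := key {0} (countable_singleton _) (by simp) (by simp) (by simp)
  obtain ⟨m', hm0', hm'⟩ := key {0, m} (by simp) (by simp)
    (by rintro (h1 | h1)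
        · simp at h1
        · rw [mem_singleton_iff] at h1; rw [← h1] at hm; exact h12 (by linarith))
    (by rintro (h1 | h1)
        · simp at h1
        · rw [mem_singleton_iff] at h1; rw [← h1] at hm; exact h12 (by linarith))
  simp only [mem_insert_iff, mem_singleton_iff, not_or] at hm0'
  exact hm0'.2 (hinj (by simpa using hm0'.1) (by simpa using hm0) (hm'.trans hm.symm))

/-- Finitely many simple closed curves do not cover an injective image of the plane. -/
theorem exists_notMem_range_curves {X : Type*} [TopologicalSpace X] [T2Space X] {n : ℕ}
    {γ : Fin n → Circle → X} (hγ : ∀ i, Continuous (γ i)) (hγi : ∀ i, Function.Injective (γ i))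
    {J : ℂ → X} (hJ : Continuous J) (hJi : Function.Injective J) :
    ∃ w, ∀ i, J w ∉ range (γ i) := by
  have hcl : ∀ i, IsClosedEmbedding (γ i) := fun i => (hγ i).isClosedEmbedding (hγi i)
  have hd : Dense (⋂ i, (J ⁻¹' range (γ i))ᶜ) := by
    refine dense_iInter_of_isOpen (fun i => ((hcl i).isClosed_range.preimage hJ).isOpen_compl)
      fun i => ?_
    rw [← interior_eq_empty_iff_dense_compl]
    by_contra hne
    obtain ⟨z, hz⟩ := nonempty_iff_ne_empty.2 hne
    obtain ⟨r, hr, hball⟩ := Metric.mem_nhds_iff.1 (mem_interior_iff_mem_nhds.1 hz)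
    set b := OpenPartialHomeomorph.univBall z r
    have hb : ∀ w, b w ∈ ball z r := fun w => by
      have := b.map_source (x := w) (by simp [b])
      rwa [OpenPartialHomeomorph.univBall_target z hr] at this
    have hbc : Continuous b := OpenPartialHomeomorph.continuous_univBall z r
    have hbi : Function.Injective b := by
      rw [← injOn_univ]
      have := b.injOn
      rwa [OpenPartialHomeomorph.univBall_source] at this
    choose g hg using fun w => hball (hb w)
    refine not_injective_complex_to_circle (g := g) ?_ fun w w' hww => ?_
    · rw [(hcl i).isEmbedding.continuous_iff]
      exact (hJ.comp hbc).congr fun w => (hg w).symm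
    · exact hbi (hJi (by rw [← hg w, ← hg w', hww]))
  obtain ⟨w, hw⟩ := hd.nonempty
  exact ⟨w, fun i hi => (mem_iInter.1 hw i) hi⟩

/-- A compact one-dimensional manifold is a disjoint union of circles. Arcs being connected, its
components are open. -/
theorem exists_homeomorph_connectedComponents_prod_circle {C : Type*} [TopologicalSpace C]
    [T2Space C] [CompactSpace C]
    (hC : ∀ x : C, ∃ v : ℝ → C, IsOpenEmbedding v ∧ x ∈ range v) :
    DiscreteTopology (ConnectedComponents C) ∧
    ∃ e : C ≃ₜ ConnectedComponents C × Circle, ∀ x, (e x).1 = x := by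
  have hopen : ∀ x : C, IsOpen (connectedComponent x) := by
    intro x
    rw [isOpen_iff_mem_nhds]
    intro y hy
    obtain ⟨v, hv, hyv⟩ := hC y
    rw [connectedComponent_eq hy]
    exact mem_of_superset (hv.isOpen_range.mem_nhds hyv)
      ((isPreconnected_range hv.continuous).subset_connectedComponent hyv)
  have hdisc : DiscreteTopology (ConnectedComponents C) :=
    ConnectedComponents.discreteTopology_iff.2 hopen
  refine ⟨hdisc, ?_⟩
  have hcomp : ∀ k : ConnectedComponents C, ∃ e : Circle → C, Continuous e ∧
      Function.Injective e ∧ range e = ((↑) : C → ConnectedComponents C) ⁻¹' {k} := by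
    intro k
    obtain ⟨x, rfl⟩ := ConnectedComponents.surjective_coe k
    set D := connectedComponent x
    have : CompactSpace D := isCompact_iff_compactSpace.1 isClosed_connectedComponent.isCompact
    have : ConnectedSpace D := isConnected_iff_connectedSpace.1 isConnected_connectedComponent
    obtain ⟨e, he, hei, hes⟩ := exists_circle_homeomorph (C := D) (by
      rintro ⟨y, hy⟩
      obtain ⟨v, hv, hyv⟩ := hC y
      have hvD : ∀ t, v t ∈ D := fun t => by
        have := (isPreconnected_range hv.continuous).subset_connectedComponent hyv
        rw [← connectedComponent_eq hy] at this
        exact this (mem_range_self t)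
      refine ⟨fun t => ⟨v t, hvD t⟩, ?_, ?_⟩
      · exact IsOpenEmbedding.of_comp _ (hopen x).isOpenEmbedding_subtypeVal hv
      · obtain ⟨t, ht⟩ := hyv
        exact ⟨t, Subtype.ext ht⟩)
    refine ⟨fun a => e a, continuous_subtype_val.comp he, Subtype.val_injective.comp hei, ?_⟩
    ext y
    simp only [mem_range, mem_preimage, mem_singleton_iff, ConnectedComponents.coe_eq_coe']
    constructor
    · rintro ⟨a, rfl⟩; exact (e a).2
    · intro hy
      obtain ⟨a, ha⟩ := hes ⟨y, hy⟩
      exact ⟨a, congrArg Subtype.val ha⟩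
  choose e he hei her using hcomp
  have hek : ∀ k a, (e k a : ConnectedComponents C) = k := fun k a => by
    have : e k a ∈ range (e k) := mem_range_self a
    rwa [her] at this
  have hf : Continuous fun z : ConnectedComponents C × Circle => e z.1 z.2 := by
    rw [continuous_prod_of_discrete_left]
    exact he
  have hfi : Function.Injective fun z : ConnectedComponents C × Circle => e z.1 z.2 := by
    rintro ⟨k, a⟩ ⟨k', a'⟩ h
    have hk : k = k' := by rw [← hek k a, ← hek k' a']; exact congrArg _ h
    subst hk
    exact Prod.ext rfl (hei k h)
  have hfs : Function.Surjective fun z : ConnectedComponents C × Circle => e z.1 z.2 := by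
    intro x
    have : x ∈ range (e (x : ConnectedComponents C)) := by rw [her]; rfl
    obtain ⟨a, ha⟩ := this
    exact ⟨(x, a), ha⟩
  have : CompactSpace (ConnectedComponents C) := Quot.compactSpace
  set E := Continuous.homeoOfEquivCompactToT2 (f := Equiv.ofBijective _ ⟨hfi, hfs⟩) hf
  refine ⟨E.symm, fun x => ?_⟩
  have h1 : E (E.symm x) = x := E.apply_symm_apply x
  have h2 : ((E (E.symm x) : C) : ConnectedComponents C) = (E.symm x).1 := hek _ _
  rw [← h2, h1]

/-! ### The topology of the capped surface -/

section Cap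

variable {N B : Set E3}

/-- The inclusion of `N` in the space obtained from it by attaching caps along `B`. -/
def capBase (N B : Set E3) (x : N) : Quot (CapRel N B) := Quot.mk _ (Sum.inl x)

/-- The map from the cylinder over `B` to the caps. -/
def capCone (N B : Set E3) (p : B × unitInterval) : Quot (CapRel N B) := Quot.mk _ (Sum.inr p)

theorem continuous_capBase : Continuous (capBase N B) := continuous_quot_mk.comp continuous_inl

theorem continuous_capCone : Continuous (capCone N B) := continuous_quot_mk.comp continuous_inr

theorem capBase_or_capCone (x : Quot (CapRel N B)) :
    (∃ y, capBase N B y = x) ∨ ∃ p, capCone N B p = x := by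
  induction x using Quot.ind with
  | mk y =>
    cases y with
    | inl y => exact Or.inl ⟨y, rfl⟩
    | inr p => exact Or.inr ⟨p, rfl⟩

theorem capBase_eq_capCone {x : N} {b : B} (h : (x : E3) = b) :
    capBase N B x = capCone N B (b, 0) :=
  Quot.sound (CapRel.glue x b h)

theorem capBase_injective : Function.Injective (capBase N B) := by
  intro x y h
  let f : Quot (CapRel N B) → E3 :=
    Quot.lift (Sum.elim (fun x => (x : E3)) fun p => (1 - (p.2 : ℝ)) • (p.1 : E3)) (by
      rintro _ _ (⟨x, b, h⟩ | ⟨b, b', -⟩)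
      · simp [h]
      · simp)
  exact Subtype.ext (congrArg f h)

/-- A subset of `N` away from `B` is saturated for the quotient map. -/
theorem mk_preimage_capBase_image {W : Set N} (hW : ∀ x ∈ W, (x : E3) ∉ B) :
    Quot.mk (CapRel N B) ⁻¹' (capBase N B '' W) = Sum.inl '' W := by
  let f : Quot (CapRel N B) → Prop := Quot.lift (Sum.elim (· ∈ W) fun _ => False) (by
    rintro _ _ (⟨x, b, h⟩ | ⟨b, b', -⟩)
    · simpa using fun hx => hW x hx (h ▸ b.2)
    · rfl)
  ext z
  constructor
  · rintro ⟨w, hw, h⟩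
    have h1 : f (Quot.mk _ z) := by rw [← h]; exact hw
    cases z with
    | inl y => exact ⟨y, h1, rfl⟩
    | inr p => exact h1.elim
  · rintro ⟨w, hw, rfl⟩
    exact ⟨w, hw, rfl⟩

theorem isOpen_capBase_image {W : Set N} (hW : ∀ x ∈ W, (x : E3) ∉ B) (ho : IsOpen W) :
    IsOpen (capBase N B '' W) := by
  rw [← isQuotientMap_quot_mk.isOpen_preimage, mk_preimage_capBase_image hW]
  exact isOpenMap_inl _ ho

theorem isClosed_capBase_image {W : Set N} (hW : ∀ x ∈ W, (x : E3) ∉ B) (hc : IsClosed W) :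
    IsClosed (capBase N B '' W) := by
  rw [← isQuotientMap_quot_mk.isClosed_preimage, mk_preimage_capBase_image hW]
  exact IsClosedEmbedding.inl.isClosedMap _ hc

theorem preconnectedSpace_cap (hBN : B ⊆ N) (hN : IsPreconnected N) (hne : N.Nonempty) :
    PreconnectedSpace (Quot (CapRel N B)) := by
  obtain ⟨o, ho⟩ := hne
  have : PreconnectedSpace N := isPreconnected_iff_preconnectedSpace.1 hN
  refine ⟨isPreconnected_of_forall (capBase N B ⟨o, ho⟩) fun x _ => ?_⟩
  have hr : IsPreconnected (range (capBase N B)) := isPreconnected_range continuous_capBase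
  rcases capBase_or_capCone x with ⟨y, rfl⟩ | ⟨⟨b, u⟩, rfl⟩
  · exact ⟨_, subset_univ _, mem_range_self _, mem_range_self _, hr⟩
  · have h2 : IsPreconnected (range fun v => capCone N B (b, v)) :=
      isPreconnected_range (continuous_capCone.comp (by fun_prop))
    refine ⟨range (capBase N B) ∪ range fun v => capCone N B (b, v), subset_univ _,
      Or.inl (mem_range_self _), Or.inr ⟨u, rfl⟩, hr.union (capCone N B (b, 0))
      ⟨⟨b, hBN b.2⟩, capBase_eq_capCone rfl⟩ ⟨0, rfl⟩ h2⟩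

theorem mem_connectedComponentIn_iff (b b' : B) :
    (b' : E3) ∈ connectedComponentIn B b ↔
      (b : ConnectedComponents B) = (b' : ConnectedComponents B) := by
  rw [connectedComponentIn_eq_image b.2, eq_comm, ConnectedComponents.coe_eq_coe']
  constructor
  · rintro ⟨x, hx, h⟩
    rwa [← Subtype.ext h]
  · exact fun h => ⟨b', h, rfl⟩

/-- Coordinates that separate the points of the capped surface: on the cap, the cone coordinate
placed in the slot of the component of `B`. -/
noncomputable def capSeparate (N B : Set E3) :
    Quot (CapRel N B) → E3 × (ConnectedComponents B → ℝ) := by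
  classical
  exact Quot.lift (Sum.elim (fun x => ((x : E3), 0)) fun p => ((1 - (p.2 : ℝ)) • (p.1 : E3),
      Pi.single (p.1 : ConnectedComponents B) (p.2 : ℝ))) (by
    rintro _ _ (⟨x, b, h⟩ | ⟨b, b', h⟩)
    · simp [h]
    · simp [(mem_connectedComponentIn_iff b b').1 h])

theorem eq_of_capSeparate_capCone_eq {p p' : B × unitInterval}
    (h : capSeparate N B (capCone N B p) = capSeparate N B (capCone N B p')) :
    p.2 = p'.2 ∧ (p.1 : ConnectedComponents B) = p'.1 ∧ ((p.2 : ℝ) ≠ 1 → p.1 = p'.1) := by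
  classical
  simp only [capSeparate, capCone, Sum.elim_inr, Prod.mk.injEq] at h
  obtain ⟨h1, h2⟩ := h
  have key : (p.2 : ℝ) = p'.2 ∧ ((p.2 : ℝ) ≠ 0 → (p.1 : ConnectedComponents B) = p'.1) := by
    by_cases hc : (p.1 : ConnectedComponents B) = p'.1
    · rw [hc] at h2
      exact ⟨Pi.single_injective _ h2, fun _ => hc⟩
    · have h3 := congrFun h2 (p.1 : ConnectedComponents B)
      have h4 := congrFun h2 (p'.1 : ConnectedComponents B)
      rw [Pi.single_eq_same, Pi.single_eq_of_ne hc] at h3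
      rw [Pi.single_eq_same, Pi.single_eq_of_ne (Ne.symm hc)] at h4
      exact ⟨h3.trans h4, fun h => (h h3).elim⟩
  have h5 : (p.2 : ℝ) ≠ 1 → p.1 = p'.1 := by
    intro hne
    rw [← key.1] at h1
    exact Subtype.ext (smul_right_injective _ (sub_ne_zero.2 (Ne.symm hne)) h1)
  refine ⟨Subtype.ext key.1, ?_, h5⟩
  by_cases h0 : (p.2 : ℝ) = 0
  · rw [h5 (by rw [h0]; exact zero_ne_one)]
  · exact key.2 h0

theorem capCone_eq_capCone {p p' : B × unitInterval} (h : capCone N B p = capCone N B p') :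
    p.2 = p'.2 ∧ (p.1 : ConnectedComponents B) = p'.1 ∧ ((p.2 : ℝ) ≠ 1 → p.1 = p'.1) :=
  eq_of_capSeparate_capCone_eq (congrArg (capSeparate N B) h)

theorem eq_of_capSeparate_capBase_eq {x : N} {p : B × unitInterval}
    (h : capSeparate N B (capBase N B x) = capSeparate N B (capCone N B p)) :
    (p.2 : ℝ) = 0 ∧ (x : E3) = p.1 := by
  classical
  simp only [capSeparate, capCone, capBase, Sum.elim_inr, Sum.elim_inl, Prod.mk.injEq] at h
  obtain ⟨h1, h2⟩ := h
  have h3 : (p.2 : ℝ) = 0 := by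
    have h3 := congrFun h2 (p.1 : ConnectedComponents B)
    rw [Pi.single_eq_same] at h3
    exact h3.symm
  exact ⟨h3, by rw [h1, h3]; simp⟩

theorem capSeparate_injective : Function.Injective (capSeparate N B) := by
  intro x y h
  have hb : ∀ (z : N) (p : B × unitInterval),
      capSeparate N B (capBase N B z) = capSeparate N B (capCone N B p) →
      capBase N B z = capCone N B p := by
    rintro z ⟨b, u⟩ h
    obtain ⟨h1, h2⟩ := eq_of_capSeparate_capBase_eq h
    obtain rfl : u = 0 := Subtype.ext h1
    exact capBase_eq_capCone h2
  rcases capBase_or_capCone x with ⟨x, rfl⟩ | ⟨⟨b, u⟩, rfl⟩ <;>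
    rcases capBase_or_capCone y with ⟨y, rfl⟩ | ⟨⟨b', u'⟩, rfl⟩
  · exact congrArg _ (Subtype.ext (congrArg Prod.fst h))
  · exact hb _ _ h
  · exact (hb _ _ h.symm).symm
  · obtain ⟨h1, h2, h3⟩ := eq_of_capSeparate_capCone_eq h
    obtain rfl : u = u' := h1
    by_cases hu1 : (u : ℝ) = 1
    · obtain rfl : u = 1 := Subtype.ext hu1
      exact Quot.sound (CapRel.tip b b' ((mem_connectedComponentIn_iff b b').2 h2))
    · rw [show b = b' from h3 hu1]

theorem t2Space_cap [DiscreteTopology (ConnectedComponents B)] :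
    T2Space (Quot (CapRel N B)) := by
  classical
  refine T2Space.of_injective_continuous (f := capSeparate N B) capSeparate_injective ?_
  refine continuous_quot_lift _ (Continuous.sumElim (by fun_prop) ?_)
  refine Continuous.prodMk (by fun_prop) (continuous_pi fun c => ?_)
  have hc : Continuous fun p : B × unitInterval => (p.1 : ConnectedComponents B) :=
    ConnectedComponents.continuous_coe.comp continuous_fst
  have : (fun p : B × unitInterval => Pi.single (M := fun _ => ℝ) (p.1 : ConnectedComponents B)
      (p.2 : ℝ) c) = fun p => (if (p.1 : ConnectedComponents B) = c then (1 : ℝ) else 0) * p.2 := by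
    funext p
    by_cases h : (p.1 : ConnectedComponents B) = c
    · subst h; simp
    · simp [h]
  rw [this]
  exact ((continuous_of_discreteTopology (f := fun k : ConnectedComponents B =>
    if k = c then (1 : ℝ) else 0)).comp hc).mul (by fun_prop)

variable (e : B ≃ₜ ConnectedComponents B × Circle)

/-- The position of a point of the cylinder in the closed unit disc which is the cap: `e` identifies
the components of `B` with circles, `B × {0}` goes to the unit circle and the tip to the origin. -/
noncomputable def discCoord (p : B × unitInterval) : ℂ := (1 - (p.2 : ℝ) : ℝ) * (e p.1).2

/-- The point of the cap over the component `c` whose position in the closed unit disc is `z` (junk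
if `‖z‖ > 1`; at `z = 0`, the tip, the direction does not matter). -/
noncomputable def discPoint (N : Set E3) (c : ConnectedComponents B) (z : ℂ) : Quot (CapRel N B) :=
  capCone N B (e.symm (c, direction z), projIcc 0 1 zero_le_one (1 - ‖z‖))

theorem norm_discCoord (p : B × unitInterval) : ‖discCoord e p‖ = 1 - p.2 := by
  rw [discCoord, norm_mul, Circle.norm_coe, mul_one, Complex.norm_real, Real.norm_eq_abs,
    abs_of_nonneg (sub_nonneg.2 p.2.2.2)]

theorem continuous_discCoord : Continuous (discCoord e) := by
  have : Continuous fun p : B × unitInterval => ((e p.1).2 : ℂ) :=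
    (continuous_subtype_val (p := (· ∈ Submonoid.unitSphere ℂ))).comp
      (continuous_snd.comp (e.continuous.comp continuous_fst))
  unfold discCoord
  fun_prop

theorem continuousOn_discPoint (c : ConnectedComponents B) :
    ContinuousOn (discPoint e N c) {0}ᶜ := by
  refine continuous_capCone.comp_continuousOn (ContinuousOn.prodMk ?_ ?_)
  · exact e.symm.continuous.comp_continuousOn (continuousOn_const.prodMk continuousOn_direction)
  · exact (continuous_projIcc.comp (by fun_prop)).continuousOn

variable {e}

theorem discPoint_eq_capCone_iff (he : ∀ x, (e x).1 = x)
    {c : ConnectedComponents B} {z : ℂ} (hz : ‖z‖ ≤ 1)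
    {p : B × unitInterval} :
    discPoint e N c z = capCone N B p ↔ (e p.1).1 = c ∧ discCoord e p = z := by
  have hpr : (projIcc (0 : ℝ) 1 zero_le_one (1 - ‖z‖) : ℝ) = 1 - ‖z‖ := by
    rw [projIcc_of_mem zero_le_one ⟨by linarith, by linarith [norm_nonneg z]⟩]
  constructor
  · intro h
    obtain ⟨h1, h2, h3⟩ := capCone_eq_capCone h
    simp only at h1 h2 h3
    have hp2 : (p.2 : ℝ) = 1 - ‖z‖ := by rw [← h1, hpr]
    refine ⟨by rw [he, ← h2, ← he, e.apply_symm_apply], ?_⟩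
    by_cases hz0 : z = 0
    · rw [hz0, ← norm_eq_zero, norm_discCoord, hp2, hz0]
      simp
    · have := h3 (by rw [hpr]; simpa using hz0)
      rw [discCoord, hp2, ← this, e.apply_symm_apply, sub_sub_cancel, norm_smul_direction hz0]
  · rintro ⟨h1, h2⟩
    obtain ⟨b, u⟩ := p
    have hu : ‖z‖ = 1 - u := by rw [← h2, norm_discCoord]
    have hpu : projIcc (0 : ℝ) 1 zero_le_one (1 - ‖z‖) = u :=
      Subtype.ext (by rw [hpr, hu, sub_sub_cancel])
    rw [discPoint, hpu]
    by_cases hu1 : (u : ℝ) = 1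
    · have : u = 1 := Subtype.ext hu1
      subst this
      refine Quot.sound (CapRel.tip _ _ ((mem_connectedComponentIn_iff _ _).2 ?_))
      rw [← he, ← he, e.apply_symm_apply]
      exact h1.symm
    · have h0 : 0 < 1 - (u : ℝ) := sub_pos.2 (lt_of_le_of_ne u.2.2 hu1)
      rw [← h2, discCoord, direction_smul h0, ← h1]
      exact congrArg (fun b => capCone N B (b, u)) (e.symm_apply_apply b)

theorem discPoint_injective (he : ∀ x, (e x).1 = x)
    {c c' : ConnectedComponents B} {z z' : ℂ} (hz : ‖z‖ ≤ 1)
    (hz' : ‖z'‖ ≤ 1) (h : discPoint e N c z = discPoint e N c' z') : c = c' ∧ z = z' := by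
  obtain ⟨h1, h2⟩ := (discPoint_eq_capCone_iff he hz).1 h
  obtain ⟨h3, h4⟩ := (discPoint_eq_capCone_iff (N := N) (c := c') he hz').1 rfl
  exact ⟨h1.symm.trans h3, h2.symm.trans h4⟩

theorem capBase_ne_discPoint (he : ∀ x, (e x).1 = x)
    {c : ConnectedComponents B} {z : ℂ} (hz : ‖z‖ < 1) (x : N) :
    capBase N B x ≠ discPoint e N c z := by
  intro h
  obtain ⟨-, h2⟩ := (discPoint_eq_capCone_iff (N := N) (c := c) he hz.le).1 rfl
  rw [← h2, norm_discCoord, (eq_of_capSeparate_capBase_eq (congrArg _ h)).1] at hz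
  simp at hz

theorem isOpen_discPoint_image (he : ∀ x, (e x).1 = x)
    [DiscreteTopology (ConnectedComponents B)]
    (c : ConnectedComponents B) {O : Set ℂ} (hO : IsOpen O) (hO1 : O ⊆ ball 0 1) :
    IsOpen (discPoint e N c '' O) := by
  have hO1' : ∀ z ∈ O, ‖z‖ < 1 := fun z hz => by simpa using hO1 hz
  rw [← isQuotientMap_quot_mk.isOpen_preimage, isOpen_sum_iff]
  constructor
  · convert isOpen_empty
    refine eq_empty_of_forall_notMem ?_
    rintro x ⟨z, hz, h⟩
    exact capBase_ne_discPoint he (hO1' z hz) x h.symm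
  · have : Sum.inr ⁻¹' (Quot.mk (CapRel N B) ⁻¹' (discPoint e N c '' O)) =
        (fun p : B × unitInterval => (e p.1).1) ⁻¹' {c} ∩ discCoord e ⁻¹' O := by
      ext p
      constructor
      · rintro ⟨z, hz, h⟩
        obtain ⟨h1, h2⟩ := (discPoint_eq_capCone_iff he (hO1' z hz).le).1 h
        exact ⟨h1, by rw [mem_preimage, h2]; exact hz⟩
      · rintro ⟨h1, h2⟩
        exact ⟨_, h2, (discPoint_eq_capCone_iff he (hO1' _ h2).le).2 ⟨h1, rfl⟩⟩
    rw [this]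
    refine IsOpen.inter ?_ (hO.preimage (continuous_discCoord e))
    exact (isOpen_discrete _).preimage
      (continuous_fst.comp (e.continuous.comp continuous_fst))

/-- A punctured disc is connected, by polar coordinates. -/
theorem isPreconnected_punctured_ball (ξ : ℂ) (r : ℝ) : IsPreconnected (ball ξ r \ {ξ}) := by
  have h1 : IsPreconnected ((univ : Set Circle) ×ˢ Ioo (0 : ℝ) r) := by
    have : PreconnectedSpace Circle := by
      have := isPreconnected_range (f := Circle.exp) Circle.exp.continuous
      rw [Circle.exp_surjective.range_eq] at this
      exact ⟨this⟩
    exact isPreconnected_univ.prod isPreconnected_Ioo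
  convert h1.image (fun p : Circle × ℝ => ξ + p.2 * (p.1 : ℂ)) ?_
  · ext z
    constructor
    · rintro ⟨hz, hne⟩
      have h0 : z - ξ ≠ 0 := sub_ne_zero.2 hne
      refine ⟨(direction (z - ξ), ‖z - ξ‖), ⟨mem_univ _, norm_pos_iff.2 h0, ?_⟩, ?_⟩
      · rwa [← dist_eq_norm]
      · simp only
        rw [norm_smul_direction h0]; ring
    · rintro ⟨⟨a, t⟩, ⟨-, ht0, htr⟩, rfl⟩
      simp only at ht0 htr
      constructor
      · simpa [Circle.norm_coe, abs_of_pos ht0] using htr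
      · simp [ht0.ne']
  · have : Continuous fun p : Circle × ℝ => ((p.1 : Circle) : ℂ) :=
      (continuous_subtype_val (p := (· ∈ Submonoid.unitSphere ℂ))).comp continuous_fst
    exact (by fun_prop : Continuous fun p : Circle × ℝ => ξ + p.2 * (p.1 : ℂ)).continuousOn

/-- Curves in the capped surface leave out an interior point of each cap. -/
theorem exists_discPoint_notMem (he : ∀ x, (e x).1 = x)
    [DiscreteTopology (ConnectedComponents B)] {n : ℕ}
    {γ : Fin n → Circle → Quot (CapRel N B)} (hγ : ∀ i, Continuous (γ i))
    (hγi : ∀ i, Function.Injective (γ i)) (c : ConnectedComponents B) :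
    ∃ ξ : ℂ, ξ ≠ 0 ∧ ‖ξ‖ < 1 ∧ ∀ i, discPoint e N c ξ ∉ range (γ i) := by
  have : T2Space (Quot (CapRel N B)) := t2Space_cap
  have hr : (0 : ℝ) < 1 / 4 := by norm_num
  -- a copy of the plane in the cap, away from the tip and the boundary
  set b := OpenPartialHomeomorph.univBall (1 / 2 : ℂ) (1 / 4)
  have hb : ∀ w, b w ≠ 0 ∧ ‖b w‖ < 1 := fun w => by
    have := b.map_source (x := w) (by simp [b])
    rw [OpenPartialHomeomorph.univBall_target _ hr, mem_ball, dist_eq_norm] at this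
    have h2 : ‖(1 / 2 : ℂ)‖ = 1 / 2 := by norm_num
    constructor
    · intro h0
      rw [h0, zero_sub, norm_neg, h2] at this
      norm_num at this
    · have := norm_add_le (b w - 1 / 2) (1 / 2)
      rw [sub_add_cancel, h2] at this
      linarith
  have hbc : Continuous b := OpenPartialHomeomorph.continuous_univBall _ _
  have hbi : Function.Injective b := by
    rw [← injOn_univ]
    have := b.injOn
    rwa [OpenPartialHomeomorph.univBall_source] at this
  obtain ⟨w, hw⟩ := exists_notMem_range_curves hγ hγi (J := fun w => discPoint e N c (b w))
    ((continuousOn_discPoint e c).comp_continuous hbc fun w => (hb w).1)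
    fun w w' h => hbi (discPoint_injective he (hb w).2.le (hb w').2.le h).2
  exact ⟨b w, (hb w).1, (hb w).2, hw⟩

/-- Removing an interior point of each cap does not disconnect. -/
theorem isPreconnected_sdiff_discPoints (he : ∀ x, (e x).1 = x)
    [DiscreteTopology (ConnectedComponents B)]
    {Γ : Set (Quot (CapRel N B))} (hΓ : IsClosed Γ) (hc : IsPreconnected Γᶜ)
    {ξ : ConnectedComponents B → ℂ} (h0 : ∀ c, ξ c ≠ 0) (h1 : ∀ c, ‖ξ c‖ < 1)
    (hξ : ∀ c, discPoint e N c (ξ c) ∉ Γ) (F : Finset (ConnectedComponents B)) :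
    IsPreconnected (Γᶜ \ (fun c => discPoint e N c (ξ c)) '' F) := by
  classical
  have : T2Space (Quot (CapRel N B)) := t2Space_cap
  induction F using Finset.induction_on with
  | empty => simpa using hc
  | insert c F hcF ih =>
    have hev : ∀ᶠ z in 𝓝 (ξ c), z ∈ ball (0 : ℂ) 1 ∧ z ≠ 0 ∧ discPoint e N c z ∈ Γᶜ := by
      refine (isOpen_ball.eventually_mem (by simpa using h1 c)).and
        ((isOpen_ne.eventually_mem (h0 c)).and ?_)
      exact ((continuousOn_discPoint e c).continuousAt (isOpen_ne.mem_nhds (h0 c))).eventually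
        (hΓ.isOpen_compl.eventually_mem (hξ c))
    obtain ⟨r, hr, hball⟩ := Metric.eventually_nhds_iff_ball.1 hev
    have hU := isOpen_discPoint_image (N := N) he c (isOpen_ball (x := ξ c) (ε := r))
      fun z hz => (hball z hz).1
    have hn : ∀ z ∈ ball (ξ c) r, ‖z‖ ≤ 1 := fun z hz => by
      have := (hball z hz).1
      rw [mem_ball_zero_iff] at this
      exact this.le
    have key := IsPreconnected.sdiff_of_isOpen ih (isClosed_singleton (x := discPoint e N c (ξ c)))
      hU ?_ ?_
    · convert key using 1
      rw [Finset.coe_insert, image_insert_eq, ← union_singleton, ← sdiff_sdiff]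
    · rintro x ⟨-, rfl⟩
      exact ⟨ξ c, mem_ball_self hr, rfl⟩
    · convert (isPreconnected_punctured_ball (ξ c) r).image (discPoint e N c)
        ((continuousOn_discPoint e c).mono fun z hz => (hball z hz.1).2.1)
      ext x
      constructor
      · rintro ⟨⟨-, z, hz, rfl⟩, hx⟩
        exact ⟨z, ⟨hz, fun h => hx (by rw [mem_singleton_iff.1 h]; rfl)⟩, rfl⟩
      · rintro ⟨z, ⟨hz, hzξ⟩, rfl⟩
        refine ⟨⟨⟨(hball z hz).2.2, ?_⟩, z, hz, rfl⟩, fun h => ?_⟩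
        · rintro ⟨c', hc', h⟩
          have := (discPoint_injective he (h1 c').le (hn z hz) h).1
          exact hcF (this ▸ hc')
        · exact hzξ (discPoint_injective he (hn z hz) (h1 c).le h).2

end Cap

/-! ### Moving curves off the caps -/

/-- If `N` is enlarged by a half-open collar `Φ (B × [0, σ))` of its boundary, then curves in the
capped surface can be moved to the enlargement: each cap, punctured at a point which is on none of
the curves, is homeomorphic to the collar of its boundary circle. -/
theorem exists_curves_in_collar_extension {N B : Set E3} (hB : IsCompact B)
    (harc : ∀ x : B, ∃ v : ℝ → B, IsOpenEmbedding v ∧ x ∈ range v)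
    {Φ : B → ℝ → E3} {σ : ℝ} (hσ : 0 < σ)
    (hΦ : ContinuousOn (fun z : B × ℝ => Φ z.1 z.2) (univ ×ˢ Ico 0 σ))
    (hΦ0 : ∀ b, Φ b 0 = b)
    (hΦi : ∀ b b', ∀ τ ∈ Ico 0 σ, ∀ τ' ∈ Ico 0 σ, Φ b τ = Φ b' τ' → b = b' ∧ τ = τ')
    (hΦN : ∀ b, ∀ τ ∈ Ico 0 σ, Φ b τ ∈ N → τ = 0)
    {n : ℕ} {γ : Fin n → Circle → Quot (CapRel N B)} (hγ : ∀ i, Continuous (γ i))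
    (hγi : ∀ i, Function.Injective (γ i))
    (hγd : ∀ i j, i ≠ j → Disjoint (range (γ i)) (range (γ j)))
    (hγc : IsPreconnected (⋃ i, range (γ i))ᶜ) :
    ∃ γ' : Fin n → Circle → E3, (∀ i, Continuous (γ' i)) ∧ (∀ i, Function.Injective (γ' i)) ∧
      (∀ i j, i ≠ j → Disjoint (range (γ' i)) (range (γ' j))) ∧
      (∀ i, range (γ' i) ⊆ N ∪ {x | ∃ b, ∃ τ ∈ Ico 0 σ, Φ b τ = x}) ∧
      IsPreconnected ((N ∪ {x | ∃ b, ∃ τ ∈ Ico 0 σ, Φ b τ = x}) \ ⋃ i, range (γ' i)) := by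
  have hBc : CompactSpace B := isCompact_iff_compactSpace.1 hB
  obtain ⟨hdisc, e, he⟩ := exists_homeomorph_connectedComponents_prod_circle harc
  have : CompactSpace (ConnectedComponents B) := Quot.compactSpace
  have : Finite (ConnectedComponents B) := finite_of_compact_of_discrete
  have := Fintype.ofFinite (ConnectedComponents B)
  have : T2Space (Quot (CapRel N B)) := t2Space_cap
  choose ξ hξ0 hξ1 hξγ using exists_discPoint_notMem (N := N) he hγ hγi
  set q := fun c => discPoint e N c (ξ c)
  have hΓ : IsClosed (⋃ i, range (γ i)) := isClosed_iUnion_of_finite fun i =>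
    ((hγ i).isClosedEmbedding (hγi i)).isClosed_range
  have hconn : IsPreconnected ((⋃ i, range (γ i))ᶜ \ range q) := by
    have := isPreconnected_sdiff_discPoints he hΓ hγc hξ0 hξ1 (fun c => by simpa using hξγ c)
      Finset.univ
    simpa using this
  choose d r hd hr hdr hr01 hinj hsurj using fun c => exists_punctured_disc_annulus (hξ1 c)
  -- the map from the punctured capped surface to the enlargement
  set G₀ : N ⊕ (B × unitInterval) → E3 := Sum.elim (fun x => (x : E3)) fun p =>
    Φ (e.symm ((e p.1).1, d (e p.1).1 (discCoord e p))) (σ * (1 - r (e p.1).1 (discCoord e p)))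
  set G : Quot (CapRel N B) → E3 := Quot.lift G₀ (by
    rintro _ _ (⟨x, b, h⟩ | ⟨b, b', h⟩)
    · have h1 : discCoord e (b, 0) = (e b).2 := by simp [discCoord]
      simp only [G₀, Sum.elim_inl, Sum.elim_inr, h1, (hdr _ _).1, (hdr _ _).2, Prod.mk.eta,
        e.symm_apply_apply, sub_self, mul_zero, hΦ0, h]
    · have h1 : ∀ b : B, discCoord e (b, 1) = 0 := fun b => by simp [discCoord]
      simp only [G₀, Sum.elim_inr, h1, he, (mem_connectedComponentIn_iff b b').1 h])
  have hGcone : ∀ p, G (capCone N B p) = Φ (e.symm ((e p.1).1, d (e p.1).1 (discCoord e p)))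
      (σ * (1 - r (e p.1).1 (discCoord e p))) := fun p => rfl
  have hGbase : ∀ x, G (capBase N B x) = x := fun p => rfl
  have hq : ∀ p, capCone N B p ∉ range q →
      discCoord e p ∈ closedBall 0 1 \ {ξ (e p.1).1} := by
    intro p hp
    refine ⟨?_, fun h => hp ⟨(e p.1).1, ?_⟩⟩
    · rw [mem_closedBall_zero_iff, norm_discCoord]; linarith [p.2.2.1]
    · exact (discPoint_eq_capCone_iff he (hξ1 _).le).2 ⟨rfl, h⟩
  have hτ : ∀ c, ∀ z ∈ closedBall 0 1 \ {ξ c}, σ * (1 - r c z) ∈ Ico 0 σ := by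
    intro c z hz
    obtain ⟨h1, h2⟩ := hr01 c z hz
    exact ⟨mul_nonneg hσ.le (by linarith), by nlinarith⟩
  have hqo : IsOpen (range q)ᶜ := (finite_range q).isClosed.isOpen_compl
  -- continuity on the quotient can be tested on `N` and on the cylinder, and on the cylinder for each
  -- component of `B` separately
  have hGc : ContinuousOn G (range q)ᶜ := by
    rw [isQuotientMap_quot_mk.continuousOn_isOpen_iff hqo]
    have hpre := hqo.preimage (continuous_quot_mk (r := CapRel N B))
    intro z hz
    refine ContinuousAt.continuousWithinAt ?_
    cases z with
    | inl x =>
      rw [← IsOpenEmbedding.inl.continuousAt_iff (f := (Sum.inl : N → N ⊕ (B × unitInterval)))]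
      exact continuous_subtype_val.continuousAt
    | inr p =>
      rw [← IsOpenEmbedding.inr.continuousAt_iff
        (f := (Sum.inr : B × unitInterval → N ⊕ (B × unitInterval)))]
      set c := (e p.1).1
      set A := {p' : B × unitInterval | (e p'.1).1 = c ∧ discCoord e p' ≠ ξ c}
      have hA : IsOpen A := by
        refine IsOpen.inter (s := {p' : B × unitInterval | (e p'.1).1 = c}) ?_
          (isOpen_ne.preimage (continuous_discCoord e))
        exact (isOpen_discrete {c}).preimage
          (continuous_fst.comp (e.continuous.comp continuous_fst))
      have hAz : ∀ p' ∈ A, discCoord e p' ∈ closedBall 0 1 \ {ξ c} := fun p' hp' => by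
        refine ⟨?_, hp'.2⟩
        rw [mem_closedBall_zero_iff, norm_discCoord]; linarith [p'.2.2.1]
      have hpA : p ∈ A := ⟨rfl, (hq p hz).2⟩
      have hcd := (hd c).comp (continuous_discCoord e).continuousOn hAz
      have hcr := (hr c).comp (continuous_discCoord e).continuousOn hAz
      have hF : ContinuousOn (fun p' => Φ (e.symm (c, d c (discCoord e p')))
          (σ * (1 - r c (discCoord e p')))) A :=
        hΦ.comp (f := fun p' => (e.symm (c, d c (discCoord e p')), σ * (1 - r c (discCoord e p'))))
          ((e.symm.continuous.comp_continuousOn (continuousOn_const.prodMk hcd)).prodMk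
            (continuousOn_const.mul (continuousOn_const.sub hcr)))
          fun p' hp' => ⟨mem_univ _, hτ c _ (hAz p' hp')⟩
      refine (hF.continuousAt (hA.mem_nhds hpA)).congr ?_
      filter_upwards [hA.mem_nhds hpA] with p' hp'
      have h1 : (e p'.1).1 = c := hp'.1
      simp only [Function.comp_apply, ← h1]
      rfl
  -- a point of the collar that lies in `N` is at the inner end, on the unit circle of its cap
  have hmix : ∀ x p, capCone N B p ∉ range q → G (capBase N B x) = G (capCone N B p) →
      capBase N B x = capCone N B p := by
    intro x p hp h
    rw [hGbase, hGcone] at h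
    have hz := hq p hp
    have h1 : σ * (1 - r (e p.1).1 (discCoord e p)) = 0 :=
      hΦN _ _ (hτ _ _ hz) (h ▸ x.2)
    have h2 : r (e p.1).1 (discCoord e p) = 1 := by
      rcases mul_eq_zero.1 h1 with h1 | h1 <;> linarith
    set a := d (e p.1).1 (discCoord e p)
    have ha : (a : ℂ) ∈ closedBall 0 1 \ {ξ (e p.1).1} := by
      refine ⟨by simp [Circle.norm_coe], fun h3 => ?_⟩
      have := hξ1 (e p.1).1
      rw [← mem_singleton_iff.1 h3, Circle.norm_coe] at this
      exact lt_irrefl _ this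
    have h3 : (a : ℂ) = discCoord e p :=
      hinj _ _ ha _ hz (hdr _ a).1 ((hdr _ a).2.trans h2.symm)
    have h4 : p.2 = 0 := by
      have := norm_discCoord e p
      rw [← h3, Circle.norm_coe] at this
      exact Subtype.ext (show (p.2 : ℝ) = 0 by linarith)
    rw [h1, hΦ0] at h
    obtain ⟨b, u⟩ := p
    obtain rfl : u = 0 := h4
    refine capBase_eq_capCone (h.trans ?_)
    have h5 : a = (e b).2 := Circle.ext (by rw [h3]; simp [discCoord])
    rw [h5, Prod.mk.eta, e.symm_apply_apply]
  have hGi : InjOn G (range q)ᶜ := by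
    intro x hx y hy h
    rcases capBase_or_capCone x with ⟨x, rfl⟩ | ⟨p, rfl⟩ <;>
      rcases capBase_or_capCone y with ⟨y, rfl⟩ | ⟨p', rfl⟩
    · exact congrArg _ (Subtype.ext h)
    · exact hmix _ _ hy h
    · exact (hmix _ _ hx h.symm).symm
    · have hz := hq p hx
      have hz' := hq p' hy
      rw [hGcone, hGcone] at h
      obtain ⟨h1, h2⟩ := hΦi _ _ _ (hτ _ _ hz) _ (hτ _ _ hz') h
      have h3 := e.symm.injective h1
      rw [Prod.mk.injEq] at h3
      obtain ⟨hc, h3⟩ := h3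
      have h4 : r (e p.1).1 (discCoord e p) = r (e p'.1).1 (discCoord e p') := by
        have := mul_left_cancel₀ hσ.ne' h2
        linarith
      rw [← hc] at h3 h4 hz'
      have h5 := hinj _ _ hz _ hz' h3 h4
      have hn : ‖discCoord e p‖ ≤ 1 := by simpa using hz.1
      rw [← (discPoint_eq_capCone_iff (N := N) he hn).2 ⟨rfl, rfl⟩]
      exact (discPoint_eq_capCone_iff he hn).2 ⟨hc.symm, h5.symm⟩
  have hGE : G '' (range q)ᶜ = N ∪ {x | ∃ b, ∃ τ ∈ Ico 0 σ, Φ b τ = x} := by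
    ext y
    constructor
    · rintro ⟨x, hx, rfl⟩
      rcases capBase_or_capCone x with ⟨x, rfl⟩ | ⟨p, rfl⟩
      · exact Or.inl x.2
      · exact Or.inr ⟨_, _, hτ _ _ (hq p hx), rfl⟩
    · rintro (hy | ⟨b, τ, hτ, rfl⟩)
      · refine ⟨capBase N B ⟨y, hy⟩, ?_, rfl⟩
        rintro ⟨c, hc⟩
        exact capBase_ne_discPoint he (hξ1 c) _ hc.symm
      · obtain ⟨z, hz, hz1, hz2⟩ := hsurj (e b).1 (e b).2 (1 - τ / σ)
          (by have := (div_lt_one hσ).2 hτ.2; linarith) (by have := div_nonneg hτ.1 hσ.le; linarith)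
        have hn : ‖z‖ ≤ 1 := by simpa using hz.1
        obtain ⟨p, hp⟩ : ∃ p, capCone N B p = discPoint e N (e b).1 z := ⟨_, rfl⟩
        obtain ⟨h1, h2⟩ := (discPoint_eq_capCone_iff he hn).1 hp.symm
        refine ⟨capCone N B p, ?_, ?_⟩
        · rintro ⟨c, hc⟩
          obtain ⟨h3, h4⟩ := (discPoint_eq_capCone_iff he (hξ1 c).le).1 hc
          rw [h2] at h4
          rw [h1] at h3
          exact hz.2 (by rw [mem_singleton_iff, h4, h3])
        · rw [hGcone, h1, h2, hz1, hz2, Prod.mk.eta, e.symm_apply_apply]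
          congr 1
          field_simp
          ring
  have hγq : ∀ i a, γ i a ∈ (range q)ᶜ := by
    rintro i a ⟨c, hc⟩
    exact hξγ c i ⟨a, hc.symm⟩
  have hrange : ∀ i, range (fun a => G (γ i a)) = G '' range (γ i) := fun i => range_comp G (γ i)
  have hrq : ∀ i, range (γ i) ⊆ (range q)ᶜ := fun i => range_subset_iff.2 (hγq i)
  refine ⟨fun i a => G (γ i a), fun i => hGc.comp_continuous (hγ i) (hγq i),
    fun i a a' h => hγi i (hGi (hγq i a) (hγq i a') h), fun i j hij => ?_, fun i => ?_, ?_⟩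
  · rw [hrange, hrange]
    exact (hγd i j hij).image hGi (hrq i) (hrq j)
  · rw [← hGE, hrange]
    exact image_mono (hrq i)
  · simp_rw [hrange]
    rw [← hGE, ← image_iUnion, ← hGi.image_sdiff_subset (iUnion_subset hrq)]
    have : (range q)ᶜ \ ⋃ i, range (γ i) = (⋃ i, range (γ i))ᶜ \ range q := by
      ext x; simp only [Set.mem_sdiff, mem_compl_iff]; tauto
    rw [this]
    exact hconn.image G (hGc.mono fun x hx => hx.2)

/-! ### Extending the component of the origin by a collar -/

namespace TransversalRadius

variable {M : Set E3} {S s δ : ℝ}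

theorem mem_boundary_iff (h : TransversalRadius M S s) {x : E3} :
    x ∈ surfaceBoundary (originComponent M s) ↔ x ∈ originComponent M s ∧ ‖x‖ = s := by
  rw [h.surfaceBoundary_eq, mem_inter_iff, mem_sphere_zero_iff_norm]

theorem boundary_subset (h : TransversalRadius M S s) :
    surfaceBoundary (originComponent M s) ⊆ M ∩ sphere 0 s := by
  rw [h.surfaceBoundary_eq]
  exact inter_subset_inter_left _ fun x hx => (originComponent_subset hx).2

theorem isCompact_boundary (h : TransversalRadius M S s) :
    IsCompact (surfaceBoundary (originComponent M s)) := by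
  rw [h.surfaceBoundary_eq]
  exact h.isCompact.inter_right isClosed_sphere

end TransversalRadius

/-- The component of the origin in the ball of radius `s`, extended by the part of width `σ` of
the collar along its boundary. -/
def Collar.extension {M : Set E3} {s δ : ℝ} (c : Collar M s δ) (σ : ℝ) : Set E3 :=
  originComponent M s ∪ {x | x ∈ M ∧ s ≤ ‖x‖ ∧ ‖x‖ ≤ s + σ ∧ c.proj x ∈ originComponent M s}

namespace TransversalRadius

variable {M : Set E3} {S s δ σ : ℝ}

theorem extension_subset (c : Collar M s δ) : c.extension σ ⊆ M :=
  union_subset (fun _ hx => (originComponent_subset hx).2) fun _ hx => hx.1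

theorem norm_le_of_mem_extension (c : Collar M s δ) (hσ : 0 ≤ σ) {x : E3}
    (hx : x ∈ c.extension σ) : ‖x‖ ≤ s + σ :=
  hx.elim (fun hx => (norm_le hx).trans (by linarith)) fun hx => hx.2.2.1

theorem toFun_mem_extension_iff (h : TransversalRadius M S s) (c : Collar M s δ) {b : E3}
    (hb : b ∈ surfaceBoundary (originComponent M s)) {τ : ℝ} (h0 : 0 ≤ τ) (hτ : τ ≤ δ) :
    c.toFun b τ ∈ c.extension σ ↔ τ ≤ σ ∨ τ = 0 := by
  have hb' := h.boundary_subset hb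
  have hτ' : |τ| ≤ δ := by rwa [abs_of_nonneg h0]
  have hn := c.norm_eq b hb' τ hτ'
  constructor
  · rintro (hx | hx)
    · have := norm_le hx
      exact Or.inr (by linarith)
    · have := hx.2.2.1
      exact Or.inl (by linarith)
  · rintro (h1 | rfl)
    · refine Or.inr ⟨c.mem b hb' τ hτ', by linarith, by linarith, ?_⟩
      rw [c.proj_toFun b hb' τ hτ']
      exact (h.mem_boundary_iff.1 hb).1
    · rw [c.toFun_zero b hb']
      exact Or.inl (h.mem_boundary_iff.1 hb).1

theorem isCompact_extension (h : TransversalRadius M S s) (c : Collar M s δ) (hσ : σ ≤ δ) :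
    IsCompact (c.extension σ) := by
  refine h.isCompact.union ?_
  have hK : IsCompact {x | x ∈ M ∧ s ≤ ‖x‖ ∧ ‖x‖ ≤ s + σ} :=
    h.minimal.isCompact.inter_right ((isClosed_le continuous_const continuous_norm).inter
      (isClosed_le continuous_norm continuous_const))
  have hcont : ContinuousOn c.proj {x | x ∈ M ∧ s ≤ ‖x‖ ∧ ‖x‖ ≤ s + σ} :=
    c.continuousOn_proj.mono fun x hx => ⟨hx.1, abs_le.2 ⟨by linarith [hx.2.1, c.pos],
      by linarith [hx.2.2]⟩⟩
  have := hcont.preimage_isClosed_of_isClosed hK.isClosed h.isCompact.isClosed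
  convert hK.of_isClosed_subset this inter_subset_left using 1
  ext x
  simp only [mem_inter_iff, Set.mem_ofPred_eq, mem_preimage]
  tauto

/-- Near any of its points, the extension is the part of `M` in the ball of radius `s + σ`. -/
theorem exists_nhds_extension (h : TransversalRadius M S s) (c : Collar M s δ) (hσ0 : 0 < σ)
    (hσ : σ < δ) {x : E3} (hx : x ∈ c.extension σ) :
    ∃ W, IsOpen W ∧ x ∈ W ∧ M ∩ W ∩ closedBall 0 (s + σ) ⊆ c.extension σ := by
  have hxM := extension_subset c hx
  by_cases hxs : ‖x‖ < s
  · have hxN : x ∈ originComponent M s := hx.elim id fun h => absurd h.2.1 (not_le.2 hxs)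
    obtain ⟨W, hW, hxW, -, hWN⟩ := h.exists_nhds_of_lt hxN hxs
    exact ⟨W, hW, hxW, fun y hy => Or.inl (hWN hy.1)⟩
  · rw [not_lt] at hxs
    have hxσ := norm_le_of_mem_extension c hσ0.le hx
    have hstrip : |‖x‖ - s| ≤ δ := abs_le.2 ⟨by linarith [c.pos], by linarith⟩
    have hpx : c.proj x ∈ originComponent M s := by
      rcases hx with hx | hx
      · have hxn : ‖x‖ = s := le_antisymm (norm_le hx) hxs
        have := c.proj_toFun x ⟨hxM, by simpa using hxn⟩ 0 (by simpa using c.pos.le)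
        rw [c.toFun_zero x ⟨hxM, by simpa using hxn⟩] at this
        rwa [this]
      · exact hx.2.2.2
    obtain ⟨W₁, hW₁, hxW₁, hWN₁⟩ := h.exists_nhds hpx
    have hev : ∀ᶠ y in 𝓝[{x | x ∈ M ∧ |‖x‖ - s| ≤ δ}] x, c.proj y ∈ W₁ :=
      c.continuousOn_proj x ⟨hxM, hstrip⟩ (hW₁.mem_nhds hxW₁)
    obtain ⟨W₂, hW₂, hxW₂, hWN₂⟩ := mem_nhdsWithin.1 hev
    have hup : ∀ y ∈ M, y ∈ W₂ → s ≤ ‖y‖ → ‖y‖ ≤ s + σ → y ∈ c.extension σ := by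
      intro y hyM hyW h1 h2
      have h3 : |‖y‖ - s| ≤ δ := abs_le.2 ⟨by linarith [c.pos], by linarith⟩
      have h4 := c.proj_mem y hyM h3
      exact Or.inr ⟨hyM, h1, h2, hWN₁ ⟨⟨h4.1, hWN₂ ⟨hyW, hyM, h3⟩⟩, sphere_subset_closedBall h4.2⟩⟩
    rcases hxs.eq_or_lt with hxs | hxs
    · have hxN : x ∈ originComponent M s := by
        rcases hx with hx | hx
        · exact hx
        · have := c.toFun_proj x hxM hstrip
          rw [← hxs, sub_self, c.toFun_zero _ (c.proj_mem x hxM hstrip)] at this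
          rwa [← this]
      obtain ⟨W₃, hW₃, hxW₃, hWN₃⟩ := h.exists_nhds hxN
      refine ⟨W₂ ∩ W₃, hW₂.inter hW₃, ⟨hxW₂, hxW₃⟩, fun y hy => ?_⟩
      by_cases hys : s ≤ ‖y‖
      · exact hup y hy.1.1 hy.1.2.1 hys (by simpa using hy.2)
      · exact Or.inl (hWN₃ ⟨⟨hy.1.1, hy.1.2.2⟩, by simpa using (not_le.1 hys).le⟩)
    · refine ⟨W₂ ∩ {y | s < ‖y‖}, hW₂.inter (isOpen_lt continuous_const continuous_norm),
        ⟨hxW₂, hxs⟩, fun y hy => hup y hy.1.1 hy.1.2.1 (le_of_lt hy.1.2.2) (by simpa using hy.2)⟩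

/-- The extension without its outer boundary. -/
theorem extension_inter_ball (h : TransversalRadius M S s) (c : Collar M s δ) (hσ0 : 0 < σ)
    (hσ : σ < δ) : c.extension σ ∩ ball 0 (s + σ) = originComponent M s ∪
      {x | ∃ b : surfaceBoundary (originComponent M s), ∃ τ ∈ Ico 0 σ, c.toFun b τ = x} := by
  ext x
  constructor
  · rintro ⟨hx | hx, hxb⟩
    · exact Or.inl hx
    · rw [mem_ball_zero_iff] at hxb
      have h3 : |‖x‖ - s| ≤ δ := abs_le.2 ⟨by linarith [c.pos, hx.2.1], by linarith⟩
      have h4 := c.proj_mem x hx.1 h3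
      exact Or.inr ⟨⟨c.proj x, h.mem_boundary_iff.2 ⟨hx.2.2.2, by simpa using h4.2⟩⟩, ‖x‖ - s,
        ⟨by linarith [hx.2.1], by linarith⟩, c.toFun_proj x hx.1 h3⟩
  · rintro (hx | ⟨b, τ, hτ, rfl⟩)
    · exact ⟨Or.inl hx, by simpa using (norm_le hx).trans_lt (by linarith)⟩
    · refine ⟨(h.toFun_mem_extension_iff c b.2 hτ.1 (hτ.2.le.trans hσ.le)).2 (Or.inl hτ.2.le), ?_⟩
      rw [mem_ball_zero_iff, c.norm_eq b (h.boundary_subset b.2) τ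
        (by rw [abs_of_nonneg hτ.1]; linarith [hτ.2])]
      linarith [hτ.2]

/-- Curves in the capped component can be moved to the extension of the component. -/
theorem exists_curves_in_extension (h : TransversalRadius M S s) (c : Collar M s δ) (hσ0 : 0 < σ)
    (hσ : σ < δ) {n : ℕ} {γ : Fin n → Circle → CappedSurface (originComponent M s)}
    (hγ : ∀ i, Continuous (γ i)) (hγi : ∀ i, Function.Injective (γ i))
    (hγd : ∀ i j, i ≠ j → Disjoint (range (γ i)) (range (γ j)))
    (hγc : ∀ x, IsPreconnected (connectedComponent x \ ⋃ i, range (γ i))) :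
    ∃ γ' : Fin n → Circle → E3, (∀ i, Continuous (γ' i)) ∧ (∀ i, Function.Injective (γ' i)) ∧
      (∀ i j, i ≠ j → Disjoint (range (γ' i)) (range (γ' j))) ∧
      (∀ i, range (γ' i) ⊆ c.extension σ ∩ ball 0 (s + σ)) ∧
      IsPreconnected ((c.extension σ ∩ ball 0 (s + σ)) \ ⋃ i, range (γ' i)) := by
  have hBN : surfaceBoundary (originComponent M s) ⊆ originComponent M s := fun x hx =>
    (h.mem_boundary_iff.1 hx).1
  have hpre := preconnectedSpace_cap hBN isPreconnected ⟨0, h.zero_mem_originComponent⟩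
  have hconn : IsPreconnected (⋃ i, range (γ i))ᶜ := by
    have := hγc (capBase _ _ ⟨0, h.zero_mem_originComponent⟩)
    rwa [PreconnectedSpace.connectedComponent_eq_univ, ← compl_eq_univ_sdiff] at this
  have hδ : ∀ τ ∈ Ico 0 σ, |τ| ≤ δ := fun τ hτ => by
    rw [abs_of_nonneg hτ.1]; linarith [hτ.2]
  rw [h.extension_inter_ball c hσ0 hσ]
  refine exists_curves_in_collar_extension h.isCompact_boundary h.exists_boundary_arc hσ0
    (Φ := fun b τ => c.toFun b τ) ?_ (fun b => c.toFun_zero b (h.boundary_subset b.2)) ?_ ?_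
    hγ hγi hγd hconn
  · refine c.continuousOn_toFun.comp (f := fun z : surfaceBoundary (originComponent M s) × ℝ =>
      ((z.1 : E3), z.2)) (by fun_prop) ?_
    exact fun z hz => ⟨h.boundary_subset z.1.2, abs_le.1 (hδ _ hz.2)⟩
  · intro b b' τ hτ τ' hτ' he
    have hb := h.boundary_subset b.2
    have hb' := h.boundary_subset b'.2
    constructor
    · rw [Subtype.ext_iff, ← c.proj_toFun b hb τ (hδ τ hτ), he, c.proj_toFun b' hb' τ' (hδ τ' hτ')]
    · have := c.norm_eq b hb τ (hδ τ hτ)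
      rw [he, c.norm_eq b' hb' τ' (hδ τ' hτ')] at this
      linarith
  · intro b τ hτ hN
    have := norm_le hN
    rw [c.norm_eq b (h.boundary_subset b.2) τ (hδ τ hτ)] at this
    linarith [hτ.1]

/-- The extension is connected: this is the case of no curves. -/
theorem isPreconnected_extension_inter_ball (h : TransversalRadius M S s) (c : Collar M s δ)
    (hσ0 : 0 < σ) (hσ : σ < δ) : IsPreconnected (c.extension σ ∩ ball 0 (s + σ)) := by
  obtain ⟨γ, -, -, -, -, h5⟩ := h.exists_curves_in_extension c hσ0 hσ (n := 0)
    (γ := fun i => i.elim0) (fun i => i.elim0) (fun i => i.elim0) (fun i => i.elim0)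
    (fun x => by simpa using isPreconnected_connectedComponent)
  simpa using h5

theorem zero_mem_extension_inter_ball (h : TransversalRadius M S s) (c : Collar M s δ)
    (hσ0 : 0 < σ) : (0 : E3) ∈ c.extension σ ∩ ball 0 (s + σ) :=
  ⟨Or.inl h.zero_mem_originComponent, by simpa using by linarith [h.pos]⟩

theorem exists_nhds_extension_inter_ball (h : TransversalRadius M S s) (c : Collar M s δ)
    (hσ0 : 0 < σ) (hσ : σ < δ) {x : E3} (hx : x ∈ c.extension σ ∩ ball 0 (s + σ)) :
    ∃ W, IsOpen W ∧ x ∈ W ∧ M ∩ W ⊆ c.extension σ ∩ ball 0 (s + σ) := by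
  obtain ⟨W, hW, hxW, hWE⟩ := h.exists_nhds_extension c hσ0 hσ hx.1
  exact ⟨W ∩ ball 0 (s + σ), hW.inter isOpen_ball, ⟨hxW, hx.2⟩, fun y hy =>
    ⟨hWE ⟨⟨hy.1, hy.2.1⟩, ball_subset_closedBall hy.2.2⟩, hy.2.2⟩⟩

/-- By the maximum principle, no part of `M` is bounded by points of the extension: at a point
where the distance to the origin is greatest, such a part would touch a sphere from inside. -/
theorem eq_empty_of_closure_subset (h : TransversalRadius M S s) (c : Collar M s δ)
    (hσ0 : 0 < σ) (hσ : σ < δ) {P : Set E3} (hPM : P ⊆ M)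
    (hP : ∀ x ∈ P, ‖x‖ < S ∧ ∃ W, IsOpen W ∧ x ∈ W ∧ M ∩ W ⊆ P)
    (hd : Disjoint P (c.extension σ)) (hcl : closure P ⊆ P ∪ c.extension σ) : P = ∅ := by
  by_contra hne
  have hcpt : IsCompact (closure P) := h.minimal.isCompact.closure_of_subset hPM
  obtain ⟨x, hx, hmax⟩ := hcpt.exists_isMaxOn (nonempty_iff_ne_empty.2 hne).closure
    continuous_norm.continuousOn
  have hmax' : ∀ y ∈ P, ‖y‖ ≤ ‖x‖ := fun y hy => hmax (subset_closure hy)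
  rcases hcl hx with hxP | hxE
  · obtain ⟨hxS, W, hW, hxW, hWP⟩ := hP x hxP
    obtain ⟨y, hy, hlt⟩ := exists_norm_lt_of_isInteriorPoint h.minimal
      (h.isInteriorPoint (hPM hxP) hxS) (hW.mem_nhds hxW)
    exact absurd (hmax' y (hWP hy)) (not_le.2 hlt)
  · obtain ⟨W, hW, hxW, hWE⟩ := h.exists_nhds_extension c hσ0 hσ hxE
    obtain ⟨y, hyW, hyP⟩ := mem_closure_iff.1 hx W hW hxW
    have hyE : y ∈ c.extension σ := hWE ⟨⟨hPM hyP, hyW⟩, by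
      simpa using (hmax' y hyP).trans (norm_le_of_mem_extension c hσ0.le hxE)⟩
    exact hd.notMem_of_mem_left hyP hyE

end TransversalRadius

/-! ### Genus and extension -/

theorem le_closedGenus {X : Type} [TopologicalSpace X] {n : ℕ} {γ : Fin n → Circle → X}
    (hγ : ∀ i, Continuous (γ i)) (hγi : ∀ i, Function.Injective (γ i))
    (hγd : ∀ i j, i ≠ j → Disjoint (range (γ i)) (range (γ j)))
    (hγc : ∀ x, IsPreconnected (connectedComponent x \ ⋃ i, range (γ i))) :
    (n : ℕ∞) ≤ closedGenus X :=
  le_iSup₂_of_le n ⟨γ, hγ, hγi, hγd, hγc⟩ le_rfl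

/-- A finite genus is attained by a system of curves. -/
theorem exists_curves_of_closedGenus_eq {X : Type} [TopologicalSpace X] {L : ℕ}
    (h : closedGenus X = L) : ∃ γ : Fin L → Circle → X,
      (∀ i, Continuous (γ i)) ∧ (∀ i, Function.Injective (γ i)) ∧
      (∀ i j, i ≠ j → Disjoint (range (γ i)) (range (γ j))) ∧
      ∀ x : X, IsPreconnected (connectedComponent x \ ⋃ i, range (γ i)) := by
  by_contra hne
  cases L with
  | zero =>
    exact hne ⟨fun i => i.elim0, fun i => i.elim0, fun i => i.elim0, fun i => i.elim0,
      fun x => by simpa using isPreconnected_connectedComponent⟩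
  | succ L =>
    have h1 : closedGenus X ≤ L := by
      refine iSup₂_le fun n hn => ?_
      have h2 : (n : ℕ∞) ≤ closedGenus X := le_iSup₂_of_le n hn le_rfl
      rw [h] at h2
      have h3 : n ≤ L + 1 := by exact_mod_cast h2
      have h4 : n ≠ L + 1 := by
        rintro rfl
        exact hne hn
      exact_mod_cast (by omega : n ≤ L)
    rw [h] at h1
    have : L + 1 ≤ L := by exact_mod_cast h1
    omega

/-- The image in the capped surface of a part of the surface. -/
def capImage (N B A : Set E3) : Set (Quot (CapRel N B)) := capBase N B '' {x | (x : E3) ∈ A}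

section CapImage

variable {N B A Γ : Set E3}

theorem capBase_mem_capImage {x : N} : capBase N B x ∈ capImage N B A ↔ (x : E3) ∈ A :=
  capBase_injective.mem_set_image

theorem isOpen_capImage (hA : ∀ x ∈ A, ∃ W, IsOpen W ∧ x ∈ W ∧ N ∩ W ⊆ A) (hB : Disjoint A B) :
    IsOpen (capImage N B A) := by
  refine isOpen_capBase_image (fun x hx => hB.notMem_of_mem_left hx) ?_
  rw [isOpen_iff_mem_nhds]
  intro x hx
  obtain ⟨W, hW, hxW, hWA⟩ := hA x hx
  filter_upwards [(hW.preimage continuous_subtype_val).mem_nhds hxW] with y hy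
  exact hWA ⟨y.2, hy⟩

theorem isClosed_capImage (hA : IsClosed A) (hB : Disjoint A B) : IsClosed (capImage N B A) :=
  isClosed_capBase_image (fun _ hx => hB.notMem_of_mem_left hx) (hA.preimage continuous_subtype_val)

theorem isPreconnected_capImage (hA : IsPreconnected A) (hAN : A ⊆ N) :
    IsPreconnected (capImage N B A) := by
  refine IsPreconnected.image ?_ _ continuous_capBase.continuousOn
  rw [← IsInducing.subtypeVal.isPreconnected_image]
  convert hA
  ext x
  exact ⟨by rintro ⟨y, hy, rfl⟩; exact hy, fun hx => ⟨⟨x, hAN hx⟩, hx, rfl⟩⟩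

theorem capImage_sdiff : capImage N B (A \ Γ) = capImage N B A \ capImage N B Γ :=
  image_sdiff capBase_injective _ _

theorem range_capBase_comp {γ : Circle → E3} (h : ∀ a, γ a ∈ N) :
    (range fun a => capBase N B ⟨γ a, h a⟩) = capImage N B (range γ) := by
  ext x
  constructor
  · rintro ⟨a, rfl⟩
    exact ⟨_, ⟨a, rfl⟩, rfl⟩
  · rintro ⟨y, ⟨a, ha⟩, rfl⟩
    exact ⟨a, congrArg _ (Subtype.ext ha)⟩

theorem capImage_iUnion {ι : Sort*} (A : ι → Set E3) :
    capImage N B (⋃ i, A i) = ⋃ i, capImage N B (A i) := by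
  rw [capImage, show {x : N | (x : E3) ∈ ⋃ i, A i} = ⋃ i, {x : N | (x : E3) ∈ A i} by
    ext; simp, image_iUnion]
  rfl

/-- Curves that do not disconnect a connected open part `E` of a surface, away from its boundary, do
not disconnect any component of the capped surface: the component containing `E` is cut only within
`E`, and the others are not cut at all. -/
theorem isPreconnected_connectedComponent_sdiff_capImage {E : Set E3} (hEN : E ⊆ N)
    (hEo : ∀ x ∈ E, ∃ W, IsOpen W ∧ x ∈ W ∧ N ∩ W ⊆ E) (hEB : Disjoint E B)
    (hE : IsPreconnected E) (hΓE : Γ ⊆ E) (hΓ : IsClosed Γ) (hEΓ : IsPreconnected (E \ Γ))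
    (x : Quot (CapRel N B)) : IsPreconnected (connectedComponent x \ capImage N B Γ) := by
  have hΓE' : capImage N B Γ ⊆ capImage N B E := image_mono fun x hx => hΓE hx
  by_cases hne : (connectedComponent x ∩ capImage N B E).Nonempty
  · obtain ⟨y, hyx, hyE⟩ := hne
    have hsub : capImage N B E ⊆ connectedComponent x := by
      rw [connectedComponent_eq hyx]
      exact (isPreconnected_capImage hE hEN).subset_connectedComponent hyE
    refine IsPreconnected.sdiff_of_isOpen isPreconnected_connectedComponent
      (isClosed_capImage hΓ (hEB.mono_left hΓE)) (isOpen_capImage hEo hEB)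
      (fun y hy => hΓE' hy.2) ?_
    rw [inter_eq_right.2 hsub, ← capImage_sdiff]
    exact isPreconnected_capImage hEΓ (sdiff_subset.trans hEN)
  · rw [sdiff_eq_left.2]
    · exact isPreconnected_connectedComponent
    · exact (disjoint_iff_inter_eq_empty.2 (not_nonempty_iff_eq_empty.1 hne)).mono_right hΓE'

end CapImage

namespace TransversalRadius

variable {M : Set E3} {S s t : ℝ}

/-- The genus of the component does not exceed that of a larger surface that contains it together
with a collar. -/
theorem genus_le_of_extension_subset (h : TransversalRadius M S s) {δ σ : ℝ} (c : Collar M s δ)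
    (hσ0 : 0 < σ) (hσ : σ < δ) {N : Set E3} (hNM : N ⊆ M)
    (hE : c.extension σ ∩ ball 0 (s + σ) ⊆ N)
    (hEB : Disjoint (c.extension σ ∩ ball 0 (s + σ)) (surfaceBoundary N)) :
    genus (originComponent M s) ≤ genus N := by
  refine iSup₂_le fun n ⟨γ, hγ, hγi, hγd, hγc⟩ => ?_
  obtain ⟨γ', hγ', hγi', hγd', hγE, hγc'⟩ :=
    h.exists_curves_in_extension c hσ0 hσ hγ hγi hγd hγc
  have hN : ∀ i a, γ' i a ∈ N := fun i a => hE (hγE i ⟨a, rfl⟩)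
  refine le_closedGenus (γ := fun i a => capBase N (surfaceBoundary N) ⟨γ' i a, hN i a⟩) ?_ ?_ ?_ ?_
  · exact fun i => continuous_capBase.comp ((hγ' i).subtype_mk _)
  · exact fun i a a' h => hγi' i (congrArg Subtype.val (capBase_injective h))
  · intro i j hij
    rw [range_capBase_comp, range_capBase_comp]
    refine (disjoint_image_iff capBase_injective).2 (disjoint_left.2 fun x h1 h2 => ?_)
    exact (hγd' i j hij).notMem_of_mem_left h1 h2
  · intro x
    simp_rw [range_capBase_comp]
    rw [← capImage_iUnion]
    refine isPreconnected_connectedComponent_sdiff_capImage hE (fun x hx => ?_) hEB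
      (h.isPreconnected_extension_inter_ball c hσ0 hσ) (iUnion_subset hγE)
      (isClosed_iUnion_of_finite fun i => (isCompact_range (hγ' i)).isClosed) hγc' x
    obtain ⟨W, hW, hxW, hWE⟩ := h.exists_nhds_extension_inter_ball c hσ0 hσ hx
    exact ⟨W, hW, hxW, (inter_subset_inter_left _ hNM).trans hWE⟩

theorem genus_originComponent_le (h : TransversalRadius M S s) :
    genus (originComponent M s) ≤ genus M := by
  obtain ⟨δ, hδ, ⟨c⟩⟩ := h.exists_collar h.lt
  have hσ0 := half_pos c.pos
  have hσ := half_lt_self c.pos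
  refine h.genus_le_of_extension_subset c hσ0 hσ subset_rfl
    (inter_subset_left.trans (extension_subset c)) (disjoint_left.2 fun x hx hxB => ?_)
  have h1 := h.bdry hxB
  have h2 := hx.2
  rw [mem_sphere_zero_iff_norm] at h1
  rw [mem_ball_zero_iff] at h2
  linarith

theorem extension_inter_ball_subset (h : TransversalRadius M S s) (ht : TransversalRadius M S t)
    {δ σ : ℝ} (c : Collar M s δ) (hσ0 : 0 < σ) (hσ : σ < δ) (hst : s + σ ≤ t) :
    c.extension σ ∩ ball 0 (s + σ) ⊆ originComponent M t :=
  subset_of_isPreconnected (h.isPreconnected_extension_inter_ball c hσ0 hσ)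
    (h.zero_mem_extension_inter_ball c hσ0) ht.zero_mem_originComponent fun _ hx =>
    ⟨closedBall_subset_closedBall hst (ball_subset_closedBall hx.2), extension_subset c hx.1⟩

theorem genus_mono (h : TransversalRadius M S s) (ht : TransversalRadius M S t) (hst : s < t) :
    genus (originComponent M s) ≤ genus (originComponent M t) := by
  obtain ⟨δ, hδ, ⟨c⟩⟩ := h.exists_collar hst
  have hσ0 := half_pos c.pos
  have hσ := half_lt_self c.pos
  refine h.genus_le_of_extension_subset c hσ0 hσ (fun x hx => (originComponent_subset hx).2)
    (h.extension_inter_ball_subset ht c hσ0 hσ (by linarith)) (disjoint_left.2 fun x hx hxB => ?_)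
  have h1 := (ht.mem_boundary_iff.1 hxB).2
  have h2 := hx.2
  rw [mem_ball_zero_iff] at h2
  linarith

end TransversalRadius

/-! ### A disconnected boundary that becomes connected adds to the genus -/

/-- Open sets of the capped surface, seen in the ambient space near points of the surface. -/
theorem exists_nhds_capBase {N B : Set E3} {O : Set (Quot (CapRel N B))} (hO : IsOpen O) {y : E3}
    (hy : y ∈ N) (h : capBase N B ⟨y, hy⟩ ∈ O) :
    ∃ W, IsOpen W ∧ y ∈ W ∧ ∀ z (hz : z ∈ N), z ∈ W → capBase N B ⟨z, hz⟩ ∈ O := by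
  obtain ⟨W, hW, hWO⟩ := isOpen_induced_iff.1 (hO.preimage (continuous_capBase (N := N) (B := B)))
  have hiff : ∀ z (hz : z ∈ N), z ∈ W ↔ capBase N B ⟨z, hz⟩ ∈ O := fun z hz =>
    iff_of_eq (congrArg (fun T : Set N => (⟨z, hz⟩ : N) ∈ T) hWO)
  exact ⟨W, hW, (hiff y hy).2 h, fun z hz => (hiff z hz).1⟩

namespace TransversalRadius

variable {M : Set E3} {S s t δ σ : ℝ}

theorem continuousAt_toFun (h : TransversalRadius M S s) (c : Collar M s δ) {b : E3}
    (hb : b ∈ surfaceBoundary (originComponent M s)) {τ : ℝ} (hτ : |τ| < δ) :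
    ContinuousAt (c.toFun b) τ := by
  have : ContinuousOn (c.toFun b) (Icc (-δ) δ) :=
    c.continuousOn_toFun.comp (f := fun τ => (b, τ)) (by fun_prop)
      fun τ hτ => ⟨h.boundary_subset hb, hτ⟩
  exact this.continuousAt (Icc_mem_nhds (abs_lt.1 hτ).1 (abs_lt.1 hτ).2)

theorem toFun_mem_originComponent (h : TransversalRadius M S s) (ht : TransversalRadius M S t)
    (c : Collar M s δ) (hδt : s + δ < t) {b : E3}
    (hb : b ∈ surfaceBoundary (originComponent M s)) {τ : ℝ} (hτ : τ ∈ Icc 0 δ) :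
    c.toFun b τ ∈ originComponent M t := by
  have hb' := h.boundary_subset hb
  have habs : ∀ τ ∈ Icc 0 δ, |τ| ≤ δ := fun τ hτ => by rw [abs_of_nonneg hτ.1]; exact hτ.2
  have hpre : IsPreconnected (c.toFun b '' Icc 0 δ) := isPreconnected_Icc.image _
    (c.continuousOn_toFun.comp (f := fun τ => (b, τ)) (by fun_prop)
      fun τ hτ => ⟨hb', abs_le.1 (habs τ hτ)⟩)
  have hbN : b ∈ originComponent M t := by
    have hσ := half_lt_self c.pos
    refine h.extension_inter_ball_subset ht c (half_pos c.pos) hσ (by linarith)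
      ⟨Or.inl (h.mem_boundary_iff.1 hb).1, ?_⟩
    rw [mem_ball_zero_iff, (h.mem_boundary_iff.1 hb).2]
    linarith [half_pos c.pos]
  refine subset_of_isPreconnected hpre ⟨0, ⟨le_rfl, c.pos.le⟩, c.toFun_zero b hb'⟩ hbN ?_
    ⟨τ, hτ, rfl⟩
  rintro _ ⟨τ, hτ, rfl⟩
  refine ⟨?_, c.mem b hb' τ (habs τ hτ)⟩
  rw [mem_closedBall_zero_iff, c.norm_eq b hb' τ (habs τ hτ)]
  linarith [hτ.2]

theorem extension_subset_originComponent (h : TransversalRadius M S s)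
    (ht : TransversalRadius M S t) (c : Collar M s δ) (hσ : σ < δ) (hδt : s + δ < t) :
    c.extension σ ⊆ originComponent M t := by
  have hmem := fun {b} (hb : b ∈ surfaceBoundary (originComponent M s)) {τ} =>
    h.toFun_mem_originComponent ht c hδt hb (τ := τ)
  rintro x (hx | hx)
  · have hσ := half_lt_self c.pos
    refine h.extension_inter_ball_subset ht c (half_pos c.pos) hσ (by linarith) ⟨Or.inl hx, ?_⟩
    rw [mem_ball_zero_iff]
    linarith [half_pos c.pos, norm_le hx]
  · have h3 : |‖x‖ - s| ≤ δ := abs_le.2 ⟨by linarith [c.pos, hx.2.1], by linarith [hx.2.2.1]⟩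
    have h4 := c.proj_mem x hx.1 h3
    rw [← c.toFun_proj x hx.1 h3]
    exact hmem (h.mem_boundary_iff.2 ⟨hx.2.2.2, by simpa using h4.2⟩)
      ⟨by linarith [hx.2.1], by linarith [hx.2.2.1]⟩

/-- Suppose that the complement of `capImage Γ` is separated by `w` and `w'`, and that all caps are
on the side of `w'`. Then the side of `w` does not leave the extension: a part of it outside would
be bounded by points of the extension, against the maximum principle. -/
theorem mem_extension_of_caps_subset (h : TransversalRadius M S s) (c : Collar M s δ) (hσ0 : 0 < σ)
    (hσ : σ < δ) {N B : Set E3} (hNM : N ⊆ M) (hNc : IsClosed N)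
    (hNloc : ∀ y ∈ N, y ∉ B → ‖y‖ < S ∧ ∃ W, IsOpen W ∧ y ∈ W ∧ M ∩ W ⊆ N)
    {Γ : Set E3} (hΓE : Γ ⊆ c.extension σ) {w w' : Set (Quot (CapRel N B))} (hw : IsOpen w)
    (hw' : IsOpen w') (hcov : (capImage N B Γ)ᶜ ⊆ w ∪ w')
    (hd : (capImage N B Γ)ᶜ ∩ (w ∩ w') = ∅) (hcap : range (capCone N B) ⊆ w')
    {y : E3} (hy : y ∈ N) (hyw : capBase _ _ ⟨y, hy⟩ ∈ w) : y ∈ c.extension σ := by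
  by_contra hyE
  set P : Set E3 
    := {y | y ∉ c.extension σ ∧ ∃ hy : y ∈ N, capBase N B ⟨y, hy⟩ ∈ w} 
  have hcl : IsClosed (c.extension σ) := (h.isCompact_extension c hσ.le).isClosed
  have hZ : ∀ y (hy : y ∈ N), y ∉ c.extension σ → capBase N B ⟨y, hy⟩ ∈ (capImage N B Γ)ᶜ :=
    fun y hy hyE hyΓ => hyE (hΓE (capBase_mem_capImage.1 hyΓ))
  have hno : ∀ y (hy : y ∈ N), y ∉ c.extension σ → capBase N B ⟨y, hy⟩ ∈ w →
      capBase N B ⟨y, hy⟩ ∈ w' → False := fun y hy h1 h2 h3 => by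
    have : capBase N B ⟨y, hy⟩ ∈ (capImage N B Γ)ᶜ ∩ (w ∩ w') := ⟨hZ y hy h1, h2, h3⟩
    rwa [hd] at this
  have hempty : P = ∅ := by
    refine h.eq_empty_of_closure_subset c hσ0 hσ (fun y hy => hNM hy.2.1)
      ?_ (disjoint_left.2 fun y hy => hy.1) fun y hy => ?_
    · rintro y ⟨hyE, hy, hyw⟩
      have hyB : y ∉ B := fun hyB =>
        hno y hy hyE hyw (hcap ⟨(⟨y, hyB⟩, 0),
          (capBase_eq_capCone (x := ⟨y, hy⟩) (b := ⟨y, hyB⟩) rfl).symm⟩)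
      obtain ⟨hyS, W₁, hW₁, hyW₁, hWN₁⟩ := hNloc y hy hyB
      obtain ⟨W₂, hW₂, hyW₂, hWw₂⟩ := exists_nhds_capBase hw hy hyw
      exact ⟨hyS, W₁ ∩ W₂ ∩ (c.extension σ)ᶜ,
        (hW₁.inter hW₂).inter hcl.isOpen_compl, ⟨⟨hyW₁, hyW₂⟩, hyE⟩, fun z hz =>
        ⟨hz.2.2, hWN₁ ⟨hz.1, hz.2.1.1⟩, hWw₂ z _ hz.2.1.2⟩⟩
    · by_contra hyn
      simp only [mem_union, not_or] at hyn
      obtain ⟨hyP, hyE⟩ := hyn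
      have hyN : y ∈ N := closure_minimal (fun z hz => hz.2.1) hNc hy
      rcases hcov (hZ y hyN hyE) with hyw | hyw
      · exact hyP ⟨hyE, hyN, hyw⟩
      · obtain ⟨W, hW, hyW, hWw⟩ := exists_nhds_capBase hw' hyN hyw
        obtain ⟨z, hzW, hzE, hzN, hzw⟩ := mem_closure_iff.1 hy W hW hyW
        exact hno z hzN hzE hzw (hWw z hzN hzW)
  have : y ∈ P := ⟨hyE, hy, hyw⟩
  rwa [hempty] at this

/-- If the caps of the larger component form a connected set, then curves in the extension of the
smaller component which do not disconnect the extension do not disconnect the larger component,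
even if some components of the outer boundary of the extension, but not all, are among them. -/
theorem isPreconnected_compl_capImage (h : TransversalRadius M S s) (ht : TransversalRadius M S t)
    (c : Collar M s δ) (hσ0 : 0 < σ) (hσ : σ < δ) (hδt : s + δ < t)
    (htc : IsPreconnected (surfaceBoundary (originComponent M t))) {Γ : Set E3}
    (hΓ : IsClosed Γ) (hΓE : Γ ⊆ c.extension σ)
    (hEΓ : IsPreconnected ((c.extension σ ∩ ball 0 (s + σ)) \ Γ))
    (hout : ∃ b ∈ surfaceBoundary (originComponent M s), c.toFun b σ ∉ Γ) :
    IsPreconnected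
      (capImage (originComponent M t) (surfaceBoundary (originComponent M t)) Γ)ᶜ := by
  set N := originComponent M t
  set B := surfaceBoundary N
  set Z := (capImage N B Γ)ᶜ with hZ_def
  have hEN : c.extension σ ⊆ N := h.extension_subset_originComponent ht c hσ hδt
  have hσ1 : |σ| < δ := by rwa [abs_of_pos hσ0]
  have hEB : Disjoint (c.extension σ) B := disjoint_left.2 fun x hx hxB => by
    have h1 := (ht.mem_boundary_iff.1 hxB).2
    have h2 := norm_le_of_mem_extension c hσ0.le hx
    linarith
  have hZo : IsOpen Z := (isClosed_capImage hΓ (hEB.mono_left hΓE)).isOpen_compl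
  have hZmem : ∀ y (hy : y ∈ N), capBase N B ⟨y, hy⟩ ∈ Z ↔ y ∉ Γ := fun y hy =>
    not_congr capBase_mem_capImage
  have : PreconnectedSpace B := isPreconnected_iff_preconnectedSpace.1 htc
  have hD : IsPreconnected (range (capCone N B)) := isPreconnected_range continuous_capCone
  have hDZ : range (capCone N B) ⊆ Z := by
    rintro _ ⟨p, rfl⟩ ⟨y, hy, hyp⟩
    have := (eq_of_capSeparate_capBase_eq (congrArg _ hyp)).2
    exact hEB.notMem_of_mem_left (hΓE hy) (this ▸ p.1.2)
  rw [isPreconnected_iff_subset_of_disjoint]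
  intro u v hu hv huv hd
  have hA : IsPreconnected (capImage N B ((c.extension σ ∩ ball 0 (s + σ)) \ Γ)) :=
    isPreconnected_capImage hEΓ fun x hx => hEN hx.1.1
  have hAZ : capImage N B ((c.extension σ ∩ ball 0 (s + σ)) \ Γ) ⊆ Z := by
    rintro _ ⟨y, hy, rfl⟩
    exact (hZmem y y.2).2 hy.2
  wlog hAu : capImage N B ((c.extension σ ∩ ball 0 (s + σ)) \ Γ) ⊆ u generalizing u v
  · have hAv := (isPreconnected_iff_subset_of_disjoint.1 hA u v hu hv (hAZ.trans huv)
      (subset_eq_empty (inter_subset_inter_left _ hAZ) hd)).resolve_left hAu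
    exact (this v u hv hu (by rwa [union_comm]) (by rwa [inter_comm v]) hAv).symm
  have hNM : N ⊆ M := fun y hy => (originComponent_subset hy).2
  have hNloc : ∀ y ∈ N, y ∉ B → ‖y‖ < S ∧ ∃ W, IsOpen W ∧ y ∈ W ∧ M ∩ W ⊆ N := by
    intro y hy hyB
    have hlt : ‖y‖ < t :=
      lt_of_le_of_ne (norm_le hy) fun heq => hyB (ht.mem_boundary_iff.2 ⟨hy, heq⟩)
    obtain ⟨W, hW, hyW, -, hWN⟩ := ht.exists_nhds_of_lt hy hlt
    exact ⟨hlt.trans ht.lt, W, hW, hyW, hWN⟩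
  have hno : ∀ x ∈ Z, x ∈ u → x ∈ v → False := fun x h1 h2 h3 => by
    have h4 : x ∈ Z ∩ (u ∩ v) := ⟨h1, h2, h3⟩
    rwa [hd] at h4
  have hmemN : ∀ b ∈ surfaceBoundary (originComponent M s), ∀ τ ∈ Icc 0 δ, c.toFun b τ ∈ N :=
    fun b hb τ hτ => h.toFun_mem_originComponent ht c hδt hb hτ
  -- the outer boundary of the extension is in the closure of its interior, hence on the same side
  have hbd : ∀ b (hb : b ∈ surfaceBoundary (originComponent M s)), c.toFun b σ ∉ Γ →
      capBase N B ⟨c.toFun b σ, hmemN b hb σ ⟨hσ0.le, hσ.le⟩⟩ ∈ u := by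
    intro b hb hbΓ
    have hbZ := (hZmem _ (hmemN b hb σ ⟨hσ0.le, hσ.le⟩)).2 hbΓ
    refine (huv hbZ).elim id fun hbv => ?_
    obtain ⟨W, hW, hbW, hWv⟩ := exists_nhds_capBase (hv.inter hZo) _ ⟨hbv, hbZ⟩
    have hev := (h.continuousAt_toFun c hb hσ1).eventually (hW.eventually_mem hbW)
    obtain ⟨τ, hτW, hτ⟩ := ((hev.filter_mono nhdsWithin_le_nhds).and (Ico_mem_nhdsLT hσ0)).exists
    have hτδ : τ ∈ Icc 0 δ := ⟨hτ.1, hτ.2.le.trans hσ.le⟩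
    have hτv := hWv _ (hmemN b hb τ hτδ) hτW
    refine (hno _ hτv.2 (hAu ⟨_, ⟨⟨?_, ?_⟩, (hZmem _ _).1 hτv.2⟩, rfl⟩) hτv.1).elim
    · exact (h.toFun_mem_extension_iff c hb hτ.1 hτδ.2).2 (Or.inl hτ.2.le)
    · rw [mem_ball_zero_iff, c.norm_eq b (h.boundary_subset hb) τ
        (by rw [abs_of_nonneg hτ.1]; exact hτδ.2)]
      linarith [hτ.2]
  rcases isPreconnected_iff_subset_of_disjoint.1 hD u v hu hv (hDZ.trans huv)
    (subset_eq_empty (inter_subset_inter_left _ hDZ) hd) with hDu | hDv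
  · left
    intro x hx
    refine (huv hx).elim id fun hxv => ?_
    rcases capBase_or_capCone x with ⟨⟨y, hy⟩, rfl⟩ | ⟨p, rfl⟩
    · have hyE := h.mem_extension_of_caps_subset c hσ0 hσ hNM ht.isCompact.isClosed
        hNloc hΓE hv hu (by rwa [union_comm]) (by rwa [inter_comm v]) hDu hy hxv
      have hyΓ := (hZmem y hy).1 hx
      rcases (norm_le_of_mem_extension c hσ0.le hyE).lt_or_eq with hlt | heq
      · exact hAu ⟨⟨y, hy⟩, ⟨⟨hyE, by simpa using hlt⟩, hyΓ⟩, rfl⟩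
      · have hyE' := hyE.resolve_left fun h1 => by linarith [norm_le h1]
        have h3 : |‖y‖ - s| ≤ δ := abs_le.2 ⟨by linarith, by linarith⟩
        have h4 := c.proj_mem y hyE'.1 h3
        have h5 := c.toFun_proj y hyE'.1 h3
        have h6 : ‖y‖ - s = σ := by linarith
        rw [h6] at h5
        have h7 := hbd _ (h.mem_boundary_iff.2 ⟨hyE'.2.2.2, by simpa using h4.2⟩)
          (by rwa [h5])
        convert h7 using 3
        exact h5.symm
    · exact hDu ⟨p, rfl⟩
  · exfalso
    obtain ⟨b, hb, hbΓ⟩ := hout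
    obtain ⟨W, hW, hbW, hWu⟩ := exists_nhds_capBase hu _ (hbd b hb hbΓ)
    have hev := (h.continuousAt_toFun c hb hσ1).eventually (hW.eventually_mem hbW)
    obtain ⟨τ, hτW, hτ⟩ := ((hev.filter_mono nhdsWithin_le_nhds).and (Ioc_mem_nhdsGT hσ)).exists
    have hτδ : τ ∈ Icc 0 δ := ⟨hσ0.le.trans hτ.1.le, hτ.2⟩
    have hE := h.mem_extension_of_caps_subset c hσ0 hσ hNM ht.isCompact.isClosed hNloc
      hΓE hu hv huv hd hDv (hmemN b hb τ hτδ) (hWu _ _ hτW)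
    rcases (h.toFun_mem_extension_iff c hb hτδ.1 hτδ.2).1 hE with h1 | h1
    · exact absurd hτ.1 (not_lt.2 h1)
    · linarith [hτ.1]

/-- If the boundary of the component in the smaller ball is disconnected and that in the larger
ball is connected, the genus increases: one more curve, parallel to a component of the inner
boundary, does not disconnect. -/
theorem add_one_le_genus (h : TransversalRadius M S s) (ht : TransversalRadius M S t) (hst : s < t)
    (hs : ¬ IsPreconnected (surfaceBoundary (originComponent M s)))
    (htc : IsPreconnected (surfaceBoundary (originComponent M t))) {L : ℕ}
    (hL : genus (originComponent M s) = L) :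
    ((L + 1 : ℕ) : ℕ∞) ≤ genus (originComponent M t) := by
  obtain ⟨δ, hδ, ⟨c⟩⟩ := h.exists_collar hst
  set σ := δ / 2
  have hσ0 : 0 < σ := half_pos c.pos
  have hσ : σ < δ := half_lt_self c.pos
  have hσ1 : |σ| ≤ δ := by rw [abs_of_pos hσ0]; exact hσ.le
  obtain ⟨γ, hγ, hγi, hγd, hγc⟩ := exists_curves_of_closedGenus_eq hL
  obtain ⟨γ', hγ', hγi', hγd', hγE, hγc'⟩ :=
    h.exists_curves_in_extension c hσ0 hσ hγ hγi hγd hγc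
  -- the outer end of the collar over the component of `b₁` is the additional curve, and `b₂` is a
  -- point of another component
  obtain ⟨b₁, b₂, hb⟩ : ∃ b₁ b₂ : surfaceBoundary (originComponent M s),
      (b₁ : ConnectedComponents (surfaceBoundary (originComponent M s))) ≠ b₂ := by
    by_contra! hall
    refine hs (isPreconnected_iff_preconnectedSpace.2 ?_)
    refine ⟨isPreconnected_of_forall_pair fun x _ y _ => ⟨connectedComponent y, subset_univ _,
      ConnectedComponents.coe_eq_coe'.1 (hall x y), mem_connectedComponent,
      isPreconnected_connectedComponent⟩⟩
  have hBc := isCompact_iff_compactSpace.1 h.isCompact_boundary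
  obtain ⟨-, e, he⟩ := exists_homeomorph_connectedComponents_prod_circle h.exists_boundary_arc
  set η : Circle → E3 := fun a => c.toFun (e.symm (b₁, a)) σ
  have hηc : Continuous η := by
    refine c.continuousOn_toFun.comp_continuous
      (f := fun a => ((e.symm ((b₁ : ConnectedComponents _), a) : E3), σ)) ?_
      fun a => ⟨h.boundary_subset (e.symm _).2, abs_le.1 hσ1⟩
    exact (continuous_subtype_val.comp (e.symm.continuous.comp (by fun_prop))).prodMk
      continuous_const
  have hproj : ∀ b ∈ surfaceBoundary (originComponent M s), c.proj (c.toFun b σ) = b :=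
    fun b hb => c.proj_toFun b (h.boundary_subset hb) σ hσ1
  have hηi : Function.Injective η := by
    intro a a' haa
    have h1 := congrArg c.proj haa
    simp only [η, hproj _ (e.symm _).2] at h1
    have h2 := e.symm.injective (Subtype.ext h1)
    exact (Prod.mk.inj h2).2
  have hηn : ∀ a, ‖η a‖ = s + σ := fun a => c.norm_eq _ (h.boundary_subset (e.symm _).2) σ hσ1
  have hηE : ∀ a, η a ∈ c.extension σ := fun a =>
    (h.toFun_mem_extension_iff c (e.symm _).2 hσ0.le hσ.le).2 (Or.inl le_rfl)
  have hγball : ∀ i, ∀ x ∈ range (γ' i), ‖x‖ < s + σ := fun i x hx => by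
    simpa using (hγE i hx).2
  have hηball : ∀ x ∈ range η, ¬ ‖x‖ < s + σ := by
    rintro _ ⟨a, rfl⟩
    rw [hηn]; exact lt_irrefl _
  set ζ : Fin (L + 1) → Circle → E3 := Fin.cons η γ'
  have hζE : ∀ i, range (ζ i) ⊆ c.extension σ := by
    refine Fin.cases ?_ fun i => ?_
    · exact range_subset_iff.2 hηE
    · exact (hγE i).trans inter_subset_left
  have hζc : ∀ i, Continuous (ζ i) := Fin.cases hηc hγ'
  have hζi : ∀ i, Function.Injective (ζ i) := Fin.cases hηi hγi'
  have hηγ : ∀ i, Disjoint (range η) (range (γ' i)) := fun i =>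
    disjoint_left.2 fun x h1 h2 => hηball x h1 (hγball i x h2)
  have hζd : ∀ i j, i ≠ j → Disjoint (range (ζ i)) (range (ζ j)) := by
    refine Fin.cases (Fin.cases (fun h => absurd rfl h) fun j _ => hηγ j) fun i =>
      Fin.cases (fun _ => (hηγ i).symm) fun j hij => hγd' i j fun h => hij (by rw [h])
  have hEN := h.extension_subset_originComponent ht c hσ hδ
  have hN : ∀ i a, ζ i a ∈ originComponent M t := fun i a => hEN (hζE i ⟨a, rfl⟩)
  have hBN : surfaceBoundary (originComponent M t) ⊆ originComponent M t := fun x hx =>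
    (ht.mem_boundary_iff.1 hx).1
  have hpre := preconnectedSpace_cap hBN isPreconnected ⟨0, ht.zero_mem_originComponent⟩
  have hunion : ⋃ i, range (ζ i) = range η ∪ ⋃ i, range (γ' i) := by
    ext x
    simp only [mem_iUnion, mem_union, Fin.exists_fin_succ]
    rfl
  refine le_closedGenus (γ := fun i a => capBase _ _ ⟨ζ i a, hN i a⟩) ?_ ?_ ?_ ?_
  · exact fun i => continuous_capBase.comp ((hζc i).subtype_mk _)
  · exact fun i a a' h => hζi i (congrArg Subtype.val (capBase_injective h))
  · intro i j hij
    rw [range_capBase_comp, range_capBase_comp]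
    refine (disjoint_image_iff capBase_injective).2 (disjoint_left.2 fun x h1 h2 => ?_)
    exact (hζd i j hij).notMem_of_mem_left h1 h2
  · intro x
    simp_rw [range_capBase_comp]
    rw [← capImage_iUnion, PreconnectedSpace.connectedComponent_eq_univ, ← compl_eq_univ_sdiff]
    refine h.isPreconnected_compl_capImage ht c hσ0 hσ hδ htc
      (isClosed_iUnion_of_finite fun i => (isCompact_range (hζc i)).isClosed)
      (iUnion_subset hζE) ?_ ⟨b₂, b₂.2, ?_⟩
    · convert hγc' using 1
      rw [hunion]
      ext x
      simp only [Set.mem_sdiff, mem_union, not_or]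
      refine and_congr_right fun hx => and_iff_right fun hxη => hηball x hxη ?_
      simpa using hx.2
    · rw [hunion]
      rintro (⟨a, ha⟩ | hx)
      · have h1 := congrArg c.proj ha
        simp only [η, hproj _ (e.symm _).2, hproj _ b₂.2] at h1
        have h2 : e.symm (b₁, a) = b₂ := Subtype.ext h1
        have h3 := he b₂
        rw [← h2, e.apply_symm_apply, h2] at h3
        exact hb h3
      · obtain ⟨i, hi⟩ := mem_iUnion.1 hx
        have := hγball i _ hi
        rw [c.norm_eq _ (h.boundary_subset b₂.2) σ hσ1] at this
        exact lt_irrefl _ this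

end TransversalRadius

/-! ### Choice of the radii -/

/-- Radii that are transversal to all the surfaces at once exist in every interval, since a
countable union of null sets is a null set. -/
theorem exists_transversal_radii {S : ℕ → ℝ} {M : ℕ → Set E3}
    (hmin : ∀ i, IsEmbeddedMinimalSurface (M i))
    (hbdry : ∀ i, surfaceBoundary (M i) ⊆ sphere 0 (S i)) :
    ∃ ρ : ℕ → ℝ, StrictMono ρ ∧ (∀ k : ℕ, (k : ℝ) < ρ k) ∧
      ∀ i k, ρ k < S i → MeetsSphereTransversally (M i) (ρ k) := by
  have hex : ∀ k : ℕ, ∃ t ∈ Ioo (k : ℝ) (k + 1),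
      t ∉ ⋃ i, {t | 0 < t ∧ t < S i ∧ ¬ MeetsSphereTransversally (M i) t} := by
    intro k
    by_contra! hall
    have h1 : MeasureTheory.volume (Ioo (k : ℝ) (k + 1)) ≤ 0 := by
      rw [← MeasureTheory.measure_iUnion_null fun i =>
        volume_nontransversal_radii (hmin i) (hbdry i)]
      exact MeasureTheory.measure_mono hall
    rw [Real.volume_Ioo] at h1
    norm_num at h1
  choose ρ hρ hρS using hex
  refine ⟨ρ, strictMono_nat_of_lt_succ fun k => ?_, fun k => (hρ k).1, fun i k hk => ?_⟩
  · have := (hρ (k + 1)).1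
    push_cast at this
    exact (hρ k).2.trans this
  · by_contra hn
    exact hρS k (mem_iUnion.2 ⟨i, (Nat.cast_nonneg k).trans_lt (hρ k).1, hk, hn⟩)

theorem mainTheorem9 (g : ℕ) (S : ℕ → ℝ) (M : ℕ → Set E3)
    (hmin : ∀ i, IsEmbeddedMinimalSurface (M i))
    (hzero : ∀ i, (0 : E3) ∈ M i)
    (hball : ∀ i, M i ⊆ closedBall 0 (S i))
    (hbdry : ∀ i, surfaceBoundary (M i) ⊆ sphere 0 (S i))
    (hgenus : ∀ i, genus (M i) ≤ g)
    (hS : Tendsto S atTop atTop) :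
    ∃ (φ : ℕ → ℕ) (R₀ : ℝ) (R : ℕ → ℝ),
      StrictMono φ ∧ 0 < R₀ ∧ Tendsto R atTop atTop ∧
      (∀ j, R₀ ≤ R j ∧ R j ≤ S (φ j)) ∧
      (∀ j, MeetsSphereTransversally (M (φ j)) R₀ ∧ MeetsSphereTransversally (M (φ j)) (R j)) ∧
      (∀ j, genus (originComponent (M (φ j)) R₀) = genus (originComponent (M (φ j)) (R j)) ∧
        genus (originComponent (M (φ j)) (R j)) ≤ g) ∧
      ((∀ j, ∀ t ∈ Icc R₀ (R j), MeetsSphereTransversally (M (φ j)) t →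
          IsConnected (surfaceBoundary (originComponent (M (φ j)) t))) ∨
        (∀ j, ¬ IsPreconnected (surfaceBoundary (originComponent (M (φ j)) R₀)))) := by
  obtain ⟨ρ, hρm, hρk, hρT⟩ := exists_transversal_radii hmin hbdry
  have hTR : ∀ i t, 0 < t → t < S i → MeetsSphereTransversally (M i) t →
      TransversalRadius (M i) (S i) t := fun i t h1 h2 h3 =>
    ⟨hmin i, hzero i, hbdry i, h1, h2, h3⟩
  have hρ0 : ∀ k, 0 < ρ k := fun k => (Nat.cast_nonneg k).trans_lt (hρk k)
  have hρR : ∀ i k, ρ k < S i → TransversalRadius (M i) (S i) (ρ k) := fun i k hk =>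
    hTR i _ (hρ0 k) hk (hρT i k hk)
  have hSk : ∀ k, ∀ᶠ i in atTop, ρ k < S i := fun k => hS.eventually_gt_atTop _
  set G : ℕ → ℕ → ℕ∞ := fun i k => genus (originComponent (M i) (ρ k)) with hG
  have hGg : ∀ i k, ρ k < S i → G i k ≤ g := fun i k hk =>
    (hρR i k hk).genus_originComponent_le.trans (hgenus i)
  have hGm : ∀ i k l, k ≤ l → ρ l < S i → G i k ≤ G i l := by
    intro i k l hkl hl
    rcases hkl.eq_or_lt with rfl | hkl
    · exact le_rfl
    · exact (hρR i k ((hρm hkl).trans hl)).genus_mono (hρR i l hl) (hρm hkl)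
  -- `L` is the largest genus that occurs, at some radius, infinitely often along the sequence
  classical
  set Q : ℕ → Prop := fun L => ∃ k, ∃ᶠ i in atTop, (L : ℕ∞) ≤ G i k
  set L := Nat.findGreatest Q g
  obtain ⟨K, hK⟩ : Q L :=
    Nat.findGreatest_spec (Nat.zero_le g) ⟨0, Frequently.of_forall fun i => by simp⟩
  have hmax : ∀ k, ∀ᶠ i in atTop, G i k ≤ L := by
    intro k
    have h1 : ¬ Q (L + 1) := by
      intro hQ
      have hle : L + 1 ≤ g := by
        obtain ⟨k, hk⟩ := hQ
        obtain ⟨i, h1, h2⟩ := (hk.and_eventually (hSk k)).exists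
        exact_mod_cast h1.trans (hGg i k h2)
      have := Nat.le_findGreatest hle hQ
      omega
    have h2 := not_frequently.1 (not_exists.1 h1 k)
    filter_upwards [h2] with i hi
    rw [not_le, Nat.cast_add, Nat.cast_one] at hi
    exact Order.le_of_lt_add_one hi
  have hGL : ∀ k, K ≤ k → ∀ᶠ i in atTop, (L : ℕ∞) ≤ G i K → G i k = L := by
    intro k hk
    filter_upwards [hmax k, hSk k] with i h1 h2 h3
    exact le_antisymm h1 (h3.trans (hGm i K k hk h2))
  have hextract : ∀ (k : ℕ) (P : ℕ → ℕ → Prop), K ≤ k →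
      (∀ j, ∃ᶠ i in atTop, (L : ℕ∞) ≤ G i K ∧ P j i) → ∃ φ : ℕ → ℕ, StrictMono φ ∧
      ∀ j, ρ (k + j) < S (φ j) ∧ G (φ j) k = L ∧ G (φ j) (k + j) = L ∧ P j (φ j) := by
    intro k P hk hP
    refine extraction_forall_of_frequently (P := fun j i => ρ (k + j) < S i ∧ G i k = L ∧
      G i (k + j) = L ∧ P j i) fun j => ?_
    refine ((hP j).and_eventually ((hSk (k + j)).and ((hGL k hk).and
      (hGL (k + j) (by omega))))).mono ?_
    rintro i ⟨⟨h1, h2⟩, h3, h4, h5⟩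
    exact ⟨h3, h4 h1, h5 h1, h2⟩
  -- at radii at least `ρ K`, and along indices with `L ≤ G i K`, the genus is `L`; so both
  -- alternatives come down to finding suitable indices infinitely often
  suffices hmain : ∃ (k : ℕ) (P : ℕ → ℕ → Prop), K ≤ k ∧
      (∀ j, ∃ᶠ i in atTop, (L : ℕ∞) ≤ G i K ∧ P j i) ∧
      ((∀ i j, ρ (k + j) < S i → P j i → ∀ t ∈ Icc (ρ k) (ρ (k + j)),
        MeetsSphereTransversally (M i) t → IsConnected (surfaceBoundary (originComponent (M i) t)))
      ∨ ∀ i j, P j i → ¬ IsPreconnected (surfaceBoundary (originComponent (M i) (ρ k)))) by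
    obtain ⟨k, P, hk, hP, hab⟩ := hmain
    obtain ⟨φ, hφ, h⟩ := hextract k P hk hP
    have hkS : ∀ j, ρ k < S (φ j) := fun j => (hρm.monotone (by omega)).trans_lt (h j).1
    refine ⟨φ, ρ k, fun j => ρ (k + j), hφ, hρ0 k, ?_, fun j =>
      ⟨hρm.monotone (by omega), (h j).1.le⟩, fun j => ⟨hρT _ _ (hkS j), hρT _ _ (h j).1⟩,
      fun j => ⟨(h j).2.1.trans (h j).2.2.1.symm, hGg _ _ (h j).1⟩, ?_⟩
    · refine tendsto_atTop_mono (fun j => ?_) tendsto_natCast_atTop_atTop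
      have := hρk (k + j)
      push_cast at this
      linarith [(Nat.cast_nonneg k : (0 : ℝ) ≤ k)]
    · exact hab.imp (fun ha j => ha _ j (h j).1 (h j).2.2.2) fun hb j => hb _ j (h j).2.2.2
  by_cases hcase : ∃ j, ∃ᶠ i in atTop, (L : ℕ∞) ≤ G i K ∧ ∃ t ∈ Icc (ρ K) (ρ (K + j)),
      MeetsSphereTransversally (M i) t ∧
        ¬ IsPreconnected (surfaceBoundary (originComponent (M i) t))
  · -- the boundary stays disconnected at the next radius, since the genus no longer increases
    obtain ⟨j, hj⟩ := hcase
    refine ⟨K + j + 1, fun _ i =>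
      ¬ IsPreconnected (surfaceBoundary (originComponent (M i) (ρ (K + j + 1)))), by omega,
      fun _ => ?_, Or.inr fun i j h => h⟩
    refine (hj.and_eventually ((hSk (K + j + 1)).and (hmax (K + j + 1)))).mono ?_
    rintro i ⟨⟨h1, t, ht, htT, htd⟩, h3, h4⟩
    refine ⟨h1, fun hpre => ?_⟩
    have htlt : t < ρ (K + j + 1) := ht.2.trans_lt (hρm (by omega))
    have hTt := hTR i t ((hρ0 K).trans_le ht.1) (htlt.trans h3) htT
    have hT := hρR i _ h3
    have hge : (L : ℕ∞) ≤ genus (originComponent (M i) t) := by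
      rcases ht.1.eq_or_lt with h5 | h5
      · rw [← h5]; exact h1
      · exact h1.trans ((hρR i K (h5.trans (htlt.trans h3))).genus_mono hTt h5)
    have hle := (hTt.genus_mono hT htlt).trans h4
    have h6 := (hTt.add_one_le_genus hT htlt htd hpre (le_antisymm hle hge)).trans h4
    have h7 : L + 1 ≤ L := by exact_mod_cast h6
    omega
  · refine ⟨K, fun j i => ∀ t ∈ Icc (ρ K) (ρ (K + j)), MeetsSphereTransversally (M i) t →
      IsPreconnected (surfaceBoundary (originComponent (M i) t)), le_rfl, fun j => ?_,
      Or.inl fun i j hS' hP t ht htT => ?_⟩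
    · have h1 := not_frequently.1 (not_exists.1 hcase j)
      refine (hK.and_eventually h1).mono ?_
      rintro i ⟨h2, h3⟩
      refine ⟨h2, fun t ht htT => ?_⟩
      by_contra hn
      exact h3 ⟨h2, t, ht, htT, hn⟩
    · have hTt := hTR i t ((hρ0 K).trans_le ht.1) (ht.2.trans_lt hS') htT
      exact ⟨hTt.surfaceBoundary_nonempty, hP t ht htT⟩
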